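/- Fix an integer $\delta\ge 2$. On $(0,\pi/2)$ let $d\mu=\sin^2(x)\cos^{2\delta-2}(x)\,dx$, $W(x)=\cos^{2\delta-2}(x)$, and let $(\cdot|\cdot)$ be the inner product of $L^2(d\mu)$. Let $H^1(d\mu)$ be the space of $u\in L^2(d\mu)$ with weak derivative $u'\in L^2(d\mu)$, with inner product $(u'|v')+(u|v)$, and let $\mathcal P=H^1(d\mu)\times L^2(d\mu)$ be the product Hilbert space. Let $L$ be the self-adjoint operator generated by the form $\alpha(u,v)=(u'|v')+\delta^2(u|v)$ on $H^1(d\mu)$ (so $Lu=-\tfrac1w\partial_x(w\,\partial_xu)+\delta^2u$ with $w=\sin^2\cos^{2\delta-2}$), the linearised operator of the Klein–Gordon model $\partial_t^2\phi+L\phi=-\epsilon^2W\phi^3$. Its lowest eigenvalue is $\omega_0^2=\delta^2$, with constant normalised eigenfunction $$e_0=\frac{2}{\pi^{1/4}}\sqrt{\frac{\delta\,\Gamma(\delta)}{\Gamma(\delta-\frac12)}}.$$ For $\zeta=(\zeta_1,\zeta_2)\in\mathcal P$ let $h_\Omega(\zeta)=\alpha(\zeta_1,\zeta_1)+\|\zeta_2\|_{L^2(d\mu)}^2$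 be the harmonic energy, let $\Phi^t(\zeta)$ be the unique continuous curve in $\mathcal P$ that solves $\partial_t\phi_1=\phi_2$, $\partial_t\phi_2=-L\phi_1$, $\phi(0)=\zeta$ (weakly, that is, tested against every $v\in H^1(d\mu)$), and put $$f(\zeta)=\frac14\int_0^{\pi/2}W\zeta_1^4\,d\mu,\qquad \langle f\rangle(\zeta)=\frac1{2\pi}\int_0^{2\pi}f(\Phi^t(\zeta))\,dt .$$ Let $\kappa_0=\pm\omega_0\sqrt{8/(3C_{0000})}$ with $C_{0000}=\int_0^{\pi/2} We_0^4\,d\mu$, let $\xi=(\kappa_0e_0,0)$, $\Sigma=\{\zeta\in\mathcal P:h_\Omega(\zeta)=\kappa_0^2\omega_0^2\}$, $T_\xi\Sigma=\ker dh_\Omega(\xi)$, and let $T_\xi\Gamma_{\rm linear}(\xi)$ be the line spanned by $\partial_t\Phi^t(\xi)|_{t=0}$. Then the linear flow is well defined, $\xi\in\Sigma$, $\xi$ is a critical point of $\langle f\rangle|_\Sigma$, and the second differential $d^2(\langle f\rangle|_\Sigma)(\xi)$ exists: there is a symmetric bounded bilinear form on $T_\xi\Sigma$ whose value at $(X,X)$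 is $\frac{d^2}{ds^2}\langle f\rangle(\gamma(s))|_{s=0}$ for every $C^2$ curve $\gamma$ in $\Sigma$ with $\gamma(0)=\xi$, $\gamma'(0)=X$. Moreover, $\delta\in\{2,3,\dots,9\}$ if and only if there is a constant $c_\perp=c_\perp(\delta)>0$ such that $$-d^2(\langle f\rangle|_\Sigma)(\xi)(X,X)\ \ge\ c_\perp\|X\|_{\mathcal P}^2\qquad\text{for all }X\in T_\xi\Sigma\text{ orthogonal in }\mathcal P\text{ to }T_\xi\Gamma_{\rm linear}(\xi).$$ In this case $\xi$ is a local maximum of $\langle f\rangle|_\Sigma$ (nondegenerate transversally to the linear orbit, by the inequality above). -/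

import Mathlib

open MeasureTheory Set Filter Topology
open scoped ContDiff InnerProductSpace

namespace KG

noncomputable section

/-- The spatial weight `w(x) = sin² x cos^(2δ-2) x`. -/
def weight (δ : ℕ) (x : ℝ) : ℝ := Real.sin x ^ 2 * Real.cos x ^ (2 * δ - 2)

/-- The weight `W(x) = cos^(2δ-2) x` in front of the cubic non-linearity. -/
def nonlinWeight (δ : ℕ) (x : ℝ) : ℝ := Real.cos x ^ (2 * δ - 2)

/-- The interval `(0, π/2)`. -/
abbrev I : Set ℝ := Ioo 0 (Real.pi / 2)

/-- The measure `dμ = w(x) dx` on `(0, π/2)`. -/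
def mu (δ : ℕ) : Measure ℝ :=
  (volume.restrict I).withDensity fun x => ENNReal.ofReal (weight δ x)

/-- `L²((0, π/2); dμ)`. -/
abbrev L2 (δ : ℕ) : Type := Lp ℝ 2 (mu δ)

/-- `v` is the weak derivative of `u` on `(0, π/2)`, tested against `C_c^∞((0, π/2))`. -/
def HasWeakDeriv (u v : ℝ → ℝ) : Prop :=
  ∀ ψ : ℝ → ℝ, ContDiff ℝ ∞ ψ → HasCompactSupport ψ → tsupport ψ ⊆ I →
    ∫ x in I, u x * deriv ψ x = -∫ x in I, v x * ψ x

theorem measurable_weight (δ : ℕ) : Measurable (weight δ) := by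
  unfold weight; fun_prop

theorem weight_pos {δ : ℕ} {x : ℝ} (hx : x ∈ I) : 0 < weight δ x := by
  have h1 : 0 < Real.sin x := Real.sin_pos_of_pos_of_lt_pi hx.1 (by linarith [hx.2, Real.pi_pos])
  have h2 : 0 < Real.cos x := Real.cos_pos_of_mem_Ioo ⟨by linarith [hx.1, Real.pi_pos], hx.2⟩
  unfold weight; positivity

theorem weight_le_one (δ : ℕ) (x : ℝ) : weight δ x ≤ 1 := by
  unfold weight
  have h1 : Real.sin x ^ 2 ≤ 1 := Real.sin_sq_le_one x
  have h2 : Real.cos x ^ (2 * δ - 2) ≤ 1 := by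
    rw [show 2 * δ - 2 = 2 * (δ - 1) by omega, pow_mul]
    exact pow_le_one₀ (sq_nonneg _) (Real.cos_sq_le_one x)
  have h3 : 0 ≤ Real.cos x ^ (2 * δ - 2) := by
    rw [show 2 * δ - 2 = 2 * (δ - 1) by omega, pow_mul]
    exact pow_nonneg (sq_nonneg _) _
  nlinarith [sq_nonneg (Real.sin x)]

instance isFiniteMeasure_mu (δ : ℕ) : IsFiniteMeasure (mu δ) := by
  refine isFiniteMeasure_withDensity (ne_of_lt ?_)
  calc ∫⁻ x in I, ENNReal.ofReal (weight δ x)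
      ≤ ∫⁻ _ in I, 1 := lintegral_mono fun x => by
        simpa using weight_le_one δ x
    _ < ⊤ := by simp

theorem restrict_absolutelyContinuous_mu (δ : ℕ) : volume.restrict I ≪ mu δ := by
  refine withDensity_absolutelyContinuous' ?_ ?_
  · exact (measurable_weight δ).ennreal_ofReal.aemeasurable
  · filter_upwards [ae_restrict_mem measurableSet_Ioo] with x hx
    simpa using weight_pos hx

/-- Elements of `L²(dμ)` are integrable over `(0, π/2)` against test functions. -/
theorem integrable_mul_test {δ : ℕ} (u : L2 δ) {ψ : ℝ → ℝ} (hc : Continuous ψ)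
    (hs : HasCompactSupport ψ) (ht : tsupport ψ ⊆ I) :
    Integrable (fun x => u x * ψ x) (volume.restrict I) := by
  have hwc : Continuous (weight δ) := by unfold weight; fun_prop
  obtain ⟨C, hC⟩ : ∃ C, ∀ x ∈ tsupport ψ, ‖ψ x / weight δ x‖ ≤ C :=
    hs.isCompact.exists_bound_of_continuousOn
      (hc.continuousOn.div hwc.continuousOn fun x hx => (weight_pos (ht hx)).ne')
  have hb : ∀ x, ‖ψ x / weight δ x‖ ≤ max C 0 := fun x => by
    by_cases hx : x ∈ tsupport ψ
    · exact (hC x hx).trans (le_max_left _ _)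
    · simp [image_eq_zero_of_notMem_tsupport hx]
  have hu : Integrable u (mu δ) := (Lp.memLp u).integrable (by norm_num)
  have hp : Integrable (fun x => u x * (ψ x / weight δ x)) (mu δ) :=
    hu.mul_bdd (c := max C 0)
      (hc.measurable.div (measurable_weight δ)).aestronglyMeasurable (ae_of_all _ hb)
  unfold mu at hp
  rw [integrable_withDensity_iff_integrable_smul' (measurable_weight δ).ennreal_ofReal
    (ae_of_all _ fun _ => ENNReal.ofReal_lt_top)] at hp
  refine hp.congr ?_
  filter_upwards [ae_restrict_mem measurableSet_Ioo] with x hx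
  have h := weight_pos (δ := δ) hx
  rw [ENNReal.toReal_ofReal h.le, smul_eq_mul, mul_left_comm, mul_div_cancel₀ _ h.ne']
  rfl

theorem HasWeakDeriv.congr {u u' v v' : ℝ → ℝ} (h : HasWeakDeriv u v)
    (hu : u' =ᵐ[volume.restrict I] u) (hv : v' =ᵐ[volume.restrict I] v) :
    HasWeakDeriv u' v' := by
  intro ψ h1 h2 h3
  have e1 : ∫ x in I, u' x * deriv ψ x = ∫ x in I, u x * deriv ψ x :=
    integral_congr_ae (by filter_upwards [hu] with x hx; rw [hx])
  have e2 : ∫ x in I, v' x * ψ x = ∫ x in I, v x * ψ x :=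
    integral_congr_ae (by filter_upwards [hv] with x hx; rw [hx])
  rw [e1, e2, h ψ h1 h2 h3]

theorem hasWeakDeriv_const (c : ℝ) : HasWeakDeriv (fun _ => c) (fun _ => 0) := by
  intro ψ h1 h2 h3
  have hd : Continuous (deriv ψ) := h1.continuous_deriv (by simp)
  have h0 : ∫ x, deriv ψ x = 0 :=
    integral_eq_zero_of_hasDerivAt_of_integrable
      (fun x => (h1.differentiable (by simp) x).hasDerivAt)
      (hd.integrable_of_hasCompactSupport h2.deriv)
      (h1.continuous.integrable_of_hasCompactSupport h2)
  have h4 : ∫ x in I, deriv ψ x = 0 := by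
    rw [setIntegral_eq_integral_of_forall_compl_eq_zero, h0]
    intro x hx
    exact image_eq_zero_of_notMem_tsupport
      fun hx' => hx (h3 (tsupport_deriv_subset hx'))
  simp [integral_const_mul, h4]

/-- The weighted Sobolev space `H¹((0, π/2); dμ)`, realised as the space of pairs `(u, u')` with
`u ∈ L²(dμ)` and weak derivative `u' ∈ L²(dμ)`. The inner product inherited from
`L²(dμ) × L²(dμ)` is `(u' | v') + (u | v)`. -/
def H1 (δ : ℕ) : Submodule ℝ (WithLp 2 (L2 δ × L2 δ)) where
  carrier := {p | HasWeakDeriv p.fst p.snd}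
  zero_mem' := by
    have h := restrict_absolutelyContinuous_mu δ
    exact (hasWeakDeriv_const 0).congr (h.ae_le (Lp.coeFn_zero ℝ 2 (mu δ)))
      (h.ae_le (Lp.coeFn_zero ℝ 2 (mu δ)))
  add_mem' := by
    intro p q hp hq
    have h := restrict_absolutelyContinuous_mu δ
    refine HasWeakDeriv.congr (u := fun x => p.fst x + q.fst x)
      (v := fun x => p.snd x + q.snd x) ?_ (h.ae_le (Lp.coeFn_add p.fst q.fst))
      (h.ae_le (Lp.coeFn_add p.snd q.snd))
    intro ψ h1 h2 h3
    have hd : Continuous (deriv ψ) := h1.continuous_deriv (by simp)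
    have ht := (tsupport_deriv_subset (f := ψ)).trans h3
    simp only [add_mul]
    rw [integral_add (integrable_mul_test _ hd h2.deriv ht)
        (integrable_mul_test _ hd h2.deriv ht),
      integral_add (integrable_mul_test _ h1.continuous h2 h3)
        (integrable_mul_test _ h1.continuous h2 h3), hp ψ h1 h2 h3, hq ψ h1 h2 h3]
    ring
  smul_mem' := by
    intro c p hp
    have h := restrict_absolutelyContinuous_mu δ
    refine HasWeakDeriv.congr (u := fun x => c * p.fst x) (v := fun x => c * p.snd x) ?_
      (h.ae_le (Lp.coeFn_smul c p.fst)) (h.ae_le (Lp.coeFn_smul c p.snd))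
    intro ψ h1 h2 h3
    simp only [mul_assoc, integral_const_mul]
    rw [hp ψ h1 h2 h3]
    ring

/-- The inclusion of `H¹` in `L²`. -/
def value {δ : ℕ} (u : H1 δ) : L2 δ := u.1.fst

/-- The weak derivative of an element of `H¹`. -/
def weakDer {δ : ℕ} (u : H1 δ) : L2 δ := u.1.snd

/-- The constant function `c` as an element of `H¹`. -/
def constH1 (δ : ℕ) (c : ℝ) : H1 δ :=
  ⟨WithLp.toLp 2 ((memLp_const (μ := mu δ) (p := 2) c).toLp (fun _ => c), 0), by
    have h := restrict_absolutelyContinuous_mu δ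
    exact (hasWeakDeriv_const c).congr
      (h.ae_le (MemLp.coeFn_toLp (memLp_const (μ := mu δ) (p := 2) c)))
      (h.ae_le (Lp.coeFn_zero ℝ 2 (mu δ)))⟩

/-- The form `α(u, v) = ∫ u' v' dμ + δ² ∫ u v dμ` generating
`L = -w⁻¹ ∂ₓ (w ∂ₓ ·) + δ²`; in particular `‖L^{1/2} u‖² = α(u, u)`. -/
def form {δ : ℕ} (u v : H1 δ) : ℝ := ⟪weakDer u, weakDer v⟫_ℝ + (δ : ℝ) ^ 2 * ⟪value u, value v⟫_ℝ

/-- The phase space `P = H¹ × L²` with its Hilbert space norm. -/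
abbrev Phase (δ : ℕ) : Type := WithLp 2 (H1 δ × L2 δ)

/-- The harmonic energy `h_Ω(ζ) = ∫ ((L^{1/2} ζ₁)² + ζ₂²) dμ`. -/
def harmonicEnergy {δ : ℕ} (ζ : Phase δ) : ℝ := form ζ.fst ζ.fst + ‖ζ.snd‖ ^ 2

/-- `φ` is the (continuous in time, weak in space) solution of the linear system
`∂ₜ φ₁ = φ₂`, `∂ₜ φ₂ = -L φ₁` with initial data `ζ`. -/
structure IsLinearSolution {δ : ℕ} (ζ : Phase δ) (φ : ℝ → Phase δ) : Prop where
  continuous : Continuous φ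
  initial : φ 0 = ζ
  deriv_fst : ∀ (v : H1 δ) (t : ℝ),
    HasDerivAt (fun s => ⟪value (φ s).fst, value v⟫_ℝ) ⟪(φ t).snd, value v⟫_ℝ t
  deriv_snd : ∀ (v : H1 δ) (t : ℝ),
    HasDerivAt (fun s => ⟪(φ s).snd, value v⟫_ℝ) (-form (φ t).fst v) t

open Classical in
/-- The linear flow `Φᵗ(ζ) = e^{At} ζ`. -/
def linearFlow {δ : ℕ} (t : ℝ) (ζ : Phase δ) : Phase δ :=
  if h : ∃ φ, IsLinearSolution ζ φ then h.choose t else 0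

/-- `f(φ) = 1/4 ∫ W φ₁⁴ dμ`. -/
def quartic {δ : ℕ} (ζ : Phase δ) : ℝ :=
  1 / 4 * ∫ x, nonlinWeight δ x * (value ζ.fst x) ^ 4 ∂mu δ

/-- The time average `⟨f⟩` of `f` over the linear flow. -/
def averaged {δ : ℕ} (ζ : Phase δ) : ℝ :=
  1 / (2 * Real.pi) * ∫ t in (0 : ℝ)..(2 * Real.pi), quartic (linearFlow t ζ)

/-- The first eigenfunction `e₀`, a constant. -/
def e0 (δ : ℕ) : ℝ :=
  2 / Real.pi ^ (1 / 4 : ℝ) * Real.sqrt (δ * Real.Gamma δ / Real.Gamma (δ - 1 / 2))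

/-- The Fourier coefficient `C₀₀₀₀ = ∫ W e₀⁴ dμ`. -/
def C0000 (δ : ℕ) : ℝ := ∫ x, nonlinWeight δ x * e0 δ ^ 4 ∂mu δ

/-- The rescaled first mode `ξ = (κ e₀, 0)`. -/
def mode (δ : ℕ) (κ : ℝ) : Phase δ := WithLp.toLp 2 (constH1 δ (κ * e0 δ), 0)

/-- The hypersurface `Σ = {h_Ω = κ² ω₀²}` of constant harmonic energy, where `ω₀ = δ`. -/
def energySurface (δ : ℕ) (κ : ℝ) : Set (Phase δ) :=
  {ζ | harmonicEnergy ζ = κ ^ 2 * (δ : ℝ) ^ 2}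

/-- The tangent space `T_ξ Σ = ker dh_Ω(ξ)`. -/
def tangentSurface (δ : ℕ) (κ : ℝ) : Submodule ℝ (Phase δ) :=
  LinearMap.ker (fderiv ℝ (harmonicEnergy (δ := δ)) (mode δ κ)).toLinearMap

/-- The tangent line at `ξ` to the linear orbit `t ↦ Φᵗ(ξ)`. -/
def tangentOrbit (δ : ℕ) (κ : ℝ) : Submodule ℝ (Phase δ) :=
  Submodule.span ℝ {deriv (fun t => linearFlow t (mode δ κ)) 0}

end

/-- `ξ` is a critical point of `g|_S`: the derivative of `g` along every `C¹` curve in `S`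
through `ξ` vanishes at `ξ`. -/
def IsCriticalPointOn {E : Type*} [NormedAddCommGroup E] [NormedSpace ℝ E]
    (g : E → ℝ) (S : Set E) (ξ : E) : Prop :=
  ∀ γ : ℝ → E, ContDiff ℝ 1 γ → (∀ s, γ s ∈ S) → γ 0 = ξ → HasDerivAt (g ∘ γ) 0 0

/-- The symmetric bounded bilinear form `B` on `T = T_ξ S` is the second differential
`d²(g|_S)(ξ)` at a critical point `ξ` of `g|_S`: for every `C²` curve `γ` in `S` with `γ(0) = ξ` and
`γ'(0) = X`, the second derivative of `g ∘ γ` at `0` exists and equals `B(X, X)`. -/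
def IsSecondDifferentialOn {E : Type*} [NormedAddCommGroup E] [NormedSpace ℝ E]
    (g : E → ℝ) (S : Set E) (ξ : E) (T : Submodule ℝ E) (B : T →L[ℝ] T →L[ℝ] ℝ) : Prop :=
  (∀ X Y : T, B X Y = B Y X) ∧
  ∀ (X : T) (γ : ℝ → E), ContDiff ℝ 2 γ → (∀ s, γ s ∈ S) → γ 0 = ξ → deriv γ 0 = X →
    (∀ᶠ s in 𝓝 0, DifferentiableAt ℝ (g ∘ γ) s) ∧ HasDerivAt (deriv (g ∘ γ)) (B X X) 0

end KG

/-! ### The measure, weak derivatives, completeness of `H1`, integration by parts up to the end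
points -/

namespace KG

noncomputable section

/-! ### Integration against `dμ` -/

/-! In the variable `y = cos² x` the operator `L` acts on polynomials, and its eigenfunctions `e_n`
are polynomials of degree `n` in `y` (Jacobi polynomials) with frequencies `ω_n = δ + 2n`. They are
complete in `L²(dμ)` and in `H¹` (`basisL2`, `basisH1`), so the linear flow is a family of
independent oscillators, and it is `2π`-periodic because all `ω_n` are integers.

A weighted Sobolev inequality (`lintegral_rootWeight_le`) makes `(u, v) ↦ √(wW) u v` bounded from
`H¹ × H¹` to `L²(dx)`. Hence `⟨f⟩(ζ) = ‖q(ζ, ζ)‖² / (8π)` for a bounded symmetric bilinear map `q =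
orbitMul` (`averaged_eq`), and all derivatives along curves follow from the product rule.

The value of `κ₀` makes `ξ` critical with Lagrange multiplier `1/2`: `d⟨f⟩(ξ) = dh_Ω(ξ) / 2`
(`hessForm_mode_eq_energyForm`). On `T_ξΣ` the second differential is therefore `(3/2π) ⟪q(ξ, ξ),
q(X, X)⟫ - h_Ω(X)`. This form is diagonal in the modes (`hessForm_modeVec_of_ne`): for `n ≠ m` the
time average vanishes unless `|n - m| = δ`, and then the spatial integral `∫ W e₀² e_n e_m dμ`
vanishes, since `W = y^(δ-1)` and `e_m` is orthogonal to polynomials of lower degree.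

Write `C_n = ∫ W e₀² e_n² dμ` and let `a_n`, `b_n` be the position and momentum coefficients. On
tangent vectors orthogonal to the orbit, which are those without component in mode `0`, the negative
second differential is `∑_{n ≥ 1} (1 - 2δ² C_n / (ω_n² C_0)) (ω_n² a_n² + b_n²)`. For `2 ≤ δ ≤ 9`
the quotient is at most `98/100`: exact rational arithmetic covers `n ≤ 6`, and the trivial bound `W
≤ 1` covers `n ≥ 7` (`quadCoeff_le`). For `δ ≥ 10` the quotient is at least `1` already at `n = 1`
(`le_quadCoeff_one`).

For the local maximum, the flow invariance of `⟨f⟩` and `h_Ω` allows the momentum of mode `0` to be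
rotated away. The quartic `⟨f⟩` is then expanded exactly around a multiple of `e₀`, and energy
conservation turns the loss of amplitude in mode `0` into a negative term that dominates the rest.
-/

theorem continuous_weight (δ : ℕ) : Continuous (weight δ) := by unfold weight; fun_prop

theorem mu_absolutelyContinuous (δ : ℕ) : mu δ ≪ volume.restrict I :=
  withDensity_absolutelyContinuous _ _

theorem ae_mem_I (δ : ℕ) : ∀ᵐ x ∂mu δ, x ∈ I :=
  (mu_absolutelyContinuous δ).ae_le (ae_restrict_mem measurableSet_Ioo)

theorem integral_mu (δ : ℕ) (f : ℝ → ℝ) : ∫ x, f x ∂mu δ = ∫ x in I, weight δ x * f x := by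
  unfold mu
  rw [integral_withDensity_eq_integral_toReal_smul (measurable_weight δ).ennreal_ofReal
    (ae_of_all _ fun _ => ENNReal.ofReal_lt_top)]
  refine integral_congr_ae ?_
  filter_upwards [ae_restrict_mem measurableSet_Ioo] with x hx
  rw [ENNReal.toReal_ofReal (weight_pos hx).le, smul_eq_mul]

theorem integrable_mu_iff (δ : ℕ) (f : ℝ → ℝ) :
    Integrable f (mu δ) ↔ IntegrableOn (fun x => weight δ x * f x) I := by
  unfold mu
  rw [integrable_withDensity_iff_integrable_smul' (measurable_weight δ).ennreal_ofReal
    (ae_of_all _ fun _ => ENNReal.ofReal_lt_top)]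
  refine integrable_congr ?_
  filter_upwards [ae_restrict_mem measurableSet_Ioo] with x hx
  rw [ENNReal.toReal_ofReal (weight_pos hx).le, smul_eq_mul]

theorem L2.integrable_weight_mul {δ : ℕ} (u : L2 δ) :
    IntegrableOn (fun x => weight δ x * u x) I :=
  (integrable_mu_iff δ _).1 ((Lp.memLp u).integrable (by norm_num))

theorem L2.aestronglyMeasurable_restrict {δ : ℕ} (u : L2 δ) :
    AEStronglyMeasurable u (volume.restrict I) :=
  (Lp.aestronglyMeasurable u).mono_ac (restrict_absolutelyContinuous_mu δ)

theorem L2.inner_eq {δ : ℕ} (u v : L2 δ) : ⟪u, v⟫_ℝ = ∫ x, u x * v x ∂mu δ := by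
  rw [MeasureTheory.L2.inner_def]
  exact integral_congr_ae (ae_of_all _ fun x => by simp [mul_comm])

theorem L2.inner_toLp {δ : ℕ} (u : L2 δ) {F : ℝ → ℝ} (hF : MemLp F 2 (mu δ)) :
    ⟪u, hF.toLp F⟫_ℝ = ∫ x, u x * F x ∂mu δ := by
  rw [L2.inner_eq]
  refine integral_congr_ae ?_
  filter_upwards [hF.coeFn_toLp] with x hx
  rw [hx]

theorem memLp_of_continuous (δ : ℕ) {F : ℝ → ℝ} (hF : Continuous F) (p : ENNReal) :
    MemLp F p (mu δ) := by
  obtain ⟨C, hC⟩ := (isCompact_Icc (a := (0 : ℝ)) (b := Real.pi / 2)).exists_bound_of_continuousOn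
    hF.continuousOn
  refine MemLp.of_bound hF.aestronglyMeasurable C ?_
  filter_upwards [ae_mem_I δ] with x hx
  exact hC x (Ioo_subset_Icc_self hx)

/-! ### Weak derivatives -/

theorem HasWeakDeriv.of_contDiff {F : ℝ → ℝ} (hF : ContDiff ℝ 1 F) : HasWeakDeriv F (deriv F) := by
  intro ψ h1 h2 h3
  have hdψ : Continuous (deriv ψ) := h1.continuous_deriv (by simp)
  have hdF : Continuous (deriv F) := hF.continuous_deriv le_rfl
  have key := integral_mul_deriv_eq_deriv_mul_of_integrable (u := F) (v := ψ)
    (u' := deriv F) (v' := deriv ψ)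
    (fun x _ => (hF.differentiable (by simp) x).hasDerivAt)
    (fun x _ => (h1.differentiable (by simp) x).hasDerivAt)
    ((hF.continuous.mul hdψ).integrable_of_hasCompactSupport h2.deriv.mul_left)
    ((hdF.mul h1.continuous).integrable_of_hasCompactSupport h2.mul_left)
    ((hF.continuous.mul h1.continuous).integrable_of_hasCompactSupport h2.mul_left)
  rw [setIntegral_eq_integral_of_forall_compl_eq_zero,
    setIntegral_eq_integral_of_forall_compl_eq_zero, key]
  · intro x hx
    rw [image_eq_zero_of_notMem_tsupport fun hx' => hx (h3 hx'), mul_zero]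
  · intro x hx
    rw [image_eq_zero_of_notMem_tsupport fun hx' => hx (h3 (tsupport_deriv_subset hx')), mul_zero]

/-- A continuously differentiable function as an element of `H¹`. -/
def ofSmooth (δ : ℕ) (F : ℝ → ℝ) (hF : ContDiff ℝ 1 F) : H1 δ :=
  ⟨WithLp.toLp 2 ((memLp_of_continuous δ hF.continuous 2).toLp F,
      (memLp_of_continuous δ (hF.continuous_deriv le_rfl) 2).toLp (deriv F)), by
    have h := restrict_absolutelyContinuous_mu δ
    exact (HasWeakDeriv.of_contDiff hF).congr 
      (h.ae_le (MemLp.coeFn_toLp (memLp_of_continuous δ hF.continuous 2)))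
      (h.ae_le (MemLp.coeFn_toLp (memLp_of_continuous δ (hF.continuous_deriv le_rfl) 2)))⟩

theorem value_ofSmooth_ae (δ : ℕ) (F : ℝ → ℝ) (hF : ContDiff ℝ 1 F) :
    value (ofSmooth δ F hF) =ᵐ[mu δ] F :=
  MemLp.coeFn_toLp (memLp_of_continuous δ hF.continuous 2)

theorem weakDer_ofSmooth_ae (δ : ℕ) (F : ℝ → ℝ) (hF : ContDiff ℝ 1 F) :
    weakDer (ofSmooth δ F hF) =ᵐ[mu δ] deriv F :=
  MemLp.coeFn_toLp (memLp_of_continuous δ (hF.continuous_deriv le_rfl) 2)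

/-- The weight is bounded below on compact subsets of the open interval, so `v` is locally
integrable for `dx` and the fundamental lemma of the calculus of variations applies. -/
theorem eq_zero_of_integral_test {δ : ℕ} (v : L2 δ)
    (h : ∀ ψ : ℝ → ℝ, ContDiff ℝ ∞ ψ → HasCompactSupport ψ → tsupport ψ ⊆ I →
      ∫ x in I, v x * ψ x = 0) : v = 0 := by
  have hloc : LocallyIntegrableOn v I volume := by
    rw [locallyIntegrableOn_iff isOpen_Ioo.isLocallyClosed]
    intro k hk hkc
    have hm : MeasurableSet k := hkc.measurableSet
    have hw : IntegrableOn (fun x => weight δ x * v x) k :=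
      (L2.integrable_weight_mul v).mono_set hk
    obtain ⟨C, hC⟩ : ∃ C, ∀ x ∈ k, ‖(weight δ x)⁻¹‖ ≤ C :=
      hkc.exists_bound_of_continuousOn
        ((continuous_weight δ).continuousOn.inv₀ fun x hx => (weight_pos (hk hx)).ne')
    have h2 : IntegrableOn (fun x => (weight δ x)⁻¹ * (weight δ x * v x)) k :=
      Integrable.bdd_mul (c := C) hw (measurable_weight δ).inv.aestronglyMeasurable
        ((ae_restrict_iff' hm).2 (ae_of_all _ hC))
    refine h2.congr_fun (fun x hx => ?_) hm
    have := (weight_pos (δ := δ) (hk hx)).ne'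
    field_simp
  have h0 := isOpen_Ioo.ae_eq_zero_of_integral_contDiff_smul_eq_zero hloc fun ψ h1 h2 h3 => by
    rw [← h ψ h1 h2 h3, setIntegral_eq_integral_of_forall_compl_eq_zero]
    · simp [mul_comm]
    · intro x hx
      rw [image_eq_zero_of_notMem_tsupport fun hx' => hx (h3 hx'), mul_zero]
  rw [Lp.eq_zero_iff_ae_eq_zero]
  refine (mu_absolutelyContinuous δ).ae_le ?_
  exact (ae_restrict_iff' measurableSet_Ioo).2 h0

/-- A function determines its weak derivative. Elements of `H1` are pairs, and this allows them to
be compared through the first component alone. -/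
theorem value_injective {δ : ℕ} {u : H1 δ} (h : value u = 0) : u = 0 := by
  have h2 : weakDer u = 0 := by
    refine eq_zero_of_integral_test _ fun ψ h1 h2 h3 => ?_
    have h4 := u.2 ψ h1 h2 h3
    have h5 : ∫ x in I, (u.1.fst : ℝ → ℝ) x * deriv ψ x = 0 := by
      rw [show u.1.fst = 0 from h]
      refine integral_eq_zero_of_ae ?_
      filter_upwards [(restrict_absolutelyContinuous_mu δ).ae_le (Lp.coeFn_zero ℝ 2 (mu δ))]
        with x hx
      rw [hx]
      simp
    rw [h5] at h4
    exact neg_eq_zero.1 h4.symm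
  apply Subtype.ext
  apply (WithLp.equiv 2 _).injective
  exact Prod.ext h h2

/-- Integration over `(0, π/2)` against a test function is a continuous functional on `L²(dμ)`. -/
theorem continuous_integral_test (δ : ℕ) {ψ : ℝ → ℝ} (hc : Continuous ψ)
    (ht : tsupport ψ ⊆ I) :
    Continuous fun u : L2 δ => ∫ x in I, u x * ψ x := by
  -- The functional is the inner product with `ψ / w`. This quotient is continuous on all of `ℝ`: `w
  -- > 0` on the support of `ψ`, and off the support the quotient is locally zero.
  have hcont : Continuous fun x => ψ x / weight δ x := by
    rw [continuous_iff_continuousAt]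
    intro x
    by_cases hx : x ∈ tsupport ψ
    · exact hc.continuousAt.div (continuous_weight δ).continuousAt (weight_pos (ht hx)).ne'
    · have : (fun x => ψ x / weight δ x) =ᶠ[𝓝 x] fun _ => 0 := by
        filter_upwards [(isClosed_tsupport ψ).isOpen_compl.mem_nhds hx] with y hy
        rw [image_eq_zero_of_notMem_tsupport hy, zero_div]
      exact this.continuousAt
  have : (fun u : L2 δ => ∫ x in I, u x * ψ x) =
      fun u => ⟪u, (memLp_of_continuous δ hcont 2).toLp _⟫_ℝ := by
    funext u
    rw [L2.inner_toLp, integral_mu]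
    refine setIntegral_congr_fun measurableSet_Ioo fun x hx => ?_
    have := (weight_pos (δ := δ) hx).ne'
    field_simp
  rw [this]
  fun_prop

/-- Each test function imposes a closed condition. Completeness is what makes Hilbert bases of `H1`
available. -/
theorem isClosed_H1 (δ : ℕ) : IsClosed (H1 δ : Set (WithLp 2 (L2 δ × L2 δ))) := by
  have : (H1 δ : Set (WithLp 2 (L2 δ × L2 δ))) =
      ⋂ (ψ : ℝ → ℝ) (_ : ContDiff ℝ ∞ ψ) (_ : HasCompactSupport ψ) (_ : tsupport ψ ⊆ I),
        {p | ∫ x in I, p.fst x * deriv ψ x = -∫ x in I, p.snd x * ψ x} := by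
    ext p
    simp only [mem_iInter]
    rfl
  rw [this]
  refine isClosed_iInter fun ψ => isClosed_iInter fun h1 => isClosed_iInter fun _ =>
    isClosed_iInter fun h3 => ?_
  refine isClosed_eq ?_ ?_
  · exact (continuous_integral_test δ (h1.continuous_deriv (by simp))
      ((tsupport_deriv_subset).trans h3)).comp (WithLp.prod_continuous_ofLp 2 _ _).fst
  · exact ((continuous_integral_test δ h1.continuous h3).comp
      (WithLp.prod_continuous_ofLp 2 _ _).snd).neg

instance completeSpace_H1 (δ : ℕ) : CompleteSpace (H1 δ) :=
  (isClosed_H1 δ).completeSpace_coe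

/-! ### Integration by parts up to the end points -/

/-- The derivative lives on `[0, 1]`. At `s = (k + 1) r - 1` with `r = x (π/2 - x)` the factor `s +
1` is `(k + 1) r`, so the derivatives of the cut-offs are `O(1/r)` uniformly in `k`. -/
theorem exists_bound_deriv_smoothTransition :
    ∃ M : ℝ, ∀ s : ℝ, |(s + 1) * deriv Real.smoothTransition s| ≤ M := by
  have hcd : Continuous (deriv Real.smoothTransition) :=
    (Real.smoothTransition.contDiff (n := 1)).continuous_deriv le_rfl
  obtain ⟨M, hM⟩ := (isCompact_Icc (a := (0 : ℝ)) (b := 1)).exists_bound_of_continuousOn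
    (f := fun s => (s + 1) * deriv Real.smoothTransition s) (by fun_prop)
  refine ⟨max M 0, fun s => ?_⟩
  by_cases hs : s ∈ Icc (0 : ℝ) 1
  · exact (hM s hs).trans (le_max_left _ _)
  · have : deriv Real.smoothTransition s = 0 := by
      rcases lt_or_ge s 0 with h | h
      · have : Real.smoothTransition =ᶠ[𝓝 s] fun _ => 0 := by
          filter_upwards [Iio_mem_nhds h] with y hy
          exact Real.smoothTransition.zero_of_nonpos (le_of_lt hy)
        rw [this.deriv_eq, deriv_const]
      · have h1 : 1 < s := by
          by_contra h'
          exact hs ⟨h, not_lt.1 h'⟩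
        have : Real.smoothTransition =ᶠ[𝓝 s] fun _ => 1 := by
          filter_upwards [Ioi_mem_nhds h1] with y hy
          exact Real.smoothTransition.one_of_one_le (le_of_lt hy)
        rw [this.deriv_eq, deriv_const]
    simp [this]

theorem deriv_smoothTransition_of_one_lt {s : ℝ} (h : 1 < s) :
    deriv Real.smoothTransition s = 0 := by
  have : Real.smoothTransition =ᶠ[𝓝 s] fun _ => 1 := by
    filter_upwards [Ioi_mem_nhds h] with y hy
    exact Real.smoothTransition.one_of_one_le (le_of_lt hy)
  rw [this.deriv_eq, deriv_const]

theorem quad_pos {x : ℝ} (hx : x ∈ I) : 0 < x * (Real.pi / 2 - x) :=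
  mul_pos hx.1 (by linarith [hx.2])

/-- The cut-off functions exhausting `(0, π/2)`. -/
def cutoff (k : ℕ) (x : ℝ) : ℝ := Real.smoothTransition ((k + 1) * (x * (Real.pi / 2 - x)) - 1)

theorem contDiff_cutoff (k : ℕ) : ContDiff ℝ ∞ (cutoff k) := by
  unfold cutoff
  exact Real.smoothTransition.contDiff.comp (by fun_prop)

theorem hasDerivAt_cutoff (k : ℕ) (x : ℝ) :
    HasDerivAt (cutoff k) (deriv Real.smoothTransition ((k + 1) * (x * (Real.pi / 2 - x)) - 1) *
      ((k + 1) * (Real.pi / 2 - 2 * x))) x := by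
  have h1 : HasDerivAt Real.smoothTransition _ ((k + 1) * (x * (Real.pi / 2 - x)) - 1) :=
    ((Real.smoothTransition.contDiff (n := 1)).differentiable (by simp) _).hasDerivAt
  have h2 : HasDerivAt (fun x : ℝ => (k + 1 : ℝ) * (x * (Real.pi / 2 - x)) - 1)
      ((k + 1) * (Real.pi / 2 - 2 * x)) x := by
    have := (((hasDerivAt_id x).mul ((hasDerivAt_const x (Real.pi / 2)).sub
      (hasDerivAt_id x))).const_mul (k + 1 : ℝ)).sub_const 1
    refine HasDerivAt.congr_deriv this ?_
    simp only [id, Pi.sub_apply]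
    ring
  exact h1.comp x h2

theorem support_cutoff_subset (k : ℕ) :
    Function.support (cutoff k) ⊆ {x | 1 / (k + 1 : ℝ) ≤ x * (Real.pi / 2 - x)} := by
  intro x hx
  by_contra h
  apply hx
  apply Real.smoothTransition.zero_of_nonpos
  simp only [mem_ofPred_eq, not_le] at h
  have hk : (0 : ℝ) < k + 1 := by positivity
  rw [lt_div_iff₀ hk] at h
  linarith

theorem tsupport_cutoff_subset (k : ℕ) : tsupport (cutoff k) ⊆ I := by
  have hcl : IsClosed {x : ℝ | 1 / (k + 1 : ℝ) ≤ x * (Real.pi / 2 - x)} :=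
    isClosed_le continuous_const (by fun_prop)
  refine (closure_minimal (support_cutoff_subset k) hcl).trans fun x hx => ?_
  have h0 : 0 < x * (Real.pi / 2 - x) := lt_of_lt_of_le (by positivity) hx
  have hpi := Real.pi_pos
  rcases pos_and_pos_or_neg_and_neg_of_mul_pos h0 with h | h
  · exact ⟨h.1, by linarith [h.2]⟩
  · linarith [h.1, h.2]

theorem hasCompactSupport_cutoff (k : ℕ) : HasCompactSupport (cutoff k) :=
  HasCompactSupport.of_support_subset_isCompact (isCompact_Icc (a := (0 : ℝ)) (b := Real.pi / 2))
    ((subset_tsupport _).trans ((tsupport_cutoff_subset k).trans Ioo_subset_Icc_self))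

theorem eventually_one_lt_cutoff_arg {x : ℝ} (hx : x ∈ I) :
    ∀ᶠ k : ℕ in atTop, 1 < (k + 1 : ℝ) * (x * (Real.pi / 2 - x)) - 1 := by
  have : Tendsto (fun k : ℕ => (k + 1 : ℝ) * (x * (Real.pi / 2 - x)) - 1) atTop atTop := by
    refine tendsto_atTop_add_const_right _ _ (Tendsto.atTop_mul_const (quad_pos hx) ?_)
    exact tendsto_atTop_add_const_right _ _ tendsto_natCast_atTop_atTop
  exact this.eventually_gt_atTop 1

/-- The weak derivative is tested against `χ_k G` with the cut-offs `χ_k`, and `k → ∞` by dominated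
convergence. The dangerous term `χ_k' G` is harmless because `χ_k' = O(1/r)` while `G = O(r w)`,
where `r = x (π/2 - x)`. -/
theorem H1.integral_mul_deriv {δ : ℕ} (u : H1 δ) {G : ℝ → ℝ} (hG : ContDiff ℝ ∞ G) {C : ℝ}
    (h1 : ∀ x ∈ I, |G x| ≤ C * (x * (Real.pi / 2 - x)) * weight δ x)
    (h2 : ∀ x ∈ I, |deriv G x| ≤ C * weight δ x) :
    ∫ x in I, value u x * deriv G x = -∫ x in I, weakDer u x * G x := by
  obtain ⟨M, hM⟩ := exists_bound_deriv_smoothTransition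
  have hpi := Real.pi_pos
  have hM0 : 0 ≤ M := (abs_nonneg _).trans (hM 0)
  have hC0 : 0 ≤ C := by
    have hx : Real.pi / 4 ∈ I := ⟨by linarith, by linarith⟩
    exact nonneg_of_mul_nonneg_left ((abs_nonneg _).trans (h2 _ hx)) (weight_pos hx)
  have hdG : ∀ x, HasDerivAt G (deriv G x) x :=
    fun x => (hG.differentiable (by simp) x).hasDerivAt
  have hdGc : Continuous (deriv G) := hG.continuous_deriv (by simp)
  have hcut : ∀ k x, |cutoff k x| ≤ 1 := fun k x => by
    rw [cutoff, abs_of_nonneg (Real.smoothTransition.nonneg _)]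
    exact Real.smoothTransition.le_one _
  have hder : ∀ k x, deriv (fun x => cutoff k x * G x) x =
      deriv (cutoff k) x * G x + cutoff k x * deriv G x := fun k x => by
    exact ((contDiff_cutoff k).differentiable (by simp) x).hasDerivAt.mul (hdG x) |>.deriv
  have hdc : ∀ k, Continuous (deriv (cutoff k)) :=
    fun k => (contDiff_cutoff k).continuous_deriv (by simp)
  have hb : ∀ k, ∀ x ∈ I, |deriv (cutoff k) x * G x| ≤ (M * (Real.pi / 2) * C) * weight δ x := by
    intro k x hx
    rw [(hasDerivAt_cutoff k x).deriv]
    set r := x * (Real.pi / 2 - x)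
    have hr : 0 < r := quad_pos hx
    have hw := weight_pos (δ := δ) hx
    have e1 := hM ((k + 1) * r - 1)
    rw [show (k + 1) * r - 1 + 1 = (k + 1) * r by ring, abs_mul,
      abs_of_pos (show 0 < (k + 1) * r by positivity)] at e1
    have e2 : |Real.pi / 2 - 2 * x| ≤ Real.pi / 2 := by
      rw [abs_le]; constructor <;> linarith [hx.1, hx.2]
    rw [abs_mul, abs_mul, abs_mul, abs_of_pos (show (0 : ℝ) < k + 1 by positivity)]
    set s := |deriv Real.smoothTransition ((k + 1) * r - 1)|
    calc s * ((k + 1) * |Real.pi / 2 - 2 * x|) * |G x|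
        ≤ s * ((k + 1) * (Real.pi / 2)) * (C * r * weight δ x) := by
          gcongr
          exact h1 x hx
      _ = ((k + 1) * r * s) * ((Real.pi / 2) * C * weight δ x) := by ring
      _ ≤ M * ((Real.pi / 2) * C * weight δ x) := by gcongr
      _ = _ := by ring
  have hr1 : ∀ x ∈ I, x * (Real.pi / 2 - x) ≤ Real.pi * Real.pi := fun x hx => by
    have a1 := hx.1
    have a2 := hx.2
    exact mul_le_mul (by linarith) (by linarith) (by linarith) hpi.le
  have lhs : Tendsto (fun k => ∫ x in I, value u x * deriv (fun x => cutoff k x * G x) x) atTop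
      (𝓝 (∫ x in I, value u x * deriv G x)) := by
    refine tendsto_integral_of_dominated_convergence
      (fun x => (M * (Real.pi / 2) * C + C) * ‖weight δ x * value u x‖) ?_ ?_ ?_ ?_
    · intro k
      refine (L2.aestronglyMeasurable_restrict _).mul ?_
      refine Continuous.aestronglyMeasurable ?_
      rw [funext (hder k)]
      exact ((hdc k).mul hG.continuous).add ((contDiff_cutoff k).continuous.mul hdGc)
    · exact (L2.integrable_weight_mul (value u)).norm.const_mul _
    · intro k
      filter_upwards [ae_restrict_mem measurableSet_Ioo] with x hx
      have hw := weight_pos (δ := δ) hx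
      rw [hder, norm_mul, norm_mul, Real.norm_eq_abs, Real.norm_eq_abs, Real.norm_eq_abs,
        abs_of_pos hw]
      have : |deriv (cutoff k) x * G x + cutoff k x * deriv G x| ≤
          (M * (Real.pi / 2) * C + C) * weight δ x := by
        refine (abs_add_le _ _).trans ?_
        rw [add_mul]
        refine add_le_add (hb k x hx) ?_
        rw [abs_mul]
        calc _ ≤ 1 * (C * weight δ x) :=
              mul_le_mul (hcut k x) (h2 x hx) (abs_nonneg _) zero_le_one
          _ = _ := one_mul _
      calc _ ≤ |value u x| * ((M * (Real.pi / 2) * C + C) * weight δ x) := by gcongr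
        _ = _ := by ring
    · filter_upwards [ae_restrict_mem measurableSet_Ioo] with x hx
      refine tendsto_const_nhds.congr' ?_
      filter_upwards [eventually_one_lt_cutoff_arg hx] with k hk
      -- At a fixed point the argument of the cut-off eventually exceeds `1`, where the transition
      -- function is locally constant.
      rw [hder, (hasDerivAt_cutoff k x).deriv, deriv_smoothTransition_of_one_lt hk, cutoff,
        Real.smoothTransition.one_of_one_le hk.le]
      ring
  have rhs : Tendsto (fun k => ∫ x in I, weakDer u x * (cutoff k x * G x)) atTop
      (𝓝 (∫ x in I, weakDer u x * G x)) := by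
    refine tendsto_integral_of_dominated_convergence
      (fun x => (C * (Real.pi * Real.pi)) * ‖weight δ x * weakDer u x‖) ?_ ?_ ?_ ?_
    · intro k
      exact (L2.aestronglyMeasurable_restrict _).mul
        ((contDiff_cutoff k).continuous.mul hG.continuous).aestronglyMeasurable
    · exact (L2.integrable_weight_mul (weakDer u)).norm.const_mul _
    · intro k
      filter_upwards [ae_restrict_mem measurableSet_Ioo] with x hx
      have hw := weight_pos (δ := δ) hx
      rw [norm_mul, norm_mul, norm_mul, Real.norm_eq_abs, Real.norm_eq_abs, Real.norm_eq_abs,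
        Real.norm_eq_abs, abs_of_pos hw]
      calc |weakDer u x| * (|cutoff k x| * |G x|)
          ≤ |weakDer u x| * (1 * (C * (Real.pi * Real.pi) * weight δ x)) := by
            gcongr
            · exact hcut k x
            · refine (h1 x hx).trans ?_
              exact mul_le_mul_of_nonneg_right (mul_le_mul_of_nonneg_left (hr1 x hx) hC0) hw.le
        _ = _ := by ring
    · filter_upwards [ae_restrict_mem measurableSet_Ioo] with x hx
      refine tendsto_const_nhds.congr' ?_
      filter_upwards [eventually_one_lt_cutoff_arg hx] with k hk
      rw [cutoff, Real.smoothTransition.one_of_one_le hk.le, one_mul]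
  refine tendsto_nhds_unique lhs (rhs.neg.congr fun k => ?_)
  refine (u.2 _ ((contDiff_cutoff k).mul hG) (hasCompactSupport_cutoff k).mul_right ?_).symm
  exact (tsupport_mul_subset_left).trans (tsupport_cutoff_subset k)

end

end KG

/-! ### Polynomials in `cos²`: the operator, its eigenpolynomials, orthogonality and density -/

namespace KG

noncomputable section

open Polynomial in
/-- The function `x ↦ p(cos² x)`. -/
def polyFun (p : ℝ[X]) (x : ℝ) : ℝ := p.eval (Real.cos x ^ 2)

theorem contDiff_polyFun (p : Polynomial ℝ) {n : WithTop ℕ∞} : ContDiff ℝ n (polyFun p) := by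
  unfold polyFun
  have h : ContDiff ℝ n fun y : ℝ => p.eval y := by
    simpa [Polynomial.aeval_def] using p.contDiff_aeval (𝕜 := ℝ) n
  exact h.comp (Real.contDiff_cos.pow 2)

theorem continuous_polyFun (p : Polynomial ℝ) : Continuous (polyFun p) :=
  (contDiff_polyFun p (n := 0)).continuous

theorem hasDerivAt_polyFun (p : Polynomial ℝ) (x : ℝ) :
    HasDerivAt (polyFun p)
      (-2 * (Real.sin x * Real.cos x) * polyFun (Polynomial.derivative p) x) x := by
  have h := (p.hasDerivAt (Real.cos x ^ 2)).comp x ((Real.hasDerivAt_cos x).pow 2)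
  refine HasDerivAt.congr_deriv h ?_
  simp only [polyFun]
  push_cast
  ring

theorem deriv_polyFun (p : Polynomial ℝ) : deriv (polyFun p) = fun x =>
    -2 * (Real.sin x * Real.cos x) * polyFun (Polynomial.derivative p) x :=
  funext fun x => (hasDerivAt_polyFun p x).deriv

/-! ### The structure of `H¹` -/

theorem value_add {δ : ℕ} (u v : H1 δ) : value (u + v) = value u + value v := rfl
theorem value_smul {δ : ℕ} (c : ℝ) (u : H1 δ) : value (c • u) = c • value u := rfl
theorem weakDer_add {δ : ℕ} (u v : H1 δ) : weakDer (u + v) = weakDer u + weakDer v := rfl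
theorem weakDer_smul {δ : ℕ} (c : ℝ) (u : H1 δ) : weakDer (c • u) = c • weakDer u := rfl

theorem H1.inner_eq {δ : ℕ} (u v : H1 δ) :
    ⟪u, v⟫_ℝ = ⟪weakDer u, weakDer v⟫_ℝ + ⟪value u, value v⟫_ℝ := by
  rw [Submodule.coe_inner, WithLp.prod_inner_apply, add_comm]
  rfl

theorem H1.norm_sq_eq {δ : ℕ} (u : H1 δ) : ‖u‖ ^ 2 = ‖weakDer u‖ ^ 2 + ‖value u‖ ^ 2 := by
  rw [← real_inner_self_eq_norm_sq, H1.inner_eq, real_inner_self_eq_norm_sq,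
    real_inner_self_eq_norm_sq]

/-- `value` as a bounded operator. -/
def valueL (δ : ℕ) : H1 δ →L[ℝ] L2 δ :=
  LinearMap.mkContinuous { toFun := value, map_add' := value_add, map_smul' := value_smul } 1
    fun u => by
      rw [one_mul]
      exact (sq_le_sq₀ (norm_nonneg _) (norm_nonneg _)).1
        (by
          change ‖value u‖ ^ 2 ≤ _
          rw [H1.norm_sq_eq]; nlinarith [sq_nonneg ‖weakDer u‖])

/-- `weakDer` as a bounded operator. -/
def weakDerL (δ : ℕ) : H1 δ →L[ℝ] L2 δ :=
  LinearMap.mkContinuous { toFun := weakDer, map_add' := weakDer_add, map_smul' := weakDer_smul } 1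
    fun u => by
      rw [one_mul]
      exact (sq_le_sq₀ (norm_nonneg _) (norm_nonneg _)).1
        (by
          change ‖weakDer u‖ ^ 2 ≤ _
          rw [H1.norm_sq_eq]; nlinarith [sq_nonneg ‖value u‖])

@[simp] theorem valueL_apply {δ : ℕ} (u : H1 δ) : valueL δ u = value u := rfl

theorem H1.ext_value {δ : ℕ} {u v : H1 δ} (h : value u = value v) : u = v := by
  rw [← sub_eq_zero]
  refine value_injective ?_
  rw [← valueL_apply, map_sub, valueL_apply, valueL_apply, h, sub_self]

/-! ### Polynomials in `cos²` as elements of `H¹` -/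

/-- The class of `x ↦ p(cos² x)` in `H¹`. -/
def polyH1 (δ : ℕ) : Polynomial ℝ →ₗ[ℝ] H1 δ where
  toFun p := ofSmooth δ (polyFun p) (contDiff_polyFun p)
  map_add' p q := by
    refine H1.ext_value (Lp.ext ?_)
    rw [value_add]
    filter_upwards [value_ofSmooth_ae δ (polyFun (p + q)) (contDiff_polyFun _),
      value_ofSmooth_ae δ (polyFun p) (contDiff_polyFun _),
      value_ofSmooth_ae δ (polyFun q) (contDiff_polyFun _),
      Lp.coeFn_add (value (ofSmooth δ (polyFun p) (contDiff_polyFun p)))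
        (value (ofSmooth δ (polyFun q) (contDiff_polyFun q)))] with x h1 h2 h3 h4
    rw [h4, Pi.add_apply, h1, h2, h3]
    simp [polyFun]
  map_smul' c p := by
    refine H1.ext_value (Lp.ext ?_)
    rw [value_smul]
    filter_upwards [value_ofSmooth_ae δ (polyFun (c • p)) (contDiff_polyFun _),
      value_ofSmooth_ae δ (polyFun p) (contDiff_polyFun _),
      Lp.coeFn_smul (RingHom.id ℝ c) (value (ofSmooth δ (polyFun p) (contDiff_polyFun p)))]
      with x h1 h2 h4
    rw [h4, Pi.smul_apply, h1, h2]
    simp [polyFun]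

theorem value_polyH1_ae (δ : ℕ) (p : Polynomial ℝ) : value (polyH1 δ p) =ᵐ[mu δ] polyFun p :=
  value_ofSmooth_ae δ (polyFun p) (contDiff_polyFun p)

theorem inner_value_polyH1 {δ : ℕ} (u : L2 δ) (p : Polynomial ℝ) :
    ⟪u, value (polyH1 δ p)⟫_ℝ = ∫ x, u x * polyFun p x ∂mu δ :=
  L2.inner_toLp u (memLp_of_continuous δ (continuous_polyFun p) 2)

theorem inner_weakDer_polyH1 {δ : ℕ} (u : L2 δ) (p : Polynomial ℝ) :
    ⟪u, weakDer (polyH1 δ p)⟫_ℝ = ∫ x, u x * deriv (polyFun p) x ∂mu δ :=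
  L2.inner_toLp u (memLp_of_continuous δ
    ((contDiff_polyFun p (n := 1)).continuous_deriv le_rfl) 2)

theorem integrable_polyFun (δ : ℕ) (p : Polynomial ℝ) : Integrable (polyFun p) (mu δ) :=
  memLp_one_iff_integrable.1 (memLp_of_continuous δ (continuous_polyFun p) 1)

/-- The functional `p ↦ ∫ p(cos² x) dμ`. -/
def moment (δ : ℕ) : Polynomial ℝ →ₗ[ℝ] ℝ where
  toFun p := ∫ x, polyFun p x ∂mu δ
  map_add' p q := by
    rw [← integral_add (integrable_polyFun δ p) (integrable_polyFun δ q)]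
    simp [polyFun]
  map_smul' c p := by
    rw [RingHom.id_apply, smul_eq_mul, ← integral_const_mul]
    simp [polyFun]

theorem inner_value_polyH1_polyH1 (δ : ℕ) (p q : Polynomial ℝ) :
    ⟪value (polyH1 δ p), value (polyH1 δ q)⟫_ℝ = moment δ (p * q) := by
  rw [inner_value_polyH1]
  refine integral_congr_ae ?_
  filter_upwards [value_polyH1_ae δ p] with x hx
  rw [hx]
  simp [polyFun]

/-! ### The operator on polynomials -/

open Polynomial in
/-- `-w⁻¹ ∂ₓ (w ∂ₓ ·)` in the variable `y = cos² x`. -/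
def lap (δ : ℕ) (p : ℝ[X]) : ℝ[X] :=
  -(C 4 * X * (1 - X) * derivative (derivative p) +
    (C (4 * (δ : ℝ) - 2) - C (4 * (δ : ℝ) + 4) * X) * derivative p)

/-- With `y = cos² x` one has `w · (p(y))' = -2 sin³ x cos^(2δ-1) x p'(y)`. A second differentiation
restores the factor `w` and leaves a hypergeometric operator in `y`. -/
theorem hasDerivAt_weight_mul_deriv_polyFun {δ : ℕ} (hδ : 1 ≤ δ) (p : Polynomial ℝ) (x : ℝ) :
    HasDerivAt (fun x => weight δ x * deriv (polyFun p) x)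
      (-(weight δ x * polyFun (lap δ p) x)) x := by
  obtain ⟨m, rfl⟩ : ∃ m, δ = m + 1 := ⟨δ - 1, by omega⟩
  have e : 2 * (m + 1) - 2 = 2 * m := by omega
  have h : (fun x => weight (m + 1) x * deriv (polyFun p) x) = fun x =>
      -2 * ((Real.sin x ^ 3 * Real.cos x ^ (2 * m + 1)) *
        polyFun (Polynomial.derivative p) x) := by
    funext x
    rw [deriv_polyFun, weight, e]
    ring
  rw [h]
  have h2 := ((((Real.hasDerivAt_sin x).pow 3).mul ((Real.hasDerivAt_cos x).pow (2 * m + 1))).mul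
    (hasDerivAt_polyFun (Polynomial.derivative p) x)).const_mul (-2)
  refine HasDerivAt.congr_deriv h2 ?_
  have hs : Real.sin x ^ 2 = 1 - Real.cos x ^ 2 := by rw [← Real.sin_sq_add_cos_sq x]; ring
  simp only [polyFun, lap, weight, e, Pi.pow_apply, Pi.mul_apply]
  simp only [Polynomial.eval_neg, Polynomial.eval_add, Polynomial.eval_mul, Polynomial.eval_sub,
    Polynomial.eval_C, Polynomial.eval_X, Polynomial.eval_one, ← hs]
  rw [show 3 - 1 = 2 by rfl, show 2 * m + 1 - 1 = 2 * m by omega]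
  push_cast
  set P' := (Polynomial.derivative p).eval (Real.cos x ^ 2)
  set P'' := (Polynomial.derivative (Polynomial.derivative p)).eval (Real.cos x ^ 2)
  set s := Real.sin x
  set c := Real.cos x
  have hc : c ^ (2 * m + 1) = c ^ (2 * m) * c := pow_succ _ _
  rw [hc]
  linear_combination (2 * P' * (2 * m + 1) * s ^ 2 * c ^ (2 * m)) * hs

/-- Integration by parts has no boundary terms, since `w (p(cos²))'` carries the extra factor `sin x
cos x ≤ x (π/2 - x)`. This is the weak form of the eigenvalue equation and the source of the
symmetry of `lap`. -/
theorem inner_weakDer_polyH1_eq {δ : ℕ} (hδ : 1 ≤ δ) (u : H1 δ) (p : Polynomial ℝ) :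
    ⟪weakDer u, weakDer (polyH1 δ p)⟫_ℝ = ⟪value u, value (polyH1 δ (lap δ p))⟫_ℝ := by
  rw [inner_weakDer_polyH1, inner_value_polyH1, integral_mu, integral_mu]
  have hsmooth : ContDiff ℝ ∞ fun x => weight δ x * deriv (polyFun p) x := by
    have h1 : ContDiff ℝ ∞ (weight δ) := by unfold weight; fun_prop
    rw [deriv_polyFun]
    exact h1.mul ((contDiff_const.mul (Real.contDiff_sin.mul Real.contDiff_cos)).mul
      (contDiff_polyFun _))
  have bnd : ∀ q : Polynomial ℝ, ∃ C : ℝ, 0 ≤ C ∧ ∀ x ∈ I, |polyFun q x| ≤ C := fun q => by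
    obtain ⟨C, hC⟩ := (isCompact_Icc (a := (0 : ℝ)) (b := Real.pi / 2)).exists_bound_of_continuousOn
      (continuous_polyFun q).continuousOn
    exact ⟨max C 0, le_max_right _ _, fun x hx =>
      (hC x (Ioo_subset_Icc_self hx)).trans (le_max_left _ _)⟩
  obtain ⟨C1, hC1, hb1⟩ := bnd (Polynomial.derivative p)
  obtain ⟨C2, hC2, hb2⟩ := bnd (lap δ p)
  -- The function is bounded with the constant `2 C1`, its derivative with `C2`; the sum serves for
  -- both.
  have key := H1.integral_mul_deriv u hsmooth (C := 2 * C1 + C2) ?_ ?_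
  · have e1 : ∫ x in I, weight δ x * (weakDer u x * deriv (polyFun p) x) =
        ∫ x in I, weakDer u x * (weight δ x * deriv (polyFun p) x) := by
      congr 1; funext x; ring
    have e2 : ∫ x in I, weight δ x * (value u x * polyFun (lap δ p) x) =
        -∫ x in I, value u x * deriv (fun x => weight δ x * deriv (polyFun p) x) x := by
      rw [← integral_neg]
      congr 1; funext x
      rw [(hasDerivAt_weight_mul_deriv_polyFun hδ p x).deriv]; ring
    rw [e1, e2, key, neg_neg]
  · intro x hx
    have hw := weight_pos (δ := δ) hx
    have hs : 0 < Real.sin x := Real.sin_pos_of_pos_of_lt_pi hx.1 (by linarith [hx.2, Real.pi_pos])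
    have hc : 0 < Real.cos x := Real.cos_pos_of_mem_Ioo ⟨by linarith [hx.1, Real.pi_pos], hx.2⟩
    have h3 : Real.sin x ≤ x := Real.sin_le hx.1.le
    have h4 : Real.cos x ≤ Real.pi / 2 - x := by
      rw [← Real.sin_pi_div_two_sub]; exact Real.sin_le (by linarith [hx.2])
    rw [deriv_polyFun, abs_mul, abs_mul, abs_mul, abs_of_pos hw, abs_of_pos (mul_pos hs hc)]
    have h5 : Real.sin x * Real.cos x ≤ x * (Real.pi / 2 - x) := mul_le_mul h3 h4 hc.le hx.1.le
    have h6 : Real.sin x * Real.cos x * |polyFun (Polynomial.derivative p) x| ≤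
        (x * (Real.pi / 2 - x)) * C1 :=
      mul_le_mul h5 (hb1 x hx) (abs_nonneg _) (quad_pos hx).le
    have h7 : 0 ≤ C2 * (x * (Real.pi / 2 - x)) := mul_nonneg hC2 (quad_pos hx).le
    rw [show |(-2 : ℝ)| = 2 by norm_num]
    nlinarith
  · intro x hx
    have hw := weight_pos (δ := δ) hx
    rw [(hasDerivAt_weight_mul_deriv_polyFun hδ p x).deriv, abs_neg, abs_mul, abs_of_pos hw,
      mul_comm]
    refine mul_le_mul_of_nonneg_right ?_ hw.le
    linarith [hb2 x hx]

/-- The operator couples a monomial only to the one below it, so the eigenpolynomials obey a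
two-term recursion. At `k = 0` the truncated exponent `k - 1` is harmless because its coefficient is
zero. -/
theorem lap_X_pow (δ k : ℕ) :
    lap δ (Polynomial.X ^ k) = Polynomial.C (4 * (k : ℝ) * (k + δ)) * Polynomial.X ^ k -
      Polynomial.C (2 * (k : ℝ) * (2 * k + 2 * δ - 3)) * Polynomial.X ^ (k - 1) := by
  unfold lap
  rcases k with _ | k
  · simp
  · rw [Polynomial.derivative_X_pow_succ]
    rcases k with _ | k
    · simp only [Polynomial.C_add, Polynomial.C_mul, Polynomial.C_sub]
      simp
      have : (Polynomial.C 2 : Polynomial ℝ) = 2 := rfl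
      have : (Polynomial.C 3 : Polynomial ℝ) = 3 := rfl
      have : (Polynomial.C 4 : Polynomial ℝ) = 4 := rfl
      simp only [*]
      ring
    · rw [Polynomial.derivative_C_mul, Polynomial.derivative_X_pow_succ]
      simp only [Polynomial.C_add, Polynomial.C_mul, Polynomial.C_sub, Nat.cast_add, Nat.cast_one,
        Polynomial.C_eq_natCast, Nat.add_sub_cancel]
      have : (Polynomial.C 2 : Polynomial ℝ) = 2 := rfl
      have : (Polynomial.C 3 : Polynomial ℝ) = 3 := rfl
      have : (Polynomial.C 4 : Polynomial ℝ) = 4 := rfl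
      have : (Polynomial.C 1 : Polynomial ℝ) = 1 := rfl
      simp only [*]
      simp
      ring

theorem lap_add (δ : ℕ) (p q : Polynomial ℝ) : lap δ (p + q) = lap δ p + lap δ q := by
  simp only [lap, map_add]; ring

theorem lap_C_mul (δ : ℕ) (c : ℝ) (p : Polynomial ℝ) :
    lap δ (Polynomial.C c * p) = Polynomial.C c * lap δ p := by
  simp only [lap, Polynomial.derivative_C_mul]; ring

theorem lap_sum (δ : ℕ) (s : Finset ℕ) (p : ℕ → Polynomial ℝ) :
    lap δ (∑ k ∈ s, p k) = ∑ k ∈ s, lap δ (p k) := by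
  classical
  induction s using Finset.induction_on with
  | empty => simp [lap]
  | insert a s ha ih => rw [Finset.sum_insert ha, Finset.sum_insert ha, lap_add, ih]

/-! ### The eigenfunctions -/

/-- The coefficients of the `n`-th eigenpolynomial. -/
def eigCoeff (δ n : ℕ) : ℕ → ℚ
  | 0 => 1
  | k + 1 => -(2 * ((n : ℚ) - k) * (n + k + δ)) / ((k + 1) * (2 * k + 2 * δ - 1)) * eigCoeff δ n k

/-- The `n`-th eigenpolynomial, a multiple of a Jacobi polynomial. -/
def eigPoly (δ n : ℕ) : Polynomial ℝ :=
  ∑ k ∈ Finset.range (n + 1), Polynomial.C (eigCoeff δ n k : ℝ) * Polynomial.X ^ k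

/-- This compares the coefficients of `X ^ k` in the eigenvalue equation, using `n (n + δ) - k (k +
δ) = (n - k)(n + k + δ)`. -/
theorem eigCoeff_succ {δ : ℕ} (hδ : 1 ≤ δ) (n k : ℕ) :
    (eigCoeff δ n (k + 1) : ℝ) * (2 * ((k : ℝ) + 1) * (2 * ((k : ℝ) + 1) + 2 * δ - 3)) =
      -(4 * ((n : ℝ) - k) * (n + k + δ)) * eigCoeff δ n k := by
  have h1 : (1 : ℝ) ≤ δ := by exact_mod_cast hδ
  have h2 : (2 * (k : ℝ) + 2 * δ - 1) ≠ 0 := by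
    have : (0 : ℝ) ≤ k := by positivity
    nlinarith
  have h3 : ((k : ℝ) + 1) ≠ 0 := by positivity
  rw [eigCoeff, show 2 * ((k : ℝ) + 1) + 2 * δ - 3 = 2 * k + 2 * δ - 1 by ring]
  push_cast
  generalize 2 * (k : ℝ) + 2 * δ - 1 = D at h2 ⊢
  field_simp
  ring

/-- The recursion breaks off only after `k = n`. Hence `eigPoly δ n` has degree exactly `n`, and the
change of basis from monomials is triangular and invertible. -/
theorem eigCoeff_ne_zero {δ : ℕ} (hδ : 1 ≤ δ) (n k : ℕ) (hk : k ≤ n) : eigCoeff δ n k ≠ 0 := by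
  induction k with
  | zero => simp [eigCoeff]
  | succ k ih =>
    rw [eigCoeff]
    have h1 : (1 : ℚ) ≤ δ := by exact_mod_cast hδ
    have h0 : (0 : ℚ) ≤ k := by positivity
    have h2 : (2 * (k : ℚ) + 2 * δ - 1) ≠ 0 := by nlinarith
    have h3 : ((k : ℚ) + 1) ≠ 0 := by positivity
    have h4 : (n : ℚ) - k ≠ 0 := by
      have : (k : ℚ) + 1 ≤ n := by exact_mod_cast hk
      intro h; linarith
    have h5 : (n : ℚ) + k + δ ≠ 0 := by positivity
    have := ih (by omega)
    simp only [ne_eq, mul_eq_zero, div_eq_zero_iff, neg_eq_zero, OfNat.ofNat_ne_zero, not_or]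
    tauto

/-- After shifting the index of the lowering terms, the recursion matches every power below `n`; at
the top power the eigenvalue appears directly. -/
theorem lap_eigPoly {δ : ℕ} (hδ : 1 ≤ δ) (n : ℕ) :
    lap δ (eigPoly δ n) = Polynomial.C (4 * (n : ℝ) * (n + δ)) * eigPoly δ n := by
  have h : ∀ k, lap δ (Polynomial.C (eigCoeff δ n k : ℝ) * Polynomial.X ^ k) =
      Polynomial.C (eigCoeff δ n k * (4 * (k : ℝ) * (k + δ))) * Polynomial.X ^ k -
      Polynomial.C (eigCoeff δ n k * (2 * (k : ℝ) * (2 * k + 2 * δ - 3))) *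
        Polynomial.X ^ (k - 1) := fun k => by
    rw [lap_C_mul, lap_X_pow, Polynomial.C_mul (a := (eigCoeff δ n k : ℝ)),
      Polynomial.C_mul (a := (eigCoeff δ n k : ℝ))]
    ring
  unfold eigPoly
  rw [lap_sum, Finset.sum_congr rfl fun k _ => h k, Finset.sum_sub_distrib]
  rw [Finset.sum_range_succ' (fun k => Polynomial.C (eigCoeff δ n k *
    (2 * (k : ℝ) * (2 * k + 2 * δ - 3))) * Polynomial.X ^ (k - 1)), Finset.sum_range_succ]
  rw [Finset.mul_sum, Finset.sum_range_succ]
  have h2 : ∀ k, Polynomial.C (eigCoeff δ n (k + 1) * (2 * ((k + 1 : ℕ) : ℝ) *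
      (2 * ((k + 1 : ℕ) : ℝ) + 2 * δ - 3))) * Polynomial.X ^ (k + 1 - 1) =
      Polynomial.C (-(4 * ((n : ℝ) - k) * (n + k + δ)) * eigCoeff δ n k) * Polynomial.X ^ k :=
    fun k => by
      have := eigCoeff_succ hδ n k
      rw [← this]
      push_cast
      rfl
  rw [Finset.sum_congr rfl fun k _ => h2 k]
  simp only [Nat.cast_zero, mul_zero, zero_mul, Polynomial.C_0, add_zero]
  rw [add_sub_right_comm, ← Finset.sum_sub_distrib]
  congr 1
  · refine Finset.sum_congr rfl fun k _ => ?_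
    rw [← sub_mul, ← Polynomial.C_sub, ← mul_assoc (Polynomial.C (4 * (n : ℝ) * (n + δ))),
      ← Polynomial.C_mul]
    congr 2
    ring
  · rw [← mul_assoc (Polynomial.C (4 * (n : ℝ) * (n + δ))), ← Polynomial.C_mul]
    congr 2
    ring

/-- A functional that vanishes on the first eigenpolynomials vanishes on all polynomials of low
degree. -/
theorem eq_zero_of_eigPoly {δ : ℕ} (hδ : 1 ≤ δ) (l : Polynomial ℝ →ₗ[ℝ] ℝ) {N : ℕ}
    (h : ∀ j < N, l (eigPoly δ j) = 0) {q : Polynomial ℝ} (hq : q.natDegree < N) : l q = 0 := by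
  -- By triangularity, `X ^ j` is a multiple of the `j`-th eigenpolynomial modulo lower powers.
  have hX : ∀ j < N, l (Polynomial.X ^ j) = 0 := by
    intro j
    induction j using Nat.strong_induction_on with
    | _ j ih =>
      intro hj
      have h1 := h j hj
      rw [eigPoly, Finset.sum_range_succ, map_add, map_sum, Finset.sum_eq_zero, zero_add,
        ← Polynomial.smul_eq_C_mul, map_smul, smul_eq_mul, mul_eq_zero] at h1
      · rcases h1 with h1 | h1
        · exact absurd (by exact_mod_cast h1) (eigCoeff_ne_zero hδ j j le_rfl)
        · exact h1
      · intro k hk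
        rw [Finset.mem_range] at hk
        rw [← Polynomial.smul_eq_C_mul, map_smul, ih k hk (hk.trans hj), smul_zero]
  rw [q.as_sum_range_C_mul_X_pow, map_sum]
  refine Finset.sum_eq_zero fun k hk => ?_
  rw [Finset.mem_range] at hk
  rw [← Polynomial.smul_eq_C_mul, map_smul, hX k (by omega), smul_zero]

theorem moment_lap_mul {δ : ℕ} (hδ : 1 ≤ δ) (p q : Polynomial ℝ) :
    moment δ (lap δ p * q) = moment δ (p * lap δ q) := by
  rw [← inner_value_polyH1_polyH1, ← inner_value_polyH1_polyH1, ← inner_weakDer_polyH1_eq hδ,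
    real_inner_comm, ← inner_weakDer_polyH1_eq hδ, real_inner_comm]

/-- The operator is symmetric, and the eigenvalues differ by `4 (m - n)(m + n + δ) ≠ 0`. -/
theorem moment_eigPoly_mul_eigPoly {δ : ℕ} (hδ : 1 ≤ δ) {m n : ℕ} (h : m ≠ n) :
    moment δ (eigPoly δ m * eigPoly δ n) = 0 := by
  have h1 := moment_lap_mul hδ (eigPoly δ m) (eigPoly δ n)
  rw [lap_eigPoly hδ, lap_eigPoly hδ, ← Polynomial.smul_eq_C_mul, ← Polynomial.smul_eq_C_mul,
    smul_mul_assoc, mul_smul_comm, map_smul, map_smul, smul_eq_mul, smul_eq_mul, ← sub_eq_zero,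
    ← sub_mul, mul_eq_zero] at h1
  refine h1.resolve_left fun h2 => h ?_
  have h3 : ((m : ℝ) - n) * (m + n + δ) = 0 := by linear_combination h2 / 4
  have h4 : (0 : ℝ) < m + n + δ := by
    have : (1 : ℝ) ≤ δ := by exact_mod_cast hδ
    positivity
  have h5 := (mul_eq_zero.1 h3).resolve_right h4.ne'
  exact_mod_cast sub_eq_zero.1 h5

/-- Orthogonality to all polynomials of lower degree is what later removes the resonant coupling of
modes `n` and `n + δ`. -/
theorem moment_eigPoly_mul {δ : ℕ} (hδ : 1 ≤ δ) {n : ℕ} {q : Polynomial ℝ}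
    (hq : q.natDegree < n) : moment δ (eigPoly δ n * q) = 0 :=
  eq_zero_of_eigPoly hδ ((moment δ).comp (LinearMap.mulLeft ℝ (eigPoly δ n))) (N := n)
    (fun j hj => by
      simpa using moment_eigPoly_mul_eigPoly hδ (Nat.ne_of_gt hj)) hq

theorem natDegree_eigPoly_le (δ n : ℕ) : (eigPoly δ n).natDegree ≤ n := by
  refine Polynomial.natDegree_sum_le_of_forall_le _ _ fun k hk => ?_
  rw [Finset.mem_range] at hk
  exact (Polynomial.natDegree_C_mul_X_pow_le _ _).trans (by omega)

theorem eigPoly_eval_zero (δ n : ℕ) : (eigPoly δ n).eval 0 = 1 := by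
  rw [eigPoly, Finset.sum_range_succ']
  simp [eigCoeff, Polynomial.eval_finsetSum]

/-- The eigenpolynomial is `1` at `y = 0`, that is at `x = π/2`, so it has no zeros on an interval
next to that end point. -/
theorem moment_eigPoly_sq_pos (δ n : ℕ) : 0 < moment δ (eigPoly δ n * eigPoly δ n) := by
  rw [← inner_value_polyH1_polyH1, real_inner_self_eq_norm_sq]
  refine pow_pos (norm_pos_iff.2 fun h0 => ?_) 2
  have hae : ∀ᵐ x ∂volume.restrict I, polyFun (eigPoly δ n) x = 0 := by
    have h1 := value_polyH1_ae δ (eigPoly δ n)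
    rw [h0] at h1
    filter_upwards [(restrict_absolutelyContinuous_mu δ).ae_le h1,
      (restrict_absolutelyContinuous_mu δ).ae_le (Lp.coeFn_zero ℝ 2 (mu δ))] with x h2 h3
    rw [← h2, h3]
    rfl
  have h1 : polyFun (eigPoly δ n) (Real.pi / 2) = 1 := by simp [polyFun, eigPoly_eval_zero]
  have hnear : ∀ᶠ x in 𝓝 (Real.pi / 2), polyFun (eigPoly δ n) x ≠ 0 :=
    (continuous_polyFun _).continuousAt.eventually_ne (by rw [h1]; norm_num)
  obtain ⟨ε, hε, hball⟩ := Metric.eventually_nhds_iff_ball.1 hnear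
  rw [ae_restrict_iff' measurableSet_Ioo] at hae
  have hpi := Real.pi_pos
  set a := max 0 (Real.pi / 2 - ε)
  have ha : a < Real.pi / 2 := max_lt (by linarith) (by linarith)
  have hsub : Ioo a (Real.pi / 2) ⊆ {x | ¬(x ∈ I → polyFun (eigPoly δ n) x = 0)} := by
    intro x hx hx2
    refine hball x ?_ (hx2 ⟨(le_max_left _ _).trans_lt hx.1, hx.2⟩)
    rw [Metric.mem_ball, Real.dist_eq, abs_lt]
    constructor <;> linarith [hx.1, hx.2, le_max_right 0 (Real.pi / 2 - ε)]
  have h2 := measure_mono_null hsub hae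
  rw [Real.volume_Ioo, ENNReal.ofReal_eq_zero] at h2
  linarith

/-- Polynomials in `cos²` are dense in `L²(dμ)`. -/
theorem eq_zero_of_inner_polyH1 {δ : ℕ} (u : L2 δ)
    (h : ∀ p, ⟪u, value (polyH1 δ p)⟫_ℝ = 0) : u = 0 := by
  have hu : Integrable u (mu δ) := (Lp.memLp u).integrable (by norm_num)
  have hd := BoundedContinuousFunction.toLp_denseRange ℝ (mu δ) ℝ (p := 2) (by norm_num)
  have hall : ∀ v : L2 δ, ⟪u, v⟫_ℝ = 0 := by
    refine hd.induction ?_ (isClosed_eq (by fun_prop) continuous_const)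
    rintro _ ⟨g, rfl⟩
    have e1 : ⟪u, BoundedContinuousFunction.toLp 2 (mu δ) ℝ g⟫_ℝ = ∫ x, u x * g x ∂mu δ := by
      rw [L2.inner_eq]
      refine integral_congr_ae ?_
      filter_upwards [BoundedContinuousFunction.coeFn_toLp (p := 2) (mu δ) ℝ g] with x hx
      rw [hx]
    rw [e1]
    have hug : Integrable (fun x => u x * g x) (mu δ) :=
      hu.mul_bdd (c := ‖g‖) g.continuous.aestronglyMeasurable (ae_of_all _ g.norm_coe_le_norm)
    have hbound : ∀ ε > 0, |∫ x, u x * g x ∂mu δ| ≤ ε * ∫ x, |u x| ∂mu δ := by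
      intro ε hε
      -- Weierstrass approximation in the variable `y = cos² x`, which is a homeomorphism from `[0,
      -- π/2]` to `[0, 1]`.
      obtain ⟨p, hp⟩ := exists_polynomial_near_of_continuousOn 0 1
        (fun y => g (Real.arccos (Real.sqrt y))) (by fun_prop) ε hε
      have hp2 : ∀ x ∈ I, |g x - polyFun p x| ≤ ε := fun x hx => by
        have hc : 0 < Real.cos x :=
          Real.cos_pos_of_mem_Ioo ⟨by linarith [hx.1, Real.pi_pos], hx.2⟩
        have h3 := hp (Real.cos x ^ 2) ⟨sq_nonneg _, Real.cos_sq_le_one x⟩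
        rw [Real.sqrt_sq hc.le, Real.arccos_cos hx.1.le (by linarith [hx.2, Real.pi_pos]),
          abs_sub_comm] at h3
        exact h3.le
      have hpu : Integrable (fun x => u x * polyFun p x) (mu δ) := by
        have := hug.sub (g := fun x => u x * (g x - polyFun p x))
          (hu.mul_bdd (c := ε) (g.continuous.sub (continuous_polyFun p)).aestronglyMeasurable
            (by filter_upwards [ae_mem_I δ] with x hx using hp2 x hx))
        refine this.congr (ae_of_all _ fun x => ?_)
        simp only [Pi.sub_apply]
        ring
      have e2 : ∫ x, u x * g x ∂mu δ = ∫ x, u x * (g x - polyFun p x) ∂mu δ := by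
        have h4 := h p
        rw [inner_value_polyH1] at h4
        simp only [mul_sub]
        rw [integral_sub hug hpu, h4, sub_zero]
      rw [e2, ← integral_const_mul, ← Real.norm_eq_abs]
      refine norm_integral_le_of_norm_le (hu.abs.const_mul ε) ?_
      filter_upwards [ae_mem_I δ] with x hx
      rw [norm_mul, mul_comm]
      exact mul_le_mul_of_nonneg_right (hp2 x hx) (abs_nonneg _)
    by_contra hne
    have hpos : 0 < |∫ x, u x * g x ∂mu δ| := abs_pos.2 hne
    have hM : 0 ≤ ∫ x, |u x| ∂mu δ := integral_nonneg fun _ => abs_nonneg _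
    set A := |∫ x, u x * g x ∂mu δ|
    set M := ∫ x, |u x| ∂mu δ
    -- This `ε` gives `A ≤ A / 2`; the summand `1` covers the case `M = 0`.
    have h5 := hbound (A / (2 * (M + 1))) (by positivity)
    have h6 : A / (2 * (M + 1)) * M ≤ A / 2 := by
      rw [div_mul_eq_mul_div, div_le_div_iff₀ (by positivity) (by norm_num)]
      nlinarith
    linarith
  exact inner_self_eq_zero.1 (hall u)

end

end KG

/-! ### Hilbert bases of eigenfunctions and the linear flow in coefficients -/

namespace KG

noncomputable section

/-! ### Hilbert bases of eigenfunctions -/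

/-- The normalised eigenfunctions. -/
def evec (δ n : ℕ) : H1 δ :=
  (Real.sqrt (moment δ (eigPoly δ n * eigPoly δ n)))⁻¹ • polyH1 δ (eigPoly δ n)

/-- The eigenfrequencies `ω_n = δ + 2n`. -/
def omega (δ n : ℕ) : ℝ := δ + 2 * n

theorem one_le_delta {δ : ℕ} [hδ : Fact (2 ≤ δ)] : 1 ≤ δ := by have := hδ.out; omega

theorem two_le_delta_real {δ : ℕ} [hδ : Fact (2 ≤ δ)] : (2 : ℝ) ≤ δ := by exact_mod_cast hδ.out

theorem omega_pos {δ : ℕ} [Fact (2 ≤ δ)] (n : ℕ) : 0 < omega δ n := by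
  have := two_le_delta_real (δ := δ)
  unfold omega; positivity

variable {δ : ℕ} [Fact (2 ≤ δ)]

theorem inner_weakDer_evec (u : H1 δ) (n : ℕ) :
    ⟪weakDer u, weakDer (evec δ n)⟫_ℝ = 4 * n * (n + δ) * ⟪value u, value (evec δ n)⟫_ℝ := by
  rw [evec, weakDer_smul, value_smul, real_inner_smul_right, real_inner_smul_right,
    inner_weakDer_polyH1_eq one_le_delta, lap_eigPoly one_le_delta, ← Polynomial.smul_eq_C_mul,
    map_smul, value_smul, real_inner_smul_right]
  ring

/-- Here `4 n (n + δ) + δ² = (δ + 2n)²`: the frequencies are integers. -/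
theorem form_evec (u : H1 δ) (n : ℕ) :
    form u (evec δ n) = omega δ n ^ 2 * ⟪value u, value (evec δ n)⟫_ℝ := by
  rw [form, inner_weakDer_evec, omega]
  ring

theorem inner_value_evec (n m : ℕ) :
    ⟪value (evec δ n), value (evec δ m)⟫_ℝ = if n = m then 1 else 0 := by
  rw [evec, evec, value_smul, value_smul, real_inner_smul_left, real_inner_smul_right,
    inner_value_polyH1_polyH1]
  split_ifs with h
  · subst h
    have h1 := moment_eigPoly_sq_pos δ n
    have h2 := Real.mul_self_sqrt h1.le
    have h3 := (Real.sqrt_pos.2 h1).ne'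
    set s := Real.sqrt (moment δ (eigPoly δ n * eigPoly δ n))
    rw [← h2]
    field_simp
  · rw [moment_eigPoly_mul_eigPoly one_le_delta h, mul_zero, mul_zero]

theorem eq_zero_of_inner_evec (u : L2 δ) (h : ∀ n, ⟪value (evec δ n), u⟫_ℝ = 0) : u = 0 := by
  refine eq_zero_of_inner_polyH1 u fun p => ?_
  let l : Polynomial ℝ →ₗ[ℝ] ℝ :=
    (innerSL ℝ u).toLinearMap.comp ((valueL δ).toLinearMap.comp (polyH1 δ))
  refine eq_zero_of_eigPoly (one_le_delta (δ := δ)) l (N := p.natDegree + 1) (fun j _ => ?_)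
    (Nat.lt_succ_self _)
  have h1 := h j
  rw [evec, value_smul, real_inner_smul_left, mul_eq_zero] at h1
  rw [real_inner_comm] at h1
  exact h1.resolve_left (inv_ne_zero (Real.sqrt_pos.2 (moment_eigPoly_sq_pos δ j)).ne')

theorem orthonormal_value_evec : Orthonormal ℝ fun n => value (evec δ n) :=
  orthonormal_iff_ite.2 inner_value_evec

/-- The eigenfunctions as a Hilbert basis of `L²(dμ)`. -/
def basisL2 (δ : ℕ) [Fact (2 ≤ δ)] : HilbertBasis ℕ ℝ (L2 δ) :=
  HilbertBasis.mkOfOrthogonalEqBot (orthonormal_value_evec (δ := δ)) (by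
    rw [Submodule.eq_bot_iff]
    intro u hu
    refine eq_zero_of_inner_evec u fun n => ?_
    exact (Submodule.mem_orthogonal _ _).1 hu _ (Submodule.subset_span ⟨n, rfl⟩))

theorem basisL2_apply (n : ℕ) : basisL2 δ n = value (evec δ n) := by
  rw [basisL2, HilbertBasis.coe_mkOfOrthogonalEqBot]

/-- The `H¹` norm of the `n`-th eigenfunction. -/
def evecNorm (δ n : ℕ) : ℝ := Real.sqrt (1 + 4 * n * (n + δ))

theorem evecNorm_pos {δ : ℕ} (n : ℕ) : 0 < evecNorm δ n := Real.sqrt_pos.2 (by positivity)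

theorem evecNorm_sq {δ : ℕ} (n : ℕ) : evecNorm δ n ^ 2 = 1 + 4 * n * (n + δ) := Real.sq_sqrt (by positivity)

theorem evecNorm_le_omega (n : ℕ) : evecNorm δ n ≤ omega δ n := by
  refine Real.sqrt_le_iff.2 ⟨(omega_pos n).le, ?_⟩
  have := two_le_delta_real (δ := δ)
  rw [omega]
  nlinarith

/-- The `H¹` and `L²` products with an eigenfunction are proportional, so orthogonality and
completeness pass from `L²` to `H¹`. -/
theorem H1.inner_evec (u : H1 δ) (n : ℕ) :
    ⟪u, evec δ n⟫_ℝ = evecNorm δ n ^ 2 * ⟪value u, value (evec δ n)⟫_ℝ := by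
  rw [H1.inner_eq, inner_weakDer_evec, evecNorm_sq]
  ring

theorem H1.inner_smul_left {δ : ℕ} (c : ℝ) (u v : H1 δ) : ⟪c • u, v⟫_ℝ = c * ⟪u, v⟫_ℝ := by
  rw [H1.inner_eq, H1.inner_eq, weakDer_smul, value_smul, real_inner_smul_left,
    real_inner_smul_left, mul_add]

theorem H1.inner_smul_right {δ : ℕ} (c : ℝ) (u v : H1 δ) : ⟪u, c • v⟫_ℝ = c * ⟪u, v⟫_ℝ := by
  rw [real_inner_comm, H1.inner_smul_left, real_inner_comm]

theorem orthonormal_evec : Orthonormal ℝ fun n => (evecNorm δ n)⁻¹ • evec δ n := by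
  rw [orthonormal_iff_ite]
  intro n m
  rw [H1.inner_smul_left, H1.inner_smul_right, H1.inner_evec, inner_value_evec]
  have h1 := (evecNorm_pos (δ := δ) n).ne'
  split_ifs with h
  · subst h
    field_simp
  · simp

/-- The normalised eigenfunctions as a Hilbert basis of `H¹`. -/
def basisH1 (δ : ℕ) [Fact (2 ≤ δ)] : HilbertBasis ℕ ℝ (H1 δ) :=
  HilbertBasis.mkOfOrthogonalEqBot (orthonormal_evec (δ := δ)) (by
    rw [Submodule.eq_bot_iff]
    intro u hu
    refine value_injective (eq_zero_of_inner_evec _ fun n => ?_)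
    have h := (Submodule.mem_orthogonal _ _).1 hu _ (Submodule.subset_span ⟨n, rfl⟩)
    have h1 := (evecNorm_pos (δ := δ) n).ne'
    rw [H1.inner_smul_left, real_inner_comm, H1.inner_evec] at h
    rw [real_inner_comm]
    have h2 := (mul_eq_zero.1 h).resolve_left (inv_ne_zero h1)
    exact (mul_eq_zero.1 h2).resolve_left (pow_ne_zero 2 h1))

theorem basisH1_apply (n : ℕ) : basisH1 δ n = (evecNorm δ n)⁻¹ • evec δ n := by
  rw [basisH1, HilbertBasis.coe_mkOfOrthogonalEqBot]

theorem inner_basisH1 (u : H1 δ) (n : ℕ) :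
    ⟪u, basisH1 δ n⟫_ℝ = evecNorm δ n * ⟪value u, value (evec δ n)⟫_ℝ := by
  rw [basisH1_apply, H1.inner_smul_right, H1.inner_evec]
  have h1 := (evecNorm_pos (δ := δ) n).ne'
  field_simp

theorem hasSum_inner_value (u v : L2 δ) :
    HasSum (fun n => ⟪u, value (evec δ n)⟫_ℝ * ⟪v, value (evec δ n)⟫_ℝ) ⟪u, v⟫_ℝ := by
  have h := (basisL2 δ).hasSum_inner_mul_inner u v
  simp only [basisL2_apply] at h
  simpa only [real_inner_comm] using h

theorem form_eq {δ : ℕ} (u v : H1 δ) :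
    form u v = ⟪u, v⟫_ℝ + ((δ : ℝ) ^ 2 - 1) * ⟪value u, value v⟫_ℝ := by
  rw [form, H1.inner_eq]; ring

theorem hasSum_form (u v : H1 δ) :
    HasSum (fun n => omega δ n ^ 2 *
      (⟪value u, value (evec δ n)⟫_ℝ * ⟪value v, value (evec δ n)⟫_ℝ)) (form u v) := by
  have h := (basisH1 δ).hasSum_inner_mul_inner u v
  have h2 := (hasSum_inner_value (value u) (value v)).mul_left ((δ : ℝ) ^ 2 - 1)
  rw [form_eq]
  refine (h.add h2).congr_fun fun n => ?_
  rw [real_inner_comm v, inner_basisH1, inner_basisH1]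
  have := evecNorm_sq (δ := δ) n
  rw [omega]
  linear_combination (-⟪value u, value (evec δ n)⟫_ℝ * ⟪value v, value (evec δ n)⟫_ℝ) * this

/-! ### Coefficients in phase space -/

/-- The coefficient of the position in the `n`-th mode. -/
def posCoeff (n : ℕ) (ζ : Phase δ) : ℝ := ⟪value ζ.fst, value (evec δ n)⟫_ℝ

/-- The coefficient of the momentum in the `n`-th mode. -/
def momCoeff (n : ℕ) (ζ : Phase δ) : ℝ := ⟪ζ.snd, value (evec δ n)⟫_ℝ

theorem L2.ext_evec {u v : L2 δ}
    (h : ∀ n, ⟪u, value (evec δ n)⟫_ℝ = ⟪v, value (evec δ n)⟫_ℝ) : u = v := by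
  rw [← sub_eq_zero]
  refine eq_zero_of_inner_evec _ fun n => ?_
  rw [real_inner_comm, inner_sub_left, h n, sub_self]

theorem Phase.ext_coeff {ζ η : Phase δ} (h1 : ∀ n, posCoeff n ζ = posCoeff n η)
    (h2 : ∀ n, momCoeff n ζ = momCoeff n η) : ζ = η := by
  apply (WithLp.equiv 2 _).injective
  exact Prod.ext (H1.ext_value (L2.ext_evec h1)) (L2.ext_evec h2)

theorem posCoeff_add {δ : ℕ} (n : ℕ) (ζ η : Phase δ) :
    posCoeff n (ζ + η) = posCoeff n ζ + posCoeff n η := by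
  simp only [posCoeff]
  rw [show (ζ + η).fst = ζ.fst + η.fst from rfl, value_add, inner_add_left]

theorem momCoeff_add {δ : ℕ} (n : ℕ) (ζ η : Phase δ) :
    momCoeff n (ζ + η) = momCoeff n ζ + momCoeff n η := by
  simp only [momCoeff]
  rw [show (ζ + η).snd = ζ.snd + η.snd from rfl, inner_add_left]

theorem posCoeff_smul {δ : ℕ} (n : ℕ) (c : ℝ) (ζ : Phase δ) :
    posCoeff n (c • ζ) = c * posCoeff n ζ := by
  simp only [posCoeff]
  rw [show (c • ζ).fst = c • ζ.fst from rfl, value_smul, real_inner_smul_left]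

theorem momCoeff_smul {δ : ℕ} (n : ℕ) (c : ℝ) (ζ : Phase δ) :
    momCoeff n (c • ζ) = c * momCoeff n ζ := by
  simp only [momCoeff]
  rw [show (c • ζ).snd = c • ζ.snd from rfl, real_inner_smul_left]

theorem hasSum_harmonicEnergy (ζ : Phase δ) :
    HasSum (fun n => omega δ n ^ 2 * posCoeff n ζ ^ 2 + momCoeff n ζ ^ 2) (harmonicEnergy ζ) := by
  have h := (hasSum_form ζ.fst ζ.fst).add (hasSum_inner_value ζ.snd ζ.snd)
  rw [real_inner_self_eq_norm_sq] at h
  refine h.congr_fun fun n => ?_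
  simp only [posCoeff, momCoeff]
  ring

/-! ### The linear flow -/

/-- The common square-summable majorant makes `∑ (c_n(t) - c_n(t₀))²` converge uniformly in `t`. Its
sum is `‖u t - u t₀‖²`, hence continuous and zero at `t₀`. -/
theorem _root_.HilbertBasis.exists_continuous_of_coeff {H : Type*} [NormedAddCommGroup H]
    [InnerProductSpace ℝ H] (b : HilbertBasis ℕ ℝ H) (c : ℕ → ℝ → ℝ) (d : ℕ → ℝ)
    (hc : ∀ n, Continuous (c n)) (hd : ∀ n t, |c n t| ≤ d n) (hs : Summable fun n => d n ^ 2) :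
    ∃ u : ℝ → H, Continuous u ∧ ∀ n t, ⟪u t, b n⟫_ℝ = c n t := by
  have hmem : ∀ t, Memℓp (fun n => c n t) 2 := fun t => by
    refine memℓp_gen ?_
    simp only [ENNReal.toReal_ofNat, Real.rpow_ofNat]
    refine Summable.of_nonneg_of_le (fun n => by positivity) (fun n => ?_) hs
    rw [Real.norm_eq_abs]
    exact pow_le_pow_left₀ (abs_nonneg _) (hd n t) 2
  let u : ℝ → H := fun t => b.repr.symm ⟨fun n => c n t, hmem t⟩
  have hu : ∀ n t, ⟪u t, b n⟫_ℝ = c n t := fun n t => by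
    rw [real_inner_comm, ← b.repr_apply_apply]
    simp [u]
  refine ⟨u, ?_, hu⟩
  rw [continuous_iff_continuousAt]
  intro t₀
  have hnorm : ∀ t, ‖u t - u t₀‖ ^ 2 = ∑' n, (c n t - c n t₀) ^ 2 := fun t => by
    rw [← real_inner_self_eq_norm_sq, ← (b.hasSum_inner_mul_inner _ _).tsum_eq]
    refine tsum_congr fun n => ?_
    rw [real_inner_comm (u t - u t₀) (b n), inner_sub_left, hu, hu, sq]
  have hcont : Continuous fun t => ∑' n, (c n t - c n t₀) ^ 2 := by
    refine continuous_tsum (u := fun n => 4 * d n ^ 2) (fun n => by have := hc n; fun_prop)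
      (hs.mul_left 4) fun n t => ?_
    have h1 := hd n t
    have h2 := hd n t₀
    rw [Real.norm_eq_abs, abs_of_nonneg (sq_nonneg _)]
    have h3 : |c n t - c n t₀| ≤ 2 * d n := (abs_sub _ _).trans (by linarith)
    have := pow_le_pow_left₀ (abs_nonneg _) h3 2
    rw [sq_abs] at this
    linarith
  have h0 : Tendsto (fun t => ‖u t - u t₀‖ ^ 2) (𝓝 t₀) (𝓝 0) := by
    have := hcont.tendsto t₀
    simp only [sub_self, ne_eq, OfNat.ofNat_ne_zero, not_false_eq_true, zero_pow, tsum_zero]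
      at this
    exact this.congr fun t => (hnorm t).symm
  have h1 : Tendsto (fun t => ‖u t - u t₀‖) (𝓝 t₀) (𝓝 0) := by
    have := h0.sqrt
    simpa [Real.sqrt_sq] using this
  exact tendsto_iff_norm_sub_tendsto_zero.2 h1

/-- The position coefficient at time `t` of a mode with initial data `(a, b)`. -/
def posAt (w a b t : ℝ) : ℝ := a * Real.cos (w * t) + b / w * Real.sin (w * t)

/-- The momentum coefficient at time `t` of a mode with initial data `(a, b)`. -/
def momAt (w a b t : ℝ) : ℝ := -(w * a * Real.sin (w * t)) + b * Real.cos (w * t)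

theorem hasDerivAt_cos_mul (w t : ℝ) :
    HasDerivAt (fun t => Real.cos (w * t)) (-(w * Real.sin (w * t))) t := by
  have := (Real.hasDerivAt_cos (w * t)).comp t ((hasDerivAt_id t).const_mul w)
  exact HasDerivAt.congr_deriv this (by ring)

theorem hasDerivAt_sin_mul (w t : ℝ) :
    HasDerivAt (fun t => Real.sin (w * t)) (w * Real.cos (w * t)) t := by
  have := (Real.hasDerivAt_sin (w * t)).comp t ((hasDerivAt_id t).const_mul w)
  exact HasDerivAt.congr_deriv this (by ring)

theorem hasDerivAt_posAt {w : ℝ} (hw : w ≠ 0) (a b t : ℝ) :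
    HasDerivAt (posAt w a b) (momAt w a b t) t := by
  have := ((hasDerivAt_cos_mul w t).const_mul a).add ((hasDerivAt_sin_mul w t).const_mul (b / w))
  refine HasDerivAt.congr_deriv this ?_
  rw [momAt]
  field_simp

theorem hasDerivAt_momAt {w : ℝ} (hw : w ≠ 0) (a b t : ℝ) :
    HasDerivAt (momAt w a b) (-(w ^ 2 * posAt w a b t)) t := by
  have := ((hasDerivAt_sin_mul w t).const_mul (w * a)).neg.add
    ((hasDerivAt_cos_mul w t).const_mul b)
  refine HasDerivAt.congr_deriv this ?_
  rw [posAt]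
  field_simp
  ring

theorem abs_posAt_le {w : ℝ} (hw : 0 < w) (a b t : ℝ) :
    w * |posAt w a b t| ≤ w * |a| + |b| := by
  have h : w * |posAt w a b t| = |w * a * Real.cos (w * t) + b * Real.sin (w * t)| := by
    rw [← abs_of_pos hw, ← abs_mul, abs_of_pos hw, posAt]
    congr 1
    field_simp
  rw [h]
  refine (abs_add_le _ _).trans ?_
  rw [abs_mul, abs_mul, abs_mul, abs_of_pos hw]
  have h1 := Real.abs_cos_le_one (w * t)
  have h2 := Real.abs_sin_le_one (w * t)
  exact add_le_add (mul_le_of_le_one_right (by positivity) h1)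
    (mul_le_of_le_one_right (by positivity) h2)

theorem abs_momAt_le {w : ℝ} (hw : 0 < w) (a b t : ℝ) :
    |momAt w a b t| ≤ w * |a| + |b| := by
  rw [momAt]
  refine (abs_add_le _ _).trans ?_
  rw [abs_neg, abs_mul, abs_mul, abs_mul, abs_of_pos hw]
  have h1 := Real.abs_cos_le_one (w * t)
  have h2 := Real.abs_sin_le_one (w * t)
  exact add_le_add (mul_le_of_le_one_right (by positivity) h2)
    (mul_le_of_le_one_right (by positivity) h1)

theorem summable_modeBound (ζ : Phase δ) :
    Summable fun n => (omega δ n * |posCoeff n ζ| + |momCoeff n ζ|) ^ 2 := by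
  refine Summable.of_nonneg_of_le (fun n => sq_nonneg _) (fun n => ?_)
    ((hasSum_harmonicEnergy ζ).summable.mul_left 2)
  have h1 := sq_abs (posCoeff n ζ)
  have h2 := sq_abs (momCoeff n ζ)
  rw [← h1, ← h2]
  nlinarith [sq_nonneg (omega δ n * |posCoeff n ζ| - |momCoeff n ζ|)]

theorem summable_modeBound_mul (ζ : Phase δ) {v : ℕ → ℝ} (hv : Summable fun n => v n ^ 2) :
    Summable fun n => (omega δ n * |posCoeff n ζ| + |momCoeff n ζ|) * |v n| := by
  refine Summable.of_nonneg_of_le (fun n => ?_) (fun n => ?_)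
    ((summable_modeBound ζ).add hv)
  · have := omega_pos (δ := δ) n
    positivity
  · rw [← sq_abs (v n)]
    nlinarith [sq_nonneg (omega δ n * |posCoeff n ζ| + |momCoeff n ζ| - |v n|),
      sq_nonneg (omega δ n * |posCoeff n ζ| + |momCoeff n ζ|), sq_nonneg |v n|]

/-- Tested against `v`, both equations are series in the modes that may be differentiated term by
term, with a majorant uniform in time. -/
theorem isLinearSolution_of_coeff {ζ : Phase δ} {φ : ℝ → Phase δ} (hc : Continuous φ)
    (h1 : ∀ n t, posCoeff n (φ t) = posAt (omega δ n) (posCoeff n ζ) (momCoeff n ζ) t)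
    (h2 : ∀ n t, momCoeff n (φ t) = momAt (omega δ n) (posCoeff n ζ) (momCoeff n ζ) t) :
    IsLinearSolution ζ φ where
  continuous := hc
  initial := Phase.ext_coeff (fun n => by rw [h1]; simp [posAt])
    (fun n => by rw [h2]; simp [momAt])
  deriv_fst v t := by
    set vn : ℕ → ℝ := fun n => ⟪value v, value (evec δ n)⟫_ℝ
    have hv : Summable fun n => vn n ^ 2 := by
      simpa only [sq] using (hasSum_inner_value (value v) (value v)).summable
    have hsum : ∀ s, HasSum (fun n => posAt (omega δ n) (posCoeff n ζ) (momCoeff n ζ) s * vn n)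
        ⟪value (φ s).fst, value v⟫_ℝ := fun s =>
      (hasSum_inner_value (value (φ s).fst) (value v)).congr_fun fun n => by
        rw [← h1 n s]; rfl
    have hsum2 : HasSum (fun n => momAt (omega δ n) (posCoeff n ζ) (momCoeff n ζ) t * vn n)
        ⟪(φ t).snd, value v⟫_ℝ :=
      (hasSum_inner_value (φ t).snd (value v)).congr_fun fun n => by rw [← h2 n t]; rfl
    have hd := hasDerivAt_tsum (summable_modeBound_mul ζ hv)
      (g := fun n s => posAt (omega δ n) (posCoeff n ζ) (momCoeff n ζ) s * vn n)
      (g' := fun n s => momAt (omega δ n) (posCoeff n ζ) (momCoeff n ζ) s * vn n)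
      (fun n s => (hasDerivAt_posAt (omega_pos n).ne' _ _ s).mul_const _)
      (fun n s => by
        rw [norm_mul, Real.norm_eq_abs, Real.norm_eq_abs]
        exact mul_le_mul_of_nonneg_right (abs_momAt_le (omega_pos n) _ _ _) (abs_nonneg _))
      (hsum 0).summable t
    rw [hsum2.tsum_eq] at hd
    rwa [funext fun s => (hsum s).tsum_eq] at hd
  deriv_snd v t := by
    set vn : ℕ → ℝ := fun n => ⟪value v, value (evec δ n)⟫_ℝ
    -- The derivative of the momentum costs `ω_n²`: one factor is borne by the data and the other by
    -- the test function, which is possible because `v` lies in `H¹`.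
    have hv : Summable fun n => (omega δ n * vn n) ^ 2 := by
      refine (hasSum_form v v).summable.congr fun n => ?_
      simp only [vn]
      ring
    have hsum : ∀ s, HasSum (fun n => momAt (omega δ n) (posCoeff n ζ) (momCoeff n ζ) s * vn n)
        ⟪(φ s).snd, value v⟫_ℝ := fun s =>
      (hasSum_inner_value (φ s).snd (value v)).congr_fun fun n => by rw [← h2 n s]; rfl
    have hsum2 : HasSum (fun n =>
        -(omega δ n ^ 2 * posAt (omega δ n) (posCoeff n ζ) (momCoeff n ζ) t) * vn n)
        (-form (φ t).fst v) :=
      (hasSum_form (φ t).fst v).neg.congr_fun fun n => by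
        rw [← h1 n t]; simp only [posCoeff, vn]; ring
    have hd := hasDerivAt_tsum (summable_modeBound_mul ζ hv)
      (g := fun n s => momAt (omega δ n) (posCoeff n ζ) (momCoeff n ζ) s * vn n)
      (g' := fun n s => -(omega δ n ^ 2 * posAt (omega δ n) (posCoeff n ζ) (momCoeff n ζ) s) * vn n)
      (fun n s => (hasDerivAt_momAt (omega_pos n).ne' _ _ s).mul_const _)
      (fun n s => by
        have hw := omega_pos (δ := δ) n
        rw [norm_mul, Real.norm_eq_abs, Real.norm_eq_abs, abs_neg, abs_mul, abs_mul,
          abs_of_pos hw, abs_of_pos (pow_pos hw 2)]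
        have := abs_posAt_le hw (posCoeff n ζ) (momCoeff n ζ) s
        calc _ = (omega δ n * |posAt (omega δ n) (posCoeff n ζ) (momCoeff n ζ) s|) *
              (omega δ n * |vn n|) := by ring
          _ ≤ _ := mul_le_mul_of_nonneg_right this (by positivity))
      (hsum 0).summable t
    rw [hsum2.tsum_eq] at hd
    rwa [funext fun s => (hsum s).tsum_eq] at hd

theorem exists_isLinearSolution (ζ : Phase δ) : ∃ φ, IsLinearSolution ζ φ := by
  obtain ⟨u, hu, hu2⟩ := (basisH1 δ).exists_continuous_of_coeff
    (fun n t => evecNorm δ n * posAt (omega δ n) (posCoeff n ζ) (momCoeff n ζ) t)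
    (fun n => omega δ n * |posCoeff n ζ| + |momCoeff n ζ|)
    (fun n => by unfold posAt; fun_prop)
    (fun n t => by
      rw [abs_mul, abs_of_pos (evecNorm_pos n)]
      exact (mul_le_mul_of_nonneg_right (evecNorm_le_omega n) (abs_nonneg _)).trans
        (abs_posAt_le (omega_pos n) _ _ _))
    (summable_modeBound ζ)
  obtain ⟨v, hv, hv2⟩ := (basisL2 δ).exists_continuous_of_coeff
    (fun n t => momAt (omega δ n) (posCoeff n ζ) (momCoeff n ζ) t)
    (fun n => omega δ n * |posCoeff n ζ| + |momCoeff n ζ|)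
    (fun n => by unfold momAt; fun_prop)
    (fun n t => abs_momAt_le (omega_pos n) _ _ _)
    (summable_modeBound ζ)
  refine ⟨fun t => WithLp.toLp 2 (u t, v t), isLinearSolution_of_coeff ?_ ?_ ?_⟩
  · exact (WithLp.prod_continuous_toLp 2 _ _).comp (hu.prodMk hv)
  · intro n t
    have h := hu2 n t
    rw [inner_basisH1] at h
    exact mul_left_cancel₀ (evecNorm_pos n).ne' h
  · intro n t
    have h := hv2 n t
    rwa [basisL2_apply] at h

theorem IsLinearSolution.coeff {ζ : Phase δ} {φ : ℝ → Phase δ} (h : IsLinearSolution ζ φ)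
    (n : ℕ) (t : ℝ) :
    posCoeff n (φ t) = posAt (omega δ n) (posCoeff n ζ) (momCoeff n ζ) t ∧
    momCoeff n (φ t) = momAt (omega δ n) (posCoeff n ζ) (momCoeff n ζ) t := by
  set w := omega δ n
  have hw : w ≠ 0 := (omega_pos n).ne'
  have ha : ∀ t, HasDerivAt (fun s => posCoeff n (φ s)) (momCoeff n (φ t)) t :=
    h.deriv_fst (evec δ n)
  have hb : ∀ t, HasDerivAt (fun s => momCoeff n (φ s)) (-(w ^ 2 * posCoeff n (φ t))) t := by
    intro t
    have := h.deriv_snd (evec δ n) t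
    rwa [form_evec] at this
  -- Testing with `e_n` gives a harmonic oscillator. Rotating `(ω a, b)` back by the angle `ω s`
  -- produces two constants of motion, which determine the solution.
  have hp : ∀ t, HasDerivAt (fun s => w * posCoeff n (φ s) * Real.cos (w * s) -
      momCoeff n (φ s) * Real.sin (w * s)) 0 t := fun t => by
    refine HasDerivAt.congr_deriv ((((ha t).const_mul w).mul (hasDerivAt_cos_mul w t)).sub
      ((hb t).mul (hasDerivAt_sin_mul w t))) ?_
    ring
  have hq : ∀ t, HasDerivAt (fun s => w * posCoeff n (φ s) * Real.sin (w * s) +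
      momCoeff n (φ s) * Real.cos (w * s)) 0 t := fun t => by
    refine HasDerivAt.congr_deriv ((((ha t).const_mul w).mul (hasDerivAt_sin_mul w t)).add
      ((hb t).mul (hasDerivAt_cos_mul w t))) ?_
    ring
  have hp2 := is_const_of_deriv_eq_zero (fun t => (hp t).differentiableAt)
    (fun t => (hp t).deriv) t 0
  have hq2 := is_const_of_deriv_eq_zero (fun t => (hq t).differentiableAt)
    (fun t => (hq t).deriv) t 0
  simp only [mul_zero, Real.cos_zero, Real.sin_zero, h.initial, mul_one, sub_zero, zero_add]
    at hp2 hq2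
  have hcs := Real.sin_sq_add_cos_sq (w * t)
  constructor
  · rw [posAt]
    field_simp
    linear_combination (Real.cos (w * t)) * hp2 + (Real.sin (w * t)) * hq2 -
      w * posCoeff n (φ t) * hcs
  · rw [momAt]
    linear_combination (-Real.sin (w * t)) * hp2 + (Real.cos (w * t)) * hq2 -
      momCoeff n (φ t) * hcs

theorem existsUnique_isLinearSolution (ζ : Phase δ) : ∃! φ, IsLinearSolution ζ φ := by
  obtain ⟨φ, hφ⟩ := exists_isLinearSolution ζ
  refine ⟨φ, hφ, fun ψ hψ => funext fun t => Phase.ext_coeff (fun n => ?_) fun n => ?_⟩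
  · rw [(hφ.coeff n t).1, (hψ.coeff n t).1]
  · rw [(hφ.coeff n t).2, (hψ.coeff n t).2]

theorem isLinearSolution_linearFlow (ζ : Phase δ) :
    IsLinearSolution ζ fun t => linearFlow t ζ := by
  have h := exists_isLinearSolution ζ
  have : (fun t => linearFlow t ζ) = h.choose := by
    funext t
    rw [linearFlow, dif_pos h]
  rw [this]
  exact h.choose_spec

theorem posCoeff_linearFlow (n : ℕ) (t : ℝ) (ζ : Phase δ) :
    posCoeff n (linearFlow t ζ) = posAt (omega δ n) (posCoeff n ζ) (momCoeff n ζ) t :=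
  ((isLinearSolution_linearFlow ζ).coeff n t).1

theorem momCoeff_linearFlow (n : ℕ) (t : ℝ) (ζ : Phase δ) :
    momCoeff n (linearFlow t ζ) = momAt (omega δ n) (posCoeff n ζ) (momCoeff n ζ) t :=
  ((isLinearSolution_linearFlow ζ).coeff n t).2

theorem continuous_linearFlow (ζ : Phase δ) : Continuous fun t => linearFlow t ζ :=
  (isLinearSolution_linearFlow ζ).continuous

theorem linearFlow_add (t : ℝ) (ζ η : Phase δ) :
    linearFlow t (ζ + η) = linearFlow t ζ + linearFlow t η := by
  refine Phase.ext_coeff (fun n => ?_) fun n => ?_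
  · simp only [posCoeff_add, posCoeff_linearFlow, momCoeff_add, posAt]; ring
  · simp only [momCoeff_add, momCoeff_linearFlow, posCoeff_add, momAt]; ring

theorem linearFlow_smul (t c : ℝ) (ζ : Phase δ) :
    linearFlow t (c • ζ) = c • linearFlow t ζ := by
  refine Phase.ext_coeff (fun n => ?_) fun n => ?_
  · simp only [posCoeff_smul, posCoeff_linearFlow, momCoeff_smul, posAt]; ring
  · simp only [momCoeff_smul, momCoeff_linearFlow, posCoeff_smul, momAt]; ring

theorem linearFlow_linearFlow (s t : ℝ) (ζ : Phase δ) :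
    linearFlow s (linearFlow t ζ) = linearFlow (s + t) ζ := by
  refine Phase.ext_coeff (fun n => ?_) fun n => ?_
  · have := (omega_pos (δ := δ) n).ne'
    simp only [posCoeff_linearFlow, momCoeff_linearFlow, posAt, momAt, mul_add, Real.cos_add,
      Real.sin_add]
    field_simp
    ring
  · have := (omega_pos (δ := δ) n).ne'
    simp only [posCoeff_linearFlow, momCoeff_linearFlow, posAt, momAt, mul_add, Real.cos_add,
      Real.sin_add]
    field_simp
    ring

theorem linearFlow_periodic (ζ : Phase δ) :
    Function.Periodic (fun t => linearFlow t ζ) (2 * Real.pi) := by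
  intro t
  have h : ∀ n, omega δ n * (t + 2 * Real.pi) = omega δ n * t + (δ + 2 * n : ℕ) * (2 * Real.pi) :=
    fun n => by rw [omega]; push_cast; ring
  refine Phase.ext_coeff (fun n => ?_) fun n => ?_
  · simp only [posCoeff_linearFlow, posAt, h, Real.cos_add_nat_mul_two_pi,
      Real.sin_add_nat_mul_two_pi]
  · simp only [momCoeff_linearFlow, momAt, h, Real.cos_add_nat_mul_two_pi,
      Real.sin_add_nat_mul_two_pi]

theorem harmonicEnergy_linearFlow (t : ℝ) (ζ : Phase δ) :
    harmonicEnergy (linearFlow t ζ) = harmonicEnergy ζ := by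
  refine (hasSum_harmonicEnergy (linearFlow t ζ)).unique
    ((hasSum_harmonicEnergy ζ).congr_fun fun n => ?_)
  have := (omega_pos (δ := δ) n).ne'
  have h := Real.sin_sq_add_cos_sq (omega δ n * t)
  rw [posCoeff_linearFlow, momCoeff_linearFlow, posAt, momAt]
  field_simp
  linear_combination (omega δ n ^ 2 * posCoeff n ζ ^ 2 + momCoeff n ζ ^ 2) * h

end

end KG

/-! ### Weighted Hardy and Sobolev inequalities, and boundedness of the product `√(wW) u v` -/

namespace KG

noncomputable section

/-! ### A weighted Sobolev inequality -/

/-- The square root of `w W`, i.e. `sin x cos^(2δ-2) x`. -/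
def rootWeight (δ : ℕ) (x : ℝ) : ℝ := Real.sin x * Real.cos x ^ (2 * δ - 2)

theorem rootWeight_sq (δ : ℕ) (x : ℝ) : rootWeight δ x ^ 2 = weight δ x * nonlinWeight δ x := by
  rw [rootWeight, weight, nonlinWeight]; ring

theorem continuous_rootWeight (δ : ℕ) : Continuous (rootWeight δ) := by
  unfold rootWeight; fun_prop

theorem sin_pos_of_mem_I {x : ℝ} (hx : x ∈ I) : 0 < Real.sin x :=
  Real.sin_pos_of_pos_of_lt_pi hx.1 (by linarith [hx.2, Real.pi_pos])

theorem cos_pos_of_mem_I {x : ℝ} (hx : x ∈ I) : 0 < Real.cos x :=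
  Real.cos_pos_of_mem_Ioo ⟨by linarith [hx.1, Real.pi_pos], hx.2⟩

theorem rootWeight_pos {δ : ℕ} {x : ℝ} (hx : x ∈ I) : 0 < rootWeight δ x :=
  mul_pos (sin_pos_of_mem_I hx) (pow_pos (cos_pos_of_mem_I hx) _)

theorem integral_I_eq (f : ℝ → ℝ) : ∫ x in I, f x = ∫ x in (0 : ℝ)..(Real.pi / 2), f x := by
  rw [intervalIntegral.integral_of_le (by positivity), integral_Ioc_eq_integral_Ioo]

theorem norm_sq_value_ofSmooth (δ : ℕ) {F : ℝ → ℝ} (hF : ContDiff ℝ 1 F) :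
    ‖value (ofSmooth δ F hF)‖ ^ 2 = ∫ x in (0 : ℝ)..(Real.pi / 2), weight δ x * F x ^ 2 := by
  rw [← real_inner_self_eq_norm_sq, L2.inner_eq, ← integral_I_eq, ← integral_mu]
  refine integral_congr_ae ?_
  filter_upwards [value_ofSmooth_ae δ F hF] with x hx
  rw [hx, sq]

theorem norm_sq_weakDer_ofSmooth (δ : ℕ) {F : ℝ → ℝ} (hF : ContDiff ℝ 1 F) :
    ‖weakDer (ofSmooth δ F hF)‖ ^ 2 =
      ∫ x in (0 : ℝ)..(Real.pi / 2), weight δ x * deriv F x ^ 2 := by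
  rw [← real_inner_self_eq_norm_sq, L2.inner_eq, ← integral_I_eq, ← integral_mu]
  refine integral_congr_ae ?_
  filter_upwards [weakDer_ofSmooth_ae δ F hF] with x hx
  rw [hx, sq]

/-- A Hardy inequality. -/
theorem integral_cos_pow_mul_sq_le {δ : ℕ} (hδ : 1 ≤ δ) {F : ℝ → ℝ} (hF : ContDiff ℝ 1 F) :
    ∫ x in (0 : ℝ)..(Real.pi / 2), Real.cos x ^ (2 * δ - 2) * F x ^ 2 ≤
      4 * δ * ‖value (ofSmooth δ F hF)‖ ^ 2 + 4 * ‖weakDer (ofSmooth δ F hF)‖ ^ 2 := by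
  rw [norm_sq_value_ofSmooth, norm_sq_weakDer_ofSmooth]
  obtain ⟨m, rfl⟩ : ∃ m, δ = m + 1 := ⟨δ - 1, by omega⟩
  have e : 2 * (m + 1) - 2 = 2 * m := by omega
  have hFc : Continuous F := hF.continuous
  have hdc : Continuous (deriv F) := hF.continuous_deriv le_rfl
  have hwc := continuous_weight (m + 1)
  set d : ℝ → ℝ := fun x =>
    (Real.cos x ^ (2 * m + 2) - (2 * m + 1) * (Real.sin x ^ 2 * Real.cos x ^ (2 * m))) * F x ^ 2 +
      2 * (Real.sin x * Real.cos x ^ (2 * m + 1)) * (F x * deriv F x) with hd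
  have hdcont : Continuous d := by fun_prop
  have hder : ∀ x, HasDerivAt (fun x => Real.sin x * Real.cos x ^ (2 * m + 1) * F x ^ 2) (d x) x :=
    fun x => by
      have h1 := ((Real.hasDerivAt_sin x).mul ((Real.hasDerivAt_cos x).pow (2 * m + 1))).mul
        ((hF.differentiable (by simp) x).hasDerivAt.pow 2)
      refine HasDerivAt.congr_deriv h1 ?_
      simp only [hd, Pi.pow_apply, Pi.mul_apply, Nat.add_sub_cancel]
      push_cast
      ring
  -- The primitive vanishes at both ends, through `sin 0` and `cos (π/2)`.
  have hint : ∫ x in (0 : ℝ)..(Real.pi / 2), d x = 0 := by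
    rw [intervalIntegral.integral_eq_sub_of_hasDerivAt (fun x _ => hder x)
      (hdcont.intervalIntegrable _ _)]
    simp
  have hle : ∫ x in (0 : ℝ)..(Real.pi / 2), Real.cos x ^ (2 * m) * F x ^ 2 ≤
      ∫ x in (0 : ℝ)..(Real.pi / 2), (2 * d x + 4 * (m + 1) * (weight (m + 1) x * F x ^ 2) +
        4 * (weight (m + 1) x * deriv F x ^ 2)) := by
    refine intervalIntegral.integral_mono (by positivity)
      (Continuous.intervalIntegrable (by fun_prop) _ _)
      (Continuous.intervalIntegrable (by fun_prop) _ _) fun x => ?_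
    simp only [hd, weight, e]
    have hs : Real.sin x ^ 2 = 1 - Real.cos x ^ 2 := by rw [← Real.sin_sq_add_cos_sq x]; ring
    have e1 : Real.cos x ^ (2 * m + 2) = Real.cos x ^ (2 * m) * Real.cos x ^ 2 := pow_add _ _ _
    have e2 : Real.cos x ^ (2 * m + 1) = Real.cos x ^ (2 * m) * Real.cos x := pow_succ _ _
    have h0 : 0 ≤ Real.cos x ^ (2 * m) := by rw [pow_mul]; exact pow_nonneg (sq_nonneg _) _
    rw [e1, e2]
    generalize Real.cos x ^ (2 * m) = P at h0
    have key : 0 ≤ P * (Real.sin x * F x) ^ 2 + P * (Real.cos x * F x +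
        2 * (Real.sin x * deriv F x)) ^ 2 := by positivity
    have hs2 : Real.cos x ^ 2 = 1 - Real.sin x ^ 2 := by rw [hs]; ring
    -- The constants `4 (m + 1)` and `4` are chosen so that the difference of the two sides, after
    -- adding twice the exact derivative `d`, is a sum of squares.
    have : 2 * ((P * Real.cos x ^ 2 - (2 * m + 1) * (Real.sin x ^ 2 * P)) * F x ^ 2 +
        2 * (Real.sin x * (P * Real.cos x)) * (F x * deriv F x)) +
        4 * (m + 1) * (Real.sin x ^ 2 * P * F x ^ 2) + 4 * (Real.sin x ^ 2 * P * deriv F x ^ 2) -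
        P * F x ^ 2 = P * (Real.sin x * F x) ^ 2 + P * (Real.cos x * F x +
        2 * (Real.sin x * deriv F x)) ^ 2 := by
      rw [mul_pow, add_sq, mul_pow (Real.cos x), hs2]
      ring
    linarith
  rw [e]
  refine hle.trans (le_of_eq ?_)
  rw [intervalIntegral.integral_add, intervalIntegral.integral_add,
    intervalIntegral.integral_const_mul, intervalIntegral.integral_const_mul,
    intervalIntegral.integral_const_mul, hint]
  · push_cast; ring
  all_goals exact Continuous.intervalIntegrable (by fun_prop) _ _

/-- The function `sin cos^(2δ-2) F²` vanishes at `0`, so it is the integral of its derivative. That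
derivative is at most `2 cos^(2δ-2) F² + w F'²`, and the Hardy inequality controls the first term.
-/
theorem rootWeight_mul_sq_le {δ : ℕ} (hδ : 1 ≤ δ) {F : ℝ → ℝ} (hF : ContDiff ℝ 1 F) {x₀ : ℝ}
    (hx₀ : x₀ ∈ I) :
    rootWeight δ x₀ * F x₀ ^ 2 ≤ (8 * δ + 9) * ‖ofSmooth δ F hF‖ ^ 2 := by
  have hK := integral_cos_pow_mul_sq_le hδ hF
  have hB := norm_sq_weakDer_ofSmooth δ hF
  have hFc : Continuous F := hF.continuous
  have hdc : Continuous (deriv F) := hF.continuous_deriv le_rfl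
  have hwc := continuous_weight δ
  set n := 2 * δ - 2 with hn
  set d : ℝ → ℝ := fun x =>
    (Real.cos x ^ (n + 1) - n * (Real.sin x ^ 2 * Real.cos x ^ (n - 1))) * F x ^ 2 +
      2 * (Real.sin x * Real.cos x ^ n) * (F x * deriv F x) with hd
  have hdcont : Continuous d := by fun_prop
  have hder : ∀ x, HasDerivAt (fun x => Real.sin x * Real.cos x ^ n * F x ^ 2) (d x) x :=
    fun x => by
      have h1 := ((Real.hasDerivAt_sin x).mul ((Real.hasDerivAt_cos x).pow n)).mul
        ((hF.differentiable (by simp) x).hasDerivAt.pow 2)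
      refine HasDerivAt.congr_deriv h1 ?_
      simp only [hd, Pi.pow_apply, Pi.mul_apply]
      push_cast
      ring
  have hint : ∫ x in (0 : ℝ)..x₀, d x = rootWeight δ x₀ * F x₀ ^ 2 := by
    rw [intervalIntegral.integral_eq_sub_of_hasDerivAt (fun x _ => hder x)
      (hdcont.intervalIntegrable _ _)]
    simp [rootWeight, ← hn]
  set g : ℝ → ℝ := fun x => 2 * (Real.cos x ^ n * F x ^ 2) + weight δ x * deriv F x ^ 2 with hg
  have hgc : Continuous g := by fun_prop
  have hcos : ∀ x, 0 ≤ Real.cos x ^ n := fun x => by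
    rw [hn, show 2 * δ - 2 = 2 * (δ - 1) by omega, pow_mul]
    exact pow_nonneg (sq_nonneg _) _
  have hg0 : ∀ x, 0 ≤ g x := fun x => by
    have := hcos x
    simp only [hg, weight, ← hn]
    positivity
  have hdg : ∀ x ∈ Ioo 0 x₀, d x ≤ g x := fun x hx => by
    have hxI : x ∈ I := ⟨hx.1, hx.2.trans hx₀.2⟩
    have hc := cos_pos_of_mem_I hxI
    have hs := sin_pos_of_mem_I hxI
    have hc1 := Real.cos_le_one x
    have hP := hcos x
    -- The term in which `cos^n` is differentiated has a favourable sign and is dropped.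
    have h1 : 0 ≤ n * (Real.sin x ^ 2 * Real.cos x ^ (n - 1)) * F x ^ 2 := by positivity
    have h2 : Real.cos x ^ (n + 1) * F x ^ 2 ≤ Real.cos x ^ n * F x ^ 2 := by
      rw [pow_succ]
      exact mul_le_mul_of_nonneg_right (mul_le_of_le_one_right hP hc1) (sq_nonneg _)
    have h3 : 2 * (Real.sin x * Real.cos x ^ n) * (F x * deriv F x) ≤
        Real.cos x ^ n * F x ^ 2 + Real.sin x ^ 2 * Real.cos x ^ n * deriv F x ^ 2 := by
      have := mul_nonneg hP (sq_nonneg (F x - Real.sin x * deriv F x))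
      nlinarith
    simp only [hd, hg, weight, ← hn]
    linarith
  have step1 : ∫ x in (0 : ℝ)..x₀, d x ≤ ∫ x in (0 : ℝ)..x₀, g x :=
    intervalIntegral.integral_mono_on_of_le_Ioo hx₀.1.le (hdcont.intervalIntegrable _ _)
      (hgc.intervalIntegrable _ _) hdg
  have step2 : ∫ x in (0 : ℝ)..x₀, g x ≤ ∫ x in (0 : ℝ)..(Real.pi / 2), g x :=
    intervalIntegral.integral_mono_interval le_rfl hx₀.1.le hx₀.2.le
      (ae_of_all _ hg0) (hgc.intervalIntegrable _ _)
  have step3 : ∫ x in (0 : ℝ)..(Real.pi / 2), g x =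
      2 * (∫ x in (0 : ℝ)..(Real.pi / 2), Real.cos x ^ n * F x ^ 2) +
        ‖weakDer (ofSmooth δ F hF)‖ ^ 2 := by
    rw [hB, ← intervalIntegral.integral_const_mul, ← intervalIntegral.integral_add]
    all_goals exact Continuous.intervalIntegrable (by fun_prop) _ _
  rw [hint] at step1
  rw [H1.norm_sq_eq]
  have h4 := sq_nonneg ‖weakDer (ofSmooth δ F hF)‖
  have h5 := sq_nonneg ‖value (ofSmooth δ F hF)‖
  have h6 : 0 ≤ (8 * (δ : ℝ)) * ‖weakDer (ofSmooth δ F hF)‖ ^ 2 := by positivity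
  linarith

variable {δ : ℕ} [Fact (2 ≤ δ)]

/-- Thanks to the basis of eigenfunctions, estimates in `H¹` need only be proved for smooth
functions. -/
theorem denseRange_polyH1 : DenseRange (polyH1 δ) := by
  have h := (basisH1 δ).dense_span
  have h2 : Submodule.span ℝ (range (basisH1 δ)) ≤ LinearMap.range (polyH1 δ) := by
    rw [Submodule.span_le]
    rintro _ ⟨n, rfl⟩
    rw [basisH1_apply, evec]
    exact Submodule.smul_mem _ _ (Submodule.smul_mem _ _ ⟨_, rfl⟩)
  have h3 := Submodule.topologicalClosure_mono h2
  rw [h, top_le_iff] at h3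
  rw [DenseRange, ← LinearMap.coe_range, ← Submodule.dense_iff_topologicalClosure_eq_top] at *
  exact h3

/-- The constant in the Sobolev inequality. -/
def sobolevConst (δ : ℕ) : ℝ := Real.pi / 2 * (8 * δ + 9) ^ 2

theorem lintegral_rootWeight_polyH1_le (p : Polynomial ℝ) :
    ∫⁻ x in I, ENNReal.ofReal ((rootWeight δ x * value (polyH1 δ p) x ^ 2) ^ 2) ≤
      ENNReal.ofReal (sobolevConst δ * ‖polyH1 δ p‖ ^ 4) := by
  have hae := (restrict_absolutelyContinuous_mu δ).ae_le (value_polyH1_ae δ p)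
  calc ∫⁻ x in I, ENNReal.ofReal ((rootWeight δ x * value (polyH1 δ p) x ^ 2) ^ 2)
      ≤ ∫⁻ _ in I, ENNReal.ofReal (((8 * δ + 9) * ‖polyH1 δ p‖ ^ 2) ^ 2) := by
        refine lintegral_mono_ae ?_
        filter_upwards [hae, ae_restrict_mem measurableSet_Ioo] with x hx hxI
        rw [hx]
        refine ENNReal.ofReal_le_ofReal (pow_le_pow_left₀ ?_
          (rootWeight_mul_sq_le one_le_delta (contDiff_polyFun p) hxI) 2)
        have := rootWeight_pos (δ := δ) hxI
        positivity
    _ = ENNReal.ofReal (sobolevConst δ * ‖polyH1 δ p‖ ^ 4) := by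
        rw [lintegral_const, Measure.restrict_apply_univ, Real.volume_Ioo,
          ← ENNReal.ofReal_mul (by positivity), sobolevConst]
        congr 1
        ring

/-- Approximation by polynomials in `H¹` and Fatou's lemma along a subsequence that converges almost
everywhere. -/
theorem lintegral_rootWeight_le (u : H1 δ) :
    ∫⁻ x in I, ENNReal.ofReal ((rootWeight δ x * value u x ^ 2) ^ 2) ≤
      ENNReal.ofReal (sobolevConst δ * ‖u‖ ^ 4) := by
  have hu : u ∈ closure (range (polyH1 δ)) := denseRange_polyH1 u
  obtain ⟨y, hy, hlim⟩ := mem_closure_iff_seq_limit.1 hu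
  choose p hp using hy
  have hval : Tendsto (fun k => value (y k)) atTop (𝓝 (value u)) :=
    ((valueL δ).continuous.tendsto u).comp hlim
  obtain ⟨ns, hns, hae⟩ := (tendstoInMeasure_of_tendsto_Lp hval).exists_seq_tendsto_ae
  have hae' := (restrict_absolutelyContinuous_mu δ).ae_le hae
  have hmeas : ∀ k, AEMeasurable
      (fun x => ENNReal.ofReal ((rootWeight δ x * value (y (ns k)) x ^ 2) ^ 2))
      (volume.restrict I) := fun k =>
    ((((continuous_rootWeight δ).aestronglyMeasurable).mul
      ((L2.aestronglyMeasurable_restrict (value (y (ns k)))).pow 2)).pow 2).aemeasurable.ennreal_ofReal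
  calc ∫⁻ x in I, ENNReal.ofReal ((rootWeight δ x * value u x ^ 2) ^ 2)
      = ∫⁻ x in I, liminf (fun k =>
          ENNReal.ofReal ((rootWeight δ x * value (y (ns k)) x ^ 2) ^ 2)) atTop := by
        refine lintegral_congr_ae ?_
        filter_upwards [hae'] with x hx
        refine (Tendsto.liminf_eq ?_).symm
        exact ENNReal.tendsto_ofReal (((hx.pow 2).const_mul _).pow 2)
    _ ≤ liminf (fun k => ∫⁻ x in I,
          ENNReal.ofReal ((rootWeight δ x * value (y (ns k)) x ^ 2) ^ 2)) atTop :=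
        lintegral_liminf_le' hmeas
    _ ≤ liminf (fun k => ENNReal.ofReal (sobolevConst δ * ‖y (ns k)‖ ^ 4)) atTop := by
        refine liminf_le_liminf (Eventually.of_forall fun k => ?_)
        rw [← hp]
        exact lintegral_rootWeight_polyH1_le _
    _ = ENNReal.ofReal (sobolevConst δ * ‖u‖ ^ 4) := by
        refine Tendsto.liminf_eq ?_
        exact ENNReal.tendsto_ofReal
          ((((hlim.comp hns.tendsto_atTop).norm).pow 4).const_mul _)

/-! ### The quartic form as a square of a bilinear map -/

/-- `L²((0, π/2); dx)`. -/
abbrev L2flat : Type := Lp ℝ 2 (volume.restrict I)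

theorem memLp_rootWeight_mul (u v : H1 δ) :
    MemLp (fun x => rootWeight δ x * (value u x * value v x)) 2 (volume.restrict I) := by
  have hm : ∀ u : H1 δ, AEStronglyMeasurable (value u) (volume.restrict I) :=
    fun u => L2.aestronglyMeasurable_restrict _
  have hrw := (continuous_rootWeight δ).aestronglyMeasurable (μ := volume.restrict I)
  have hsq : ∀ u : H1 δ, MemLp (fun x => rootWeight δ x * value u x ^ 2) 2 (volume.restrict I) :=
    fun u => by
      have hmeas : AEStronglyMeasurable (fun x => rootWeight δ x * value u x ^ 2)
        (volume.restrict I) := hrw.mul ((hm u).pow 2)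
      rw [memLp_two_iff_integrable_sq hmeas]
      refine ⟨hmeas.pow 2, ?_⟩
      rw [hasFiniteIntegral_iff_ofReal (ae_of_all _ fun x => by positivity)]
      exact (lintegral_rootWeight_le u).trans_lt ENNReal.ofReal_lt_top
  refine ((hsq u).add (hsq v)).mono (hrw.mul ((hm u).mul (hm v))) ?_
  filter_upwards [ae_restrict_mem measurableSet_Ioo] with x hx
  have h := rootWeight_pos (δ := δ) hx
  have hpos : 0 ≤ value u x ^ 2 + value v x ^ 2 := by positivity
  simp only [Pi.add_apply]
  rw [← mul_add, norm_mul (rootWeight δ x), norm_mul (rootWeight δ x)]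
  refine mul_le_mul_of_nonneg_left ?_ (norm_nonneg (rootWeight δ x))
  rw [Real.norm_eq_abs, Real.norm_eq_abs, abs_of_nonneg hpos, abs_le]
  constructor <;> nlinarith [sq_nonneg (value u x + value v x), sq_nonneg (value u x - value v x),
    sq_nonneg (value u x), sq_nonneg (value v x)]

/-- The product `√(w W) u v`. -/
def mulFlat (u v : H1 δ) : L2flat := (memLp_rootWeight_mul u v).toLp _

theorem mulFlat_ae (u v : H1 δ) : mulFlat u v =ᵐ[volume.restrict I]
    fun x => rootWeight δ x * (value u x * value v x) := MemLp.coeFn_toLp _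

theorem inner_mulFlat (u v u' v' : H1 δ) :
    ⟪mulFlat u v, mulFlat u' v'⟫_ℝ =
      ∫ x, nonlinWeight δ x * (value u x * value v x * (value u' x * value v' x)) ∂mu δ := by
  rw [MeasureTheory.L2.inner_def, integral_mu]
  refine integral_congr_ae ?_
  filter_upwards [mulFlat_ae u v, mulFlat_ae u' v'] with x h1 h2
  rw [h1, h2, RCLike.inner_apply, conj_trivial]
  linear_combination (value u x * value v x * (value u' x * value v' x)) * rootWeight_sq δ x

theorem norm_mulFlat_self_le (u : H1 δ) :
    ‖mulFlat u u‖ ^ 2 ≤ sobolevConst δ * ‖u‖ ^ 4 := by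
  have hS : 0 ≤ sobolevConst δ := by unfold sobolevConst; positivity
  have e : ‖mulFlat u u‖ ^ 2 = ∫ x in I, (rootWeight δ x * value u x ^ 2) ^ 2 := by
    rw [← real_inner_self_eq_norm_sq, MeasureTheory.L2.inner_def]
    refine integral_congr_ae ?_
    filter_upwards [mulFlat_ae u u] with x h1
    rw [h1, RCLike.inner_apply, conj_trivial]
    ring
  rw [e, integral_eq_lintegral_of_nonneg_ae (ae_of_all _ fun x => by positivity)]
  · exact ENNReal.toReal_le_of_le_ofReal (by positivity) (lintegral_rootWeight_le u)
  · exact ((continuous_rootWeight δ).aestronglyMeasurable.mul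
      ((L2.aestronglyMeasurable_restrict (value u)).pow 2)).pow 2

/-- Since `(uv)² = u² v²`, the Cauchy–Schwarz inequality reduces the mixed product to the diagonal
case. -/
theorem norm_mulFlat_le (u v : H1 δ) :
    ‖mulFlat u v‖ ≤ Real.sqrt (sobolevConst δ) * ‖u‖ * ‖v‖ := by
  have hS : 0 ≤ sobolevConst δ := by unfold sobolevConst; positivity
  have h1 : ‖mulFlat u v‖ ^ 2 = ⟪mulFlat u u, mulFlat v v⟫_ℝ := by
    rw [← real_inner_self_eq_norm_sq, inner_mulFlat, inner_mulFlat]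
    congr 1; funext x; ring
  have hs := Real.sq_sqrt hS
  have h2 : ∀ u : H1 δ, ‖mulFlat u u‖ ≤ Real.sqrt (sobolevConst δ) * ‖u‖ ^ 2 := fun u => by
    refine le_of_sq_le_sq ?_ (by positivity)
    calc _ ≤ _ := norm_mulFlat_self_le u
      _ = _ := by rw [mul_pow, hs]; ring
  refine le_of_sq_le_sq ?_ (by positivity)
  rw [h1]
  calc _ ≤ ‖mulFlat u u‖ * ‖mulFlat v v‖ := real_inner_le_norm _ _
    _ ≤ (Real.sqrt (sobolevConst δ) * ‖u‖ ^ 2) * (Real.sqrt (sobolevConst δ) * ‖v‖ ^ 2) :=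
      mul_le_mul (h2 u) (h2 v) (norm_nonneg _) (by positivity)
    _ = _ := by ring
end

end KG

/-! ### The averaged functional as the squared norm of a bounded bilinear map, and its derivatives
along curves -/

namespace KG

noncomputable section

variable {δ : ℕ} [Fact (2 ≤ δ)]

theorem mulFlat_comm (u v : H1 δ) : mulFlat u v = mulFlat v u := by
  refine Lp.ext ?_
  filter_upwards [mulFlat_ae u v, mulFlat_ae v u] with x h1 h2
  rw [h1, h2]; ring

theorem mulFlat_add_left (u u' v : H1 δ) : mulFlat (u + u') v = mulFlat u v + mulFlat u' v := by
  refine Lp.ext ?_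
  have h := restrict_absolutelyContinuous_mu δ
  filter_upwards [mulFlat_ae (u + u') v, mulFlat_ae u v, mulFlat_ae u' v,
    Lp.coeFn_add (mulFlat u v) (mulFlat u' v),
    h.ae_le (Lp.coeFn_add (value u) (value u'))] with x h1 h2 h3 h4 h5
  rw [h4, Pi.add_apply, h1, h2, h3, value_add, h5, Pi.add_apply]; ring

theorem mulFlat_smul_left (c : ℝ) (u v : H1 δ) : mulFlat (c • u) v = c • mulFlat u v := by
  refine Lp.ext ?_
  have h := restrict_absolutelyContinuous_mu δ
  filter_upwards [mulFlat_ae (c • u) v, mulFlat_ae u v, Lp.coeFn_smul c (mulFlat u v),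
    h.ae_le (Lp.coeFn_smul c (value u))] with x h1 h2 h4 h5
  rw [h4, Pi.smul_apply, h1, h2, value_smul, h5, Pi.smul_apply, smul_eq_mul, smul_eq_mul]; ring

/-- `mulFlat` as a bounded bilinear map. -/
def mulFlatL (δ : ℕ) [Fact (2 ≤ δ)] : H1 δ →L[ℝ] H1 δ →L[ℝ] L2flat :=
  LinearMap.mkContinuous₂ (LinearMap.mk₂ ℝ mulFlat mulFlat_add_left mulFlat_smul_left
    (fun u v w => by rw [mulFlat_comm, mulFlat_add_left, mulFlat_comm v, mulFlat_comm w])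
    (fun c u v => by rw [mulFlat_comm, mulFlat_smul_left, mulFlat_comm v]))
    (Real.sqrt (sobolevConst δ)) norm_mulFlat_le

/-! ### The energy form -/

theorem Phase.norm_sq_eq {δ : ℕ} (ζ : Phase δ) : ‖ζ‖ ^ 2 = ‖ζ.fst‖ ^ 2 + ‖ζ.snd‖ ^ 2 :=
  WithLp.prod_norm_sq_eq_of_L2 ζ

theorem form_self {δ : ℕ} (u : H1 δ) :
    form u u = ‖weakDer u‖ ^ 2 + (δ : ℝ) ^ 2 * ‖value u‖ ^ 2 := by
  rw [form, real_inner_self_eq_norm_sq, real_inner_self_eq_norm_sq]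

/-- With the reverse bound this makes the energy equivalent to the squared norm, so the conserved
energy bounds the flow uniformly in time. -/
theorem norm_sq_le_harmonicEnergy (ζ : Phase δ) : ‖ζ‖ ^ 2 ≤ harmonicEnergy ζ := by
  have h := two_le_delta_real (δ := δ)
  have h2 : (1 : ℝ) ≤ (δ : ℝ) ^ 2 := by nlinarith
  rw [harmonicEnergy, form_self, Phase.norm_sq_eq, H1.norm_sq_eq]
  linarith [mul_le_mul_of_nonneg_right h2 (sq_nonneg ‖value ζ.fst‖)]

theorem harmonicEnergy_le (ζ : Phase δ) : harmonicEnergy ζ ≤ (δ : ℝ) ^ 2 * ‖ζ‖ ^ 2 := by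
  have h := two_le_delta_real (δ := δ)
  have h2 : (1 : ℝ) ≤ (δ : ℝ) ^ 2 := by nlinarith
  rw [harmonicEnergy, form_self, Phase.norm_sq_eq, H1.norm_sq_eq]
  nlinarith [mul_le_mul_of_nonneg_right h2 (sq_nonneg ‖weakDer ζ.fst‖),
    mul_le_mul_of_nonneg_right h2 (sq_nonneg ‖ζ.snd‖)]

theorem norm_linearFlow_fst_le (t : ℝ) (ζ : Phase δ) : ‖(linearFlow t ζ).fst‖ ≤ δ * ‖ζ‖ := by
  refine le_of_sq_le_sq ?_ (by positivity)
  calc ‖(linearFlow t ζ).fst‖ ^ 2 ≤ ‖linearFlow t ζ‖ ^ 2 := by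
        rw [Phase.norm_sq_eq]; nlinarith [sq_nonneg ‖(linearFlow t ζ).snd‖]
    _ ≤ harmonicEnergy ζ := by
        rw [← harmonicEnergy_linearFlow t]; exact norm_sq_le_harmonicEnergy _
    _ ≤ _ := by rw [mul_pow]; exact harmonicEnergy_le ζ

theorem continuous_linearFlow_fst (ζ : Phase δ) : Continuous fun t => (linearFlow t ζ).fst :=
  ((WithLp.prod_continuous_ofLp 2 _ _).fst).comp (continuous_linearFlow ζ)

/-! ### Products along the flow -/

/-- The product of the positions of two orbits, as a function of time. -/
def orbitProd (ζ η : Phase δ) : BoundedContinuousFunction ℝ L2flat :=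
  BoundedContinuousFunction.ofNormedAddCommGroup
    (fun t => mulFlat (linearFlow t ζ).fst (linearFlow t η).fst)
    (((mulFlatL δ).continuous.comp (continuous_linearFlow_fst ζ)).clm_apply
      (continuous_linearFlow_fst η))
    (Real.sqrt (sobolevConst δ) * (δ * ‖ζ‖) * (δ * ‖η‖)) fun t =>
      (norm_mulFlat_le _ _).trans (by
        have h1 := norm_linearFlow_fst_le t ζ
        have h2 := norm_linearFlow_fst_le t η
        gcongr)

theorem orbitProd_apply (ζ η : Phase δ) (t : ℝ) :
    orbitProd ζ η t = mulFlat (linearFlow t ζ).fst (linearFlow t η).fst := rfl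

theorem norm_orbitProd_le (ζ η : Phase δ) :
    ‖orbitProd ζ η‖ ≤ Real.sqrt (sobolevConst δ) * (δ * ‖ζ‖) * (δ * ‖η‖) :=
  BoundedContinuousFunction.norm_ofNormedAddCommGroup_le _ (by positivity) _

theorem orbitProd_comm (ζ η : Phase δ) : orbitProd ζ η = orbitProd η ζ := by
  ext1 t
  rw [orbitProd_apply, orbitProd_apply, mulFlat_comm]

theorem orbitProd_add_left (ζ ζ' η : Phase δ) :
    orbitProd (ζ + ζ') η = orbitProd ζ η + orbitProd ζ' η := by
  ext1 t
  rw [BoundedContinuousFunction.add_apply, orbitProd_apply, orbitProd_apply, orbitProd_apply,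
    linearFlow_add, ← mulFlat_add_left]
  rfl

theorem orbitProd_smul_left (c : ℝ) (ζ η : Phase δ) :
    orbitProd (c • ζ) η = c • orbitProd ζ η := by
  ext1 t
  rw [BoundedContinuousFunction.smul_apply, orbitProd_apply, orbitProd_apply,
    linearFlow_smul, ← mulFlat_smul_left]
  rfl

/-- The time interval of one period. -/
abbrev periodMeasure : Measure ℝ := volume.restrict (Ioc 0 (2 * Real.pi))

/-- Square integrable functions of time over one period with values in `L²(dx)`. -/
abbrev TimeL2 : Type := Lp L2flat 2 periodMeasure

/-- The product of the positions of two orbits over one period, as a bounded bilinear map. -/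
def orbitMul (δ : ℕ) [Fact (2 ≤ δ)] : Phase δ →L[ℝ] Phase δ →L[ℝ] TimeL2 :=
  LinearMap.mkContinuous₂ (LinearMap.mk₂ ℝ
    (fun ζ η => BoundedContinuousFunction.toLp 2 periodMeasure ℝ (orbitProd ζ η))
    (fun ζ ζ' η => by rw [orbitProd_add_left, map_add])
    (fun c ζ η => by rw [orbitProd_smul_left, map_smul])
    (fun ζ η η' => by
      rw [orbitProd_comm, orbitProd_add_left, map_add, orbitProd_comm η, orbitProd_comm η'])
    (fun c ζ η => by rw [orbitProd_comm, orbitProd_smul_left, map_smul, orbitProd_comm η]))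
    (‖(BoundedContinuousFunction.toLp 2 periodMeasure ℝ :
      BoundedContinuousFunction ℝ L2flat →L[ℝ] TimeL2)‖ *
      (Real.sqrt (sobolevConst δ) * δ * δ)) fun ζ η => by
      refine ((BoundedContinuousFunction.toLp 2 periodMeasure ℝ :
        BoundedContinuousFunction ℝ L2flat →L[ℝ] TimeL2).le_opNorm (orbitProd ζ η)).trans ?_
      rw [mul_assoc, mul_assoc]
      refine mul_le_mul_of_nonneg_left ?_ (norm_nonneg _)
      refine (norm_orbitProd_le ζ η).trans (le_of_eq ?_)
      ring

theorem orbitMul_comm (ζ η : Phase δ) : orbitMul δ ζ η = orbitMul δ η ζ := by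
  change BoundedContinuousFunction.toLp 2 periodMeasure ℝ (orbitProd ζ η) =
    BoundedContinuousFunction.toLp 2 periodMeasure ℝ (orbitProd η ζ)
  rw [orbitProd_comm]

theorem inner_orbitMul (ζ η ζ' η' : Phase δ) :
    ⟪orbitMul δ ζ η, orbitMul δ ζ' η'⟫_ℝ = ∫ t in (0 : ℝ)..(2 * Real.pi),
      ∫ x, nonlinWeight δ x *
        (value (linearFlow t ζ).fst x * value (linearFlow t η).fst x *
          (value (linearFlow t ζ').fst x * value (linearFlow t η').fst x)) ∂mu δ := by
  rw [MeasureTheory.L2.inner_def, intervalIntegral.integral_of_le (by positivity)]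
  refine integral_congr_ae ?_
  have h : ∀ ζ η : Phase δ, orbitMul δ ζ η =ᵐ[periodMeasure] orbitProd ζ η := fun ζ η =>
    BoundedContinuousFunction.coeFn_toLp (p := 2) periodMeasure ℝ (orbitProd ζ η)
  filter_upwards [h ζ η, h ζ' η'] with t h1 h2
  rw [h1, h2, orbitProd_apply, orbitProd_apply, inner_mulFlat]

/-- The integrand is a product of four factors, so the quartic form is totally symmetric. This
symmetry produces the factor `3` in second derivatives and the factor `6` in the expansion of
`averaged`. -/
theorem inner_orbitMul_comm (ζ η ζ' η' : Phase δ) :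
    ⟪orbitMul δ ζ η, orbitMul δ ζ' η'⟫_ℝ = ⟪orbitMul δ ζ ζ', orbitMul δ η η'⟫_ℝ := by
  rw [inner_orbitMul, inner_orbitMul]
  congr 1; funext t; congr 1; funext x; ring

theorem averaged_eq (ζ : Phase δ) :
    averaged ζ = 1 / (8 * Real.pi) * ‖orbitMul δ ζ ζ‖ ^ 2 := by
  rw [averaged, ← real_inner_self_eq_norm_sq, inner_orbitMul]
  simp only [quartic]
  rw [intervalIntegral.integral_const_mul, ← mul_assoc]
  congr 1
  · field_simp; norm_num
  · congr 1; funext t; congr 1; funext x; ring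

/-- The position of a phase space point as an element of `L²(dμ)`. -/
def posL (δ : ℕ) : Phase δ →L[ℝ] L2 δ := (valueL δ).comp (WithLp.fstL 2 ℝ (H1 δ) (L2 δ))

/-- The derivative of the position of a phase space point. -/
def derL (δ : ℕ) : Phase δ →L[ℝ] L2 δ := (weakDerL δ).comp (WithLp.fstL 2 ℝ (H1 δ) (L2 δ))

/-- The momentum of a phase space point. -/
def momL (δ : ℕ) : Phase δ →L[ℝ] L2 δ := WithLp.sndL 2 ℝ (H1 δ) (L2 δ)

/-- The bilinear form of the harmonic energy. -/
def energyForm (δ : ℕ) : Phase δ →L[ℝ] Phase δ →L[ℝ] ℝ :=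
  (innerSL ℝ).bilinearComp (derL δ) (derL δ) +
    (δ : ℝ) ^ 2 • (innerSL ℝ).bilinearComp (posL δ) (posL δ) +
    (innerSL ℝ).bilinearComp (momL δ) (momL δ)

theorem energyForm_apply {δ : ℕ} (ζ η : Phase δ) :
    energyForm δ ζ η = form ζ.fst η.fst + ⟪ζ.snd, η.snd⟫_ℝ := rfl

theorem energyForm_self {δ : ℕ} (ζ : Phase δ) : energyForm δ ζ ζ = harmonicEnergy ζ := by
  rw [energyForm_apply, real_inner_self_eq_norm_sq, harmonicEnergy]

theorem energyForm_comm {δ : ℕ} (ζ η : Phase δ) : energyForm δ ζ η = energyForm δ η ζ := by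
  rw [energyForm_apply, energyForm_apply, form, form, real_inner_comm, real_inner_comm (value _),
    real_inner_comm ζ.snd]

/-! ### Derivatives along curves -/

section Curves

variable {E F : Type*} [NormedAddCommGroup E] [NormedSpace ℝ E] [NormedAddCommGroup F]
  [NormedSpace ℝ F]

theorem hasDerivAt_bilinear (q : E →L[ℝ] E →L[ℝ] F) {γ η : ℝ → E} {γ' η' : E} {s : ℝ}
    (hγ : HasDerivAt γ γ' s) (hη : HasDerivAt η η' s) :
    HasDerivAt (fun s => q (γ s) (η s)) (q γ' (η s) + q (γ s) η') s :=
  (q.hasFDerivAt.comp_hasDerivAt s hγ).clm_apply hη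

end Curves

theorem hasDerivAt_averaged_comp {γ : ℝ → Phase δ} {γ' : Phase δ} {s : ℝ}
    (hγ : HasDerivAt γ γ' s) :
    HasDerivAt (averaged ∘ γ)
      (1 / (2 * Real.pi) * ⟪orbitMul δ (γ s) (γ s), orbitMul δ (γ s) γ'⟫_ℝ) s := by
  have h1 := hasDerivAt_bilinear (orbitMul δ) hγ hγ
  have h2 := (h1.inner ℝ h1).const_mul (1 / (8 * Real.pi))
  have e : averaged ∘ γ = fun s => 1 / (8 * Real.pi) *
      ⟪orbitMul δ (γ s) (γ s), orbitMul δ (γ s) (γ s)⟫_ℝ := by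
    funext s
    rw [Function.comp, averaged_eq, real_inner_self_eq_norm_sq]
  rw [e]
  refine HasDerivAt.congr_deriv h2 ?_
  rw [orbitMul_comm γ', real_inner_comm (orbitMul δ (γ s) (γ s)), inner_add_right]
  field_simp
  ring

/-- Differentiating the first entry gives two copies of the quadratic term, by total symmetry, and
the second entry gives a third. -/
theorem hasDerivAt_averaged_comp_deriv {γ γ₁ : ℝ → Phase δ} {γ₂ : Phase δ} {s : ℝ}
    (hγ : HasDerivAt γ (γ₁ s) s) (hγ₁ : HasDerivAt γ₁ γ₂ s) :
    HasDerivAt (fun s => 1 / (2 * Real.pi) *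
      ⟪orbitMul δ (γ s) (γ s), orbitMul δ (γ s) (γ₁ s)⟫_ℝ)
      (1 / (2 * Real.pi) * (3 * ⟪orbitMul δ (γ s) (γ s), orbitMul δ (γ₁ s) (γ₁ s)⟫_ℝ) +
        1 / (2 * Real.pi) * ⟪orbitMul δ (γ s) (γ s), orbitMul δ (γ s) γ₂⟫_ℝ) s := by
  have h1 := hasDerivAt_bilinear (orbitMul δ) hγ hγ
  have h2 := hasDerivAt_bilinear (orbitMul δ) hγ hγ₁
  refine HasDerivAt.congr_deriv ((h1.inner ℝ h2).const_mul (1 / (2 * Real.pi))) ?_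
  rw [orbitMul_comm (γ₁ s) (γ s), inner_add_left, inner_add_right,
    inner_orbitMul_comm (γ s) (γ₁ s) (γ s) (γ₁ s)]
  ring

end

end KG

/-! ### Resonances: time averages of trigonometric products, and products of pure modes -/

namespace KG

noncomputable section

/-! ### Time averages of trigonometric products -/

theorem integral_cos_int_mul {k : ℤ} (hk : k ≠ 0) :
    ∫ t in (0 : ℝ)..(2 * Real.pi), Real.cos (k * t) = 0 := by
  have hk' : (k : ℝ) ≠ 0 := by exact_mod_cast hk
  rw [intervalIntegral.integral_comp_mul_left (fun x => Real.cos x) hk', integral_cos]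
  rw [show (k : ℝ) * (2 * Real.pi) = (2 * k : ℤ) * Real.pi by push_cast; ring, Real.sin_int_mul_pi]
  simp

/-- This removes the products with exactly one sine, which are odd under `t ↦ 2π - t`. -/
theorem integral_eq_zero_of_reflect {f : ℝ → ℝ} (hf : ∀ t, f (2 * Real.pi - t) = -f t) :
    ∫ t in (0 : ℝ)..(2 * Real.pi), f t = 0 := by
  have h := intervalIntegral.integral_comp_sub_left (a := 0) (b := 2 * Real.pi) f (2 * Real.pi)
  rw [sub_zero, sub_self, funext hf, intervalIntegral.integral_neg] at h
  linarith

theorem cos_nat_mul_reflect (n : ℕ) (t : ℝ) :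
    Real.cos (n * (2 * Real.pi - t)) = Real.cos (n * t) := by
  rw [mul_sub, Real.cos_nat_mul_two_pi_sub]

theorem sin_nat_mul_reflect (n : ℕ) (t : ℝ) :
    Real.sin (n * (2 * Real.pi - t)) = -Real.sin (n * t) := by
  rw [mul_sub, Real.sin_nat_mul_two_pi_sub]

theorem integral_const_mul_cos (a : ℝ) (k : ℤ) :
    ∫ t in (0 : ℝ)..(2 * Real.pi), a * Real.cos (k * t) =
      2 * Real.pi * if k = 0 then a else 0 := by
  rw [intervalIntegral.integral_const_mul]
  split_ifs with h
  · simp [h]; ring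
  · rw [integral_cos_int_mul h]; ring

/-- The products that occur linearise to at most six cosines of integer frequency, of which only
those of frequency zero survive. The indicators turn resonance into linear arithmetic over `ℤ`. -/
theorem integral_six_cos (a₁ a₂ a₃ a₄ a₅ a₆ : ℝ) (k₁ k₂ k₃ k₄ k₅ k₆ : ℤ) :
    ∫ t in (0 : ℝ)..(2 * Real.pi), (a₁ * Real.cos (k₁ * t) + a₂ * Real.cos (k₂ * t) +
      a₃ * Real.cos (k₃ * t) + a₄ * Real.cos (k₄ * t) + a₅ * Real.cos (k₅ * t) +
      a₆ * Real.cos (k₆ * t)) =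
      2 * Real.pi * ((if k₁ = 0 then a₁ else 0) + (if k₂ = 0 then a₂ else 0) +
        (if k₃ = 0 then a₃ else 0) + (if k₄ = 0 then a₄ else 0) + (if k₅ = 0 then a₅ else 0) +
        (if k₆ = 0 then a₆ else 0)) := by
  rw [intervalIntegral.integral_add, intervalIntegral.integral_add, intervalIntegral.integral_add,
    intervalIntegral.integral_add, intervalIntegral.integral_add]
  · simp only [integral_const_mul_cos]
    ring
  all_goals exact Continuous.intervalIntegrable (by fun_prop) _ _

/-- Four frequencies occur; the two remaining slots of `integral_six_cos` are filled with frequency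
`1` and coefficient `0`. -/
theorem integral_cos_cube_mul_cos (d p : ℕ) :
    ∫ t in (0 : ℝ)..(2 * Real.pi), Real.cos (d * t) ^ 3 * Real.cos (p * t) =
      2 * Real.pi * ((if (d - p : ℤ) = 0 then (3 / 8 : ℝ) else 0) +
        (if (d + p : ℤ) = 0 then (3 / 8 : ℝ) else 0) +
        (if (3 * d - p : ℤ) = 0 then (1 / 8 : ℝ) else 0) +
        (if (3 * d + p : ℤ) = 0 then (1 / 8 : ℝ) else 0) +
        (if (1 : ℤ) = 0 then (0 : ℝ) else 0) +
        (if (1 : ℤ) = 0 then (0 : ℝ) else 0)) := by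
  rw [← integral_six_cos]
  congr 1; funext t
  push_cast
  have h3 := Real.cos_three_mul (d * t)
  have e1 : ((d : ℝ) - p) * t = d * t - p * t := by ring
  have e2 : ((d : ℝ) + p) * t = d * t + p * t := by ring
  have e3 : (3 * (d : ℝ) - p) * t = 3 * (d * t) - p * t := by ring
  have e4 : (3 * (d : ℝ) + p) * t = 3 * (d * t) + p * t := by ring
  rw [e1, e2, e3, e4, Real.cos_sub, Real.cos_add, Real.cos_sub, Real.cos_add, h3]
  ring

theorem integral_cos_sq_mul_cos_mul_cos (d p q : ℕ) :
    ∫ t in (0 : ℝ)..(2 * Real.pi), Real.cos (d * t) ^ 2 * (Real.cos (p * t) * Real.cos (q * t)) =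
      2 * Real.pi * ((if (p - q : ℤ) = 0 then (1 / 4 : ℝ) else 0) +
        (if (p + q : ℤ) = 0 then (1 / 4 : ℝ) else 0) +
        (if (2 * d + (p - q) : ℤ) = 0 then (1 / 8 : ℝ) else 0) +
        (if (2 * d - (p - q) : ℤ) = 0 then (1 / 8 : ℝ) else 0) +
        (if (2 * d + (p + q) : ℤ) = 0 then (1 / 8 : ℝ) else 0) +
        (if (2 * d - (p + q) : ℤ) = 0 then (1 / 8 : ℝ) else 0)) := by
  rw [← integral_six_cos]
  congr 1; funext t
  push_cast
  have h3 := Real.cos_two_mul (d * t)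
  have e1 : ((p : ℝ) - q) * t = p * t - q * t := by ring
  have e2 : ((p : ℝ) + q) * t = p * t + q * t := by ring
  have e3 : (2 * (d : ℝ) + (p - q)) * t = 2 * (d * t) + (p * t - q * t) := by ring
  have e4 : (2 * (d : ℝ) - (p - q)) * t = 2 * (d * t) - (p * t - q * t) := by ring
  have e5 : (2 * (d : ℝ) + (p + q)) * t = 2 * (d * t) + (p * t + q * t) := by ring
  have e6 : (2 * (d : ℝ) - (p + q)) * t = 2 * (d * t) - (p * t + q * t) := by ring
  rw [e1, e2, e3, e4, e5, e6, Real.cos_add (2 * (d * t)), Real.cos_sub (2 * (d * t)),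
    Real.cos_add (2 * (d * t)), Real.cos_sub (2 * (d * t)), Real.cos_add, Real.cos_sub, h3]
  ring

theorem integral_cos_sq_mul_sin_mul_sin (d p q : ℕ) :
    ∫ t in (0 : ℝ)..(2 * Real.pi), Real.cos (d * t) ^ 2 * (Real.sin (p * t) * Real.sin (q * t)) =
      2 * Real.pi * ((if (p - q : ℤ) = 0 then (1 / 4 : ℝ) else 0) +
        (if (p + q : ℤ) = 0 then (-1 / 4 : ℝ) else 0) +
        (if (2 * d + (p - q) : ℤ) = 0 then (1 / 8 : ℝ) else 0) +
        (if (2 * d - (p - q) : ℤ) = 0 then (1 / 8 : ℝ) else 0) +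
        (if (2 * d + (p + q) : ℤ) = 0 then (-1 / 8 : ℝ) else 0) +
        (if (2 * d - (p + q) : ℤ) = 0 then (-1 / 8 : ℝ) else 0)) := by
  rw [← integral_six_cos]
  congr 1; funext t
  push_cast
  have h3 := Real.cos_two_mul (d * t)
  have e1 : ((p : ℝ) - q) * t = p * t - q * t := by ring
  have e2 : ((p : ℝ) + q) * t = p * t + q * t := by ring
  have e3 : (2 * (d : ℝ) + (p - q)) * t = 2 * (d * t) + (p * t - q * t) := by ring
  have e4 : (2 * (d : ℝ) - (p - q)) * t = 2 * (d * t) - (p * t - q * t) := by ring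
  have e5 : (2 * (d : ℝ) + (p + q)) * t = 2 * (d * t) + (p * t + q * t) := by ring
  have e6 : (2 * (d : ℝ) - (p + q)) * t = 2 * (d * t) - (p * t + q * t) := by ring
  rw [e1, e2, e3, e4, e5, e6, Real.cos_add (2 * (d * t)), Real.cos_sub (2 * (d * t)),
    Real.cos_add (2 * (d * t)), Real.cos_sub (2 * (d * t)), Real.cos_add, Real.cos_sub, h3]
  ring

theorem omega_eq_cast (δ n : ℕ) : omega δ n = ((δ + 2 * n : ℕ) : ℝ) := by
  rw [omega]; push_cast; ring

theorem integral_cos_cube_mul_posAt (δ n : ℕ) (a b : ℝ) :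
    ∫ t in (0 : ℝ)..(2 * Real.pi), Real.cos (δ * t) ^ 3 * posAt (omega δ n) a b t =
      a * ∫ t in (0 : ℝ)..(2 * Real.pi),
        Real.cos (δ * t) ^ 3 * Real.cos ((δ + 2 * n : ℕ) * t) := by
  have h0 : ∫ t in (0 : ℝ)..(2 * Real.pi),
      Real.cos (δ * t) ^ 3 * Real.sin ((δ + 2 * n : ℕ) * t) = 0 :=
    integral_eq_zero_of_reflect fun t => by
      rw [cos_nat_mul_reflect, sin_nat_mul_reflect]; ring
  have e : ∀ t, Real.cos (δ * t) ^ 3 * posAt (omega δ n) a b t =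
      a * (Real.cos (δ * t) ^ 3 * Real.cos ((δ + 2 * n : ℕ) * t)) +
      b / omega δ n * (Real.cos (δ * t) ^ 3 * Real.sin ((δ + 2 * n : ℕ) * t)) := fun t => by
    rw [posAt, omega_eq_cast]; ring
  simp only [e]
  rw [intervalIntegral.integral_add, intervalIntegral.integral_const_mul,
    intervalIntegral.integral_const_mul, h0]
  · ring
  all_goals exact Continuous.intervalIntegrable (by fun_prop) _ _

theorem integral_cos_cube_mul_posAt_zero {δ : ℕ} (hδ : 1 ≤ δ) (a b : ℝ) :
    ∫ t in (0 : ℝ)..(2 * Real.pi), Real.cos (δ * t) ^ 3 * posAt (omega δ 0) a b t =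
      3 / 4 * Real.pi * a := by
  rw [integral_cos_cube_mul_posAt, integral_cos_cube_mul_cos]
  rw [if_pos (by push_cast; ring), if_neg (by push_cast; omega), if_neg (by push_cast; omega),
    if_neg (by push_cast; omega)]
  simp
  ring

theorem integral_cos_sq_mul_posAt_mul_posAt (δ n m : ℕ) (a b c d : ℝ) :
    ∫ t in (0 : ℝ)..(2 * Real.pi), Real.cos (δ * t) ^ 2 *
      (posAt (omega δ n) a b t * posAt (omega δ m) c d t) =
      a * c * (∫ t in (0 : ℝ)..(2 * Real.pi), Real.cos (δ * t) ^ 2 *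
        (Real.cos ((δ + 2 * n : ℕ) * t) * Real.cos ((δ + 2 * m : ℕ) * t))) +
      b / omega δ n * (d / omega δ m) * (∫ t in (0 : ℝ)..(2 * Real.pi), Real.cos (δ * t) ^ 2 *
        (Real.sin ((δ + 2 * n : ℕ) * t) * Real.sin ((δ + 2 * m : ℕ) * t))) := by
  have h0 : ∀ n m : ℕ, ∫ t in (0 : ℝ)..(2 * Real.pi),
      Real.cos (δ * t) ^ 2 * (Real.sin ((δ + 2 * n : ℕ) * t) * Real.cos ((δ + 2 * m : ℕ) * t)) = 0 :=
    fun n m => integral_eq_zero_of_reflect fun t => by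
      rw [cos_nat_mul_reflect, sin_nat_mul_reflect, cos_nat_mul_reflect]; ring
  have e : ∀ t, Real.cos (δ * t) ^ 2 * (posAt (omega δ n) a b t * posAt (omega δ m) c d t) =
      a * c * (Real.cos (δ * t) ^ 2 *
        (Real.cos ((δ + 2 * n : ℕ) * t) * Real.cos ((δ + 2 * m : ℕ) * t))) +
      b / omega δ n * (d / omega δ m) * (Real.cos (δ * t) ^ 2 *
        (Real.sin ((δ + 2 * n : ℕ) * t) * Real.sin ((δ + 2 * m : ℕ) * t))) +
      b / omega δ n * c * (Real.cos (δ * t) ^ 2 *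
        (Real.sin ((δ + 2 * n : ℕ) * t) * Real.cos ((δ + 2 * m : ℕ) * t))) +
      a * (d / omega δ m) * (Real.cos (δ * t) ^ 2 *
        (Real.sin ((δ + 2 * m : ℕ) * t) * Real.cos ((δ + 2 * n : ℕ) * t))) := fun t => by
    rw [posAt, posAt, omega_eq_cast, omega_eq_cast]; ring
  simp only [e]
  rw [intervalIntegral.integral_add, intervalIntegral.integral_add, intervalIntegral.integral_add,
    intervalIntegral.integral_const_mul, intervalIntegral.integral_const_mul,
    intervalIntegral.integral_const_mul, intervalIntegral.integral_const_mul, h0, h0]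
  · ring
  all_goals exact Continuous.intervalIntegrable (by fun_prop) _ _

/-- Only the frequency `ω_n - ω_n` vanishes. The mode `n = 0` is excluded because there `2 ω_n = 2δ`
is resonant as well. -/
theorem integral_cos_sq_mul_posAt_sq {δ n : ℕ} (hδ : 1 ≤ δ) (h0 : n ≠ 0) (a b : ℝ) :
    ∫ t in (0 : ℝ)..(2 * Real.pi), Real.cos (δ * t) ^ 2 *
      (posAt (omega δ n) a b t * posAt (omega δ n) a b t) =
      Real.pi / 2 * (a ^ 2 + b ^ 2 / omega δ n ^ 2) := by
  rw [integral_cos_sq_mul_posAt_mul_posAt, integral_cos_sq_mul_cos_mul_cos,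
    integral_cos_sq_mul_sin_mul_sin]
  rw [if_pos (by push_cast; ring), if_neg (by push_cast; omega), if_neg (by push_cast; omega),
    if_neg (by push_cast; omega), if_neg (by push_cast; omega), if_neg (by push_cast; omega),
    if_neg (by push_cast; omega), if_neg (by push_cast; omega), if_neg (by push_cast; omega)]
  ring

/-- Resonance would require `ω_n = ω_m`, `|ω_n - ω_m| = 2δ`, or `ω_n + ω_m = 2δ`; the last forces `n
= m = 0`. -/
theorem integral_cos_sq_mul_posAt_mul_posAt_of_ne {δ n m : ℕ} (hδ : 1 ≤ δ) (h0 : n ≠ m)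
    (h1 : n ≠ m + δ) (h2 : m ≠ n + δ) (a b c d : ℝ) :
    ∫ t in (0 : ℝ)..(2 * Real.pi), Real.cos (δ * t) ^ 2 *
      (posAt (omega δ n) a b t * posAt (omega δ m) c d t) = 0 := by
  rw [integral_cos_sq_mul_posAt_mul_posAt, integral_cos_sq_mul_cos_mul_cos,
    integral_cos_sq_mul_sin_mul_sin]
  rw [if_neg (by push_cast; omega), if_neg (by push_cast; omega), if_neg (by push_cast; omega),
    if_neg (by push_cast; omega), if_neg (by push_cast; omega), if_neg (by push_cast; omega),
    if_neg (by push_cast; omega), if_neg (by push_cast; omega), if_neg (by push_cast; omega)]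
  ring

variable {δ : ℕ} [Fact (2 ≤ δ)]

/-! ### Pure modes -/

/-- The phase space point `(a e_n, b e_n)`. -/
def modeVec (δ n : ℕ) (a b : ℝ) : Phase δ :=
  WithLp.toLp 2 (a • evec δ n, b • value (evec δ n))

theorem posCoeff_modeVec (n m : ℕ) (a b : ℝ) :
    posCoeff m (modeVec δ n a b) = if n = m then a else 0 := by
  rw [posCoeff, modeVec]
  change ⟪value (a • evec δ n), value (evec δ m)⟫_ℝ = _
  rw [value_smul, real_inner_smul_left, inner_value_evec]
  split_ifs <;> simp

theorem momCoeff_modeVec (n m : ℕ) (a b : ℝ) :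
    momCoeff m (modeVec δ n a b) = if n = m then b else 0 := by
  rw [momCoeff, modeVec]
  change ⟪b • value (evec δ n), value (evec δ m)⟫_ℝ = _
  rw [real_inner_smul_left, inner_value_evec]
  split_ifs <;> simp

theorem linearFlow_modeVec (n : ℕ) (a b t : ℝ) :
    linearFlow t (modeVec δ n a b) =
      modeVec δ n (posAt (omega δ n) a b t) (momAt (omega δ n) a b t) := by
  refine Phase.ext_coeff (fun m => ?_) fun m => ?_
  · rw [posCoeff_linearFlow, posCoeff_modeVec, momCoeff_modeVec, posCoeff_modeVec]
    split_ifs with h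
    · rw [h]
    · simp [posAt]
  · rw [momCoeff_linearFlow, posCoeff_modeVec, momCoeff_modeVec, momCoeff_modeVec]
    split_ifs with h
    · rw [h]
    · simp [momAt]

theorem harmonicEnergy_modeVec (n : ℕ) (a b : ℝ) :
    harmonicEnergy (modeVec δ n a b) = omega δ n ^ 2 * a ^ 2 + b ^ 2 := by
  refine (hasSum_harmonicEnergy (modeVec δ n a b)).unique ?_
  have h := hasSum_ite_eq n (omega δ n ^ 2 * a ^ 2 + b ^ 2)
  refine h.congr_fun fun m => ?_
  rw [posCoeff_modeVec, momCoeff_modeVec]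
  by_cases hnm : m = n
  · subst hnm; simp
  · rw [if_neg (Ne.symm hnm), if_neg (Ne.symm hnm), if_neg hnm]; simp

theorem hasSum_modeVec (ζ : Phase δ) :
    HasSum (fun n => modeVec δ n (posCoeff n ζ) (momCoeff n ζ)) ζ := by
  have h1 : HasSum (fun n => posCoeff n ζ • evec δ n) ζ.fst := by
    refine ((basisH1 δ).hasSum_repr ζ.fst).congr_fun fun n => ?_
    rw [HilbertBasis.repr_apply_apply, real_inner_comm, inner_basisH1, basisH1_apply, smul_smul,
      posCoeff]
    congr 1
    have := (evecNorm_pos (δ := δ) n).ne'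
    field_simp
  have h2 : HasSum (fun n => momCoeff n ζ • value (evec δ n)) ζ.snd := by
    refine ((basisL2 δ).hasSum_repr ζ.snd).congr_fun fun n => ?_
    rw [HilbertBasis.repr_apply_apply, real_inner_comm, basisL2_apply, momCoeff]
  exact (h1.prodMk h2).mapL
    ((WithLp.prodContinuousLinearEquiv 2 ℝ (H1 δ) (L2 δ)).symm : (H1 δ × L2 δ) →L[ℝ] Phase δ)

/-- The coefficients `∫ W e₀² e_n e_m dμ`. -/
def quadCoeff (δ n m : ℕ) [Fact (2 ≤ δ)] : ℝ :=
  ⟪mulFlat (evec δ 0) (evec δ 0), mulFlat (evec δ n) (evec δ m)⟫_ℝ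

theorem inner_orbitMul_eq (ζ η ζ' η' : Phase δ) :
    ⟪orbitMul δ ζ η, orbitMul δ ζ' η'⟫_ℝ = ∫ t in (0 : ℝ)..(2 * Real.pi),
      ⟪mulFlat (linearFlow t ζ).fst (linearFlow t η).fst,
        mulFlat (linearFlow t ζ').fst (linearFlow t η').fst⟫_ℝ := by
  simp only [inner_orbitMul, inner_mulFlat]

theorem mulFlat_smul_smul (a b : ℝ) (u v : H1 δ) :
    mulFlat (a • u) (b • v) = (a * b) • mulFlat u v := by
  rw [mulFlat_smul_left, mulFlat_comm, mulFlat_smul_left, mulFlat_comm, smul_smul]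

theorem linearFlow_modeVec_fst (n : ℕ) (a b t : ℝ) :
    (linearFlow t (modeVec δ n a b)).fst = posAt (omega δ n) a b t • evec δ n := by
  rw [linearFlow_modeVec]; rfl

theorem inner_orbitMul_modeVec (r : ℝ) (n m : ℕ) (a b c d : ℝ) :
    ⟪orbitMul δ (modeVec δ 0 r 0) (modeVec δ 0 r 0),
      orbitMul δ (modeVec δ n a b) (modeVec δ m c d)⟫_ℝ =
      r ^ 2 * quadCoeff δ n m * ∫ t in (0 : ℝ)..(2 * Real.pi), Real.cos (δ * t) ^ 2 *
        (posAt (omega δ n) a b t * posAt (omega δ m) c d t) := by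
  rw [inner_orbitMul_eq, ← intervalIntegral.integral_const_mul]
  congr 1; funext t
  rw [linearFlow_modeVec_fst, linearFlow_modeVec_fst, linearFlow_modeVec_fst, mulFlat_smul_smul,
    mulFlat_smul_smul, real_inner_smul_left, real_inner_smul_right, quadCoeff]
  simp only [posAt, zero_div, zero_mul, add_zero, omega_eq_cast, Nat.mul_zero]
  ring

end

end KG

/-! ### Moments, normalisation of `e₀`, and the estimates of the coefficients `∫ W e₀² e_n² dμ` -/

namespace KG

noncomputable section

/-! ### Moments -/

theorem eigPoly_zero (δ : ℕ) : eigPoly δ 0 = 1 := by simp [eigPoly, eigCoeff]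

theorem moment_one_pos (δ : ℕ) : 0 < moment δ 1 := by
  have := moment_eigPoly_sq_pos δ 0
  rwa [eigPoly_zero, mul_one] at this

/-- By symmetry of the operator and `lap δ 1 = 0`, the integral of `lap δ (X ^ (k + 1))` is zero,
which links two consecutive moments. -/
theorem moment_X_pow_succ {δ : ℕ} (hδ : 1 ≤ δ) (k : ℕ) :
    moment δ (Polynomial.X ^ (k + 1)) =
      (2 * k + 2 * δ - 1) / (2 * k + 2 * δ + 2) * moment δ (Polynomial.X ^ k) := by
  have h := moment_lap_mul hδ (Polynomial.X ^ (k + 1)) 1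
  have h1 : lap δ 1 = 0 := by simp [lap]
  rw [h1, mul_one, mul_zero, map_zero, lap_X_pow, map_sub, ← Polynomial.smul_eq_C_mul,
    ← Polynomial.smul_eq_C_mul, map_smul, map_smul, smul_eq_mul, smul_eq_mul,
    Nat.add_sub_cancel] at h
  push_cast at h
  have hk : ((k : ℝ) + 1) ≠ 0 := by positivity
  have h2 : (2 * (k : ℝ) + 2 * δ + 2) ≠ 0 := by positivity
  rw [div_mul_eq_mul_div, eq_div_iff h2]
  refine mul_left_cancel₀ hk ?_
  linear_combination h / 2

/-- The moments of `dμ` in the variable `cos²`, normalised by the total mass. -/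
def momentRatio (δ : ℕ) : ℕ → ℚ
  | 0 => 1
  | k + 1 => (2 * k + 2 * δ - 1) / (2 * k + 2 * δ + 2) * momentRatio δ k

theorem moment_X_pow {δ : ℕ} (hδ : 1 ≤ δ) (k : ℕ) :
    moment δ (Polynomial.X ^ k) = momentRatio δ k * moment δ 1 := by
  induction k with
  | zero => simp [momentRatio]
  | succ k ih =>
    rw [moment_X_pow_succ hδ, ih, momentRatio]
    push_cast
    ring

theorem momentRatio_pos {δ : ℕ} (hδ : 1 ≤ δ) (k : ℕ) : 0 < momentRatio δ k := by
  induction k with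
  | zero => simp [momentRatio]
  | succ k ih =>
    rw [momentRatio]
    have h1 : (1 : ℚ) ≤ δ := by exact_mod_cast hδ
    have h2 : (0 : ℚ) < 2 * k + 2 * δ - 1 := by
      have : (0 : ℚ) ≤ k := by positivity
      linarith
    positivity

/-- The normalised integral of `y^s P_n²`. -/
def quadRatio (δ n s : ℕ) : ℚ :=
  ∑ i ∈ Finset.range (n + 1), ∑ j ∈ Finset.range (n + 1),
    eigCoeff δ n i * eigCoeff δ n j * momentRatio δ (i + j + s)

theorem moment_X_pow_mul_eigPoly_sq {δ : ℕ} (hδ : 1 ≤ δ) (n s : ℕ) :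
    moment δ (Polynomial.X ^ s * (eigPoly δ n * eigPoly δ n)) = quadRatio δ n s * moment δ 1 := by
  rw [eigPoly, Finset.sum_mul_sum, Finset.mul_sum, map_sum, quadRatio, Rat.cast_sum,
    Finset.sum_mul]
  refine Finset.sum_congr rfl fun i _ => ?_
  rw [Finset.mul_sum, map_sum, Rat.cast_sum, Finset.sum_mul]
  refine Finset.sum_congr rfl fun j _ => ?_
  have e : Polynomial.X ^ s * (Polynomial.C (eigCoeff δ n i : ℝ) * Polynomial.X ^ i *
      (Polynomial.C (eigCoeff δ n j : ℝ) * Polynomial.X ^ j)) =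
      ((eigCoeff δ n i : ℝ) * eigCoeff δ n j) • Polynomial.X ^ (i + j + s) := by
    rw [Polynomial.smul_eq_C_mul, Polynomial.C_mul]; ring
  rw [e, map_smul, moment_X_pow hδ, smul_eq_mul]
  push_cast
  ring

theorem quadRatio_zero_pos {δ : ℕ} (hδ : 1 ≤ δ) (n : ℕ) : 0 < quadRatio δ n 0 := by
  have h := moment_X_pow_mul_eigPoly_sq hδ n 0
  rw [pow_zero, one_mul] at h
  have h1 := moment_eigPoly_sq_pos δ n
  rw [h] at h1
  exact_mod_cast pos_of_mul_pos_left h1 (moment_one_pos δ).le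

/-! ### The constant eigenfunction -/

theorem moment_succ (δ : ℕ) (hδ : 1 ≤ δ) (p : Polynomial ℝ) :
    moment (δ + 1) p = moment δ (Polynomial.X * p) := by
  change ∫ x, polyFun p x ∂mu (δ + 1) = ∫ x, polyFun (Polynomial.X * p) x ∂mu δ
  rw [integral_mu, integral_mu]
  congr 1; funext x
  simp only [weight, polyFun, Polynomial.eval_mul, Polynomial.eval_X]
  rw [show 2 * (δ + 1) - 2 = 2 * δ - 2 + 2 by omega]
  ring

theorem moment_one_one : moment 1 1 = Real.pi / 4 := by
  change ∫ x, polyFun 1 x ∂mu 1 = _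
  rw [integral_mu, integral_I_eq]
  simp only [weight, polyFun, Polynomial.eval_one, mul_one]
  simp [integral_sin_sq]
  ring

/-- Raising `δ` by one multiplies the weight by `y`, so the first moment gives the induction step.
-/
theorem moment_one_eq {δ : ℕ} (hδ : 1 ≤ δ) :
    moment δ 1 = Real.sqrt Real.pi / 4 * (Real.Gamma (δ - 1 / 2) / (δ * Real.Gamma δ)) := by
  induction δ, hδ using Nat.le_induction with
  | base =>
    rw [moment_one_one]
    have h := Real.Gamma_one_half_eq
    rw [Nat.cast_one, show (1 : ℝ) - 1 / 2 = 1 / 2 by norm_num, h, Real.Gamma_one]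
    have := Real.mul_self_sqrt Real.pi_pos.le
    linarith
  | succ δ hδ ih =>
    have h1 : (1 : ℝ) ≤ δ := by exact_mod_cast hδ
    have h := moment_X_pow_succ hδ 0
    rw [zero_add, pow_one, pow_zero, ih] at h
    rw [moment_succ δ hδ, mul_one, h]
    have h2 : Real.Gamma ((δ + 1 : ℕ) - 1 / 2) = ((δ : ℝ) - 1 / 2) * Real.Gamma (δ - 1 / 2) := by
      rw [← Real.Gamma_add_one (by linarith)]
      congr 1; push_cast; ring
    have h3 : Real.Gamma ((δ + 1 : ℕ) : ℝ) = δ * Real.Gamma δ := by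
      rw [Nat.cast_add, Nat.cast_one, Real.Gamma_add_one (by linarith)]
    have h4 : Real.Gamma δ ≠ 0 := (Real.Gamma_pos_of_pos (by linarith)).ne'
    rw [h2, h3]
    push_cast
    field_simp
    ring

theorem e0_eq {δ : ℕ} (hδ : 1 ≤ δ) : e0 δ = (Real.sqrt (moment δ 1))⁻¹ := by
  have h1 : (1 : ℝ) ≤ δ := by exact_mod_cast hδ
  have hpi := Real.pi_pos
  have hG : 0 < Real.Gamma δ := Real.Gamma_pos_of_pos (by linarith)
  have hG2 : 0 < Real.Gamma (δ - 1 / 2) := Real.Gamma_pos_of_pos (by linarith)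
  have hq : (Real.pi ^ (1 / 4 : ℝ)) ^ 2 = Real.sqrt Real.pi := by
    rw [← Real.rpow_natCast, ← Real.rpow_mul hpi.le, Real.sqrt_eq_rpow]
    norm_num
  have hq0 : 0 < Real.pi ^ (1 / 4 : ℝ) := Real.rpow_pos_of_pos hpi _
  rw [← Real.sqrt_inv, eq_comm, Real.sqrt_eq_iff_mul_self_eq
    (inv_nonneg.2 (moment_one_pos δ).le) (by unfold e0; positivity), ← sq, e0, mul_pow, div_pow, hq,
    Real.sq_sqrt (by positivity), moment_one_eq hδ]
  have hs : 0 < Real.sqrt Real.pi := Real.sqrt_pos.2 hpi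
  field_simp
  norm_num

theorem evec_zero_eq {δ : ℕ} (hδ : 1 ≤ δ) (c : ℝ) : c • evec δ 0 = constH1 δ (c * e0 δ) := by
  refine H1.ext_value (Lp.ext ?_)
  have h1 : value (constH1 δ (c * e0 δ)) =ᵐ[mu δ] fun _ => c * e0 δ :=
    MemLp.coeFn_toLp (memLp_const (μ := mu δ) (p := 2) (c * e0 δ))
  rw [evec, smul_smul, value_smul]
  filter_upwards [h1, value_polyH1_ae δ (eigPoly δ 0),
    Lp.coeFn_smul (c * (Real.sqrt (moment δ (eigPoly δ 0 * eigPoly δ 0)))⁻¹)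
      (value (polyH1 δ (eigPoly δ 0)))] with x h2 h3 h4
  rw [h2, h4, Pi.smul_apply, h3, eigPoly_zero, mul_one, ← e0_eq hδ]
  simp [polyFun]

variable {δ : ℕ} [Fact (2 ≤ δ)]

theorem mode_eq (κ : ℝ) : mode δ κ = modeVec δ 0 κ 0 := by
  rw [mode, modeVec, evec_zero_eq one_le_delta, zero_smul]

/-! ### The coefficients of the quadratic form -/

theorem inner_mulFlat_polyH1 (a b c d : Polynomial ℝ) :
    ⟪mulFlat (polyH1 δ a) (polyH1 δ b), mulFlat (polyH1 δ c) (polyH1 δ d)⟫_ℝ =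
      moment δ (Polynomial.X ^ (δ - 1) * (a * b * (c * d))) := by
  rw [inner_mulFlat]
  refine integral_congr_ae ?_
  filter_upwards [value_polyH1_ae δ a, value_polyH1_ae δ b, value_polyH1_ae δ c,
    value_polyH1_ae δ d] with x ha hb hc hd
  rw [ha, hb, hc, hd]
  simp only [polyFun, nonlinWeight, Polynomial.eval_mul, Polynomial.eval_pow, Polynomial.eval_X]
  rw [← pow_mul, show 2 * (δ - 1) = 2 * δ - 2 by omega]

theorem quadCoeff_eq (n m : ℕ) :
    quadCoeff δ n m = (moment δ 1)⁻¹ *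
      ((Real.sqrt (moment δ (eigPoly δ n * eigPoly δ n)))⁻¹ *
        (Real.sqrt (moment δ (eigPoly δ m * eigPoly δ m)))⁻¹ *
        moment δ (Polynomial.X ^ (δ - 1) * (eigPoly δ n * eigPoly δ m))) := by
  rw [quadCoeff, evec, evec, evec, mulFlat_smul_smul, mulFlat_smul_smul, real_inner_smul_left,
    real_inner_smul_right, inner_mulFlat_polyH1, eigPoly_zero, mul_one, one_mul,
    ← mul_inv, Real.mul_self_sqrt (moment_one_pos δ).le]

theorem quadCoeff_comm (n m : ℕ) : quadCoeff δ n m = quadCoeff δ m n := by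
  rw [quadCoeff, quadCoeff, mulFlat_comm (evec δ n)]

/-- Since `W = y^(δ-1)`, the factor `W P_n` has degree at most `n + δ - 1 < m` in `y` and is
orthogonal to `P_m`. -/
theorem quadCoeff_eq_zero {n m : ℕ} (h : n + δ ≤ m) : quadCoeff δ n m = 0 := by
  have h1 := natDegree_eigPoly_le δ n
  have h2 := Polynomial.natDegree_X_pow (R := ℝ) (δ - 1)
  have h3 := Polynomial.natDegree_mul_le (p := (Polynomial.X : Polynomial ℝ) ^ (δ - 1))
    (q := eigPoly δ n)
  have h4 := one_le_delta (δ := δ)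
  have h5 : moment δ (Polynomial.X ^ (δ - 1) * (eigPoly δ n * eigPoly δ m)) = 0 := by
    rw [← mul_assoc, mul_comm]
    exact moment_eigPoly_mul one_le_delta (by omega)
  rw [quadCoeff_eq, h5, mul_zero, mul_zero]

theorem quadCoeff_self (n : ℕ) :
    quadCoeff δ n n = (moment δ 1)⁻¹ * (quadRatio δ n (δ - 1) / quadRatio δ n 0) := by
  have h0 := moment_X_pow_mul_eigPoly_sq (one_le_delta (δ := δ)) n 0
  rw [pow_zero, one_mul] at h0
  rw [quadCoeff_eq, ← mul_inv, Real.mul_self_sqrt (moment_eigPoly_sq_pos δ n).le,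
    moment_X_pow_mul_eigPoly_sq one_le_delta, h0]
  have h1 := (moment_one_pos δ).ne'
  have h2 : (quadRatio δ n 0 : ℝ) ≠ 0 := by
    exact_mod_cast (quadRatio_zero_pos (one_le_delta (δ := δ)) n).ne'
  field_simp

theorem quadCoeff_zero_zero :
    quadCoeff δ 0 0 = (moment δ 1)⁻¹ * momentRatio δ (δ - 1) := by
  rw [quadCoeff_self]
  simp [quadRatio, eigCoeff, momentRatio]

theorem quadCoeff_zero_zero_pos : 0 < quadCoeff δ 0 0 := by
  rw [quadCoeff_zero_zero]
  have h1 := moment_one_pos δ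
  have h2 : (0 : ℝ) < momentRatio δ (δ - 1) := by
    exact_mod_cast momentRatio_pos (one_le_delta (δ := δ)) _
  positivity

/-- This uses only `W ≤ 1` and the normalisation of `e_n`; it is enough for high modes, where `ω_n²`
is large. -/
theorem quadCoeff_self_le (n : ℕ) : quadCoeff δ n n ≤ (moment δ 1)⁻¹ := by
  have hpos := moment_eigPoly_sq_pos δ n
  rw [quadCoeff_eq, ← mul_inv, Real.mul_self_sqrt hpos.le]
  refine mul_le_of_le_one_right (inv_nonneg.2 (moment_one_pos δ).le) ?_
  rw [inv_mul_le_iff₀ hpos, mul_one]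
  refine integral_mono (integrable_polyFun δ _) (integrable_polyFun δ _) fun x => ?_
  simp only [polyFun, Polynomial.eval_mul, Polynomial.eval_pow, Polynomial.eval_X]
  refine mul_le_of_le_one_left (mul_self_nonneg _) ?_
  exact pow_le_one₀ (sq_nonneg _) (Real.cos_sq_le_one x)

theorem C0000_eq : C0000 δ = quadCoeff δ 0 0 := by
  have h := inner_mulFlat_polyH1 (δ := δ) 1 1 1 1
  rw [quadCoeff_eq, eigPoly_zero, C0000, e0_eq one_le_delta, integral_mul_const]
  have e : ∫ x, nonlinWeight δ x ∂mu δ = moment δ (Polynomial.X ^ (δ - 1) * (1 * 1)) := by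
    refine integral_congr_ae (ae_of_all _ fun x => ?_)
    simp only [polyFun, nonlinWeight, Polynomial.eval_mul, Polynomial.eval_pow, Polynomial.eval_X,
      Polynomial.eval_one]
    rw [← pow_mul, show 2 * (δ - 1) = 2 * δ - 2 by omega]
    simp
  have h1 := moment_one_pos δ
  have h2 := Real.sq_sqrt h1.le
  have h3 : (Real.sqrt (moment δ 1))⁻¹ ^ 4 = (moment δ 1)⁻¹ ^ 2 := by
    rw [inv_pow, inv_pow, show 4 = 2 * 2 by rfl, pow_mul, h2]
  rw [e, h3, mul_one, ← mul_inv, Real.mul_self_sqrt h1.le]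
  ring

/-- The quotient `2δ² C_n / (ω_n² C_0)` is compared with `98/100` after clearing denominators, in
exact rational arithmetic. For `δ = 9`, `n = 1` it equals `3474/3553 ≈ 0.978`, which leaves little
room. -/
theorem quadRatio_le_of_small :
    ∀ δ ∈ Finset.Icc (2 : ℕ) 9, ∀ n ∈ Finset.Icc (1 : ℕ) 6,
      100 * (2 * (δ : ℚ) ^ 2) * quadRatio δ n (δ - 1) ≤
        98 * ((δ : ℚ) + 2 * n) ^ 2 * momentRatio δ (δ - 1) * quadRatio δ n 0 := by
  decide +kernel

/-- This is the same comparison for all `n ≥ 7` at once, with `ω_n ≥ δ + 14` and the crude bound of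
`quadCoeff_self_le`. -/
theorem momentRatio_ge_of_small :
    ∀ δ ∈ Finset.Icc (2 : ℕ) 9,
      100 * (2 * (δ : ℚ) ^ 2) ≤ 98 * ((δ : ℚ) + 14) ^ 2 * momentRatio δ (δ - 1) := by
  decide +kernel

theorem quadCoeff_le (hδ : δ ≤ 9) {n : ℕ} (hn : 1 ≤ n) :
    100 * (2 * (δ : ℝ) ^ 2) * quadCoeff δ n n ≤ 98 * omega δ n ^ 2 * quadCoeff δ 0 0 := by
  have h2 : 2 ≤ δ := Fact.out
  have hM := inv_pos.2 (moment_one_pos δ)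
  rw [quadCoeff_zero_zero]
  by_cases hn6 : n ≤ 6
  · have h := quadRatio_le_of_small δ (Finset.mem_Icc.2 ⟨h2, hδ⟩) n (Finset.mem_Icc.2 ⟨hn, hn6⟩)
    have hq := quadRatio_zero_pos (one_le_delta (δ := δ)) n
    have h' : 100 * (2 * (δ : ℝ) ^ 2) * quadRatio δ n (δ - 1) ≤
        98 * ((δ : ℝ) + 2 * n) ^ 2 * momentRatio δ (δ - 1) * quadRatio δ n 0 := by
      exact_mod_cast h
    have hq' : (0 : ℝ) < quadRatio δ n 0 := by exact_mod_cast hq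
    rw [quadCoeff_self, omega]
    have h3 : 100 * (2 * (δ : ℝ) ^ 2) * (quadRatio δ n (δ - 1) / quadRatio δ n 0) ≤
        98 * ((δ : ℝ) + 2 * n) ^ 2 * momentRatio δ (δ - 1) := by
      rw [← mul_div_assoc, div_le_iff₀ hq']
      exact h'
    have := mul_le_mul_of_nonneg_left h3 hM.le
    linarith
  · have h := momentRatio_ge_of_small δ (Finset.mem_Icc.2 ⟨h2, hδ⟩)
    have h' : 100 * (2 * (δ : ℝ) ^ 2) ≤ 98 * ((δ : ℝ) + 14) ^ 2 * momentRatio δ (δ - 1) := by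
      exact_mod_cast h
    have hm : (0 : ℝ) < momentRatio δ (δ - 1) := by
      exact_mod_cast momentRatio_pos (one_le_delta (δ := δ)) _
    have hn7 : (7 : ℝ) ≤ n := by exact_mod_cast (by omega : 7 ≤ n)
    have h3 : ((δ : ℝ) + 14) ^ 2 ≤ omega δ n ^ 2 := by
      rw [omega]
      exact pow_le_pow_left₀ (by positivity) (by linarith) 2
    calc 100 * (2 * (δ : ℝ) ^ 2) * quadCoeff δ n n
        ≤ 100 * (2 * (δ : ℝ) ^ 2) * (moment δ 1)⁻¹ :=
          mul_le_mul_of_nonneg_left (quadCoeff_self_le n) (by positivity)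
      _ ≤ 98 * ((δ : ℝ) + 14) ^ 2 * momentRatio δ (δ - 1) * (moment δ 1)⁻¹ := by gcongr
      _ ≤ 98 * omega δ n ^ 2 * momentRatio δ (δ - 1) * (moment δ 1)⁻¹ := by gcongr
      _ = _ := by ring

/-- With `m = δ - 1`, the quotient `2δ² C_1 / (ω_1² C_0)` is `(m+1)(5m²+8m+2) /
((2m+1)(2m+3)(m+3))`. It is at least `1` exactly when `(m - 9)(m + 1)² + 2 ≥ 0`, which places the
threshold at `δ = 10`. -/
theorem le_quadCoeff_one (hδ : 10 ≤ δ) :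
    omega δ 1 ^ 2 * quadCoeff δ 0 0 ≤ 2 * (δ : ℝ) ^ 2 * quadCoeff δ 1 1 := by
  have hM := inv_pos.2 (moment_one_pos δ)
  have hd : (10 : ℚ) ≤ δ := by exact_mod_cast hδ
  obtain ⟨m, rfl⟩ : ∃ m, δ = m + 1 := ⟨δ - 1, by omega⟩
  have hq := quadRatio_zero_pos (one_le_delta (δ := m + 1)) 1
  have hmr := momentRatio_pos (one_le_delta (δ := m + 1)) m
  have key : (((m + 1 : ℕ) : ℚ) + 2) ^ 2 * momentRatio (m + 1) m * quadRatio (m + 1) 1 0 ≤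
      2 * ((m + 1 : ℕ) : ℚ) ^ 2 * quadRatio (m + 1) 1 m := by
    -- Here `P_1 = 1 - 2(m+2)/(2m+1) y`, and the moments of order `s + 1` and `s + 2` are reduced to
    -- the one of order `s`.
    have e : ∀ s, quadRatio (m + 1) 1 s = momentRatio (m + 1) s *
        (1 - 4 * ((m : ℚ) + 2) / (2 * m + 1) * ((2 * s + 2 * m + 1) / (2 * s + 2 * m + 4)) +
        (2 * ((m : ℚ) + 2) / (2 * m + 1)) ^ 2 * ((2 * s + 2 * m + 1) / (2 * s + 2 * m + 4)) *
          ((2 * s + 2 * m + 3) / (2 * s + 2 * m + 6))) := fun s => by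
      simp only [quadRatio, Finset.sum_range_succ, Finset.sum_range_zero, eigCoeff, zero_add,
        add_zero]
      rw [show 1 + 1 + s = s + 1 + 1 by ring, show 1 + s = s + 1 by ring]
      simp only [momentRatio]
      push_cast
      have h1 : (2 * (m : ℚ) + 1) ≠ 0 := by positivity
      have h2 : (2 * (s : ℚ) + 2 * m + 4) ≠ 0 := by positivity
      have h3 : (2 * (s : ℚ) + 2 * m + 6) ≠ 0 := by positivity
      rw [show 2 * (s : ℚ) + 2 * (m + 1) - 1 = 2 * s + 2 * m + 1 by ring,
        show 2 * (s : ℚ) + 2 * (m + 1) + 2 = 2 * s + 2 * m + 4 by ring,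
        show 2 * ((s : ℚ) + 1) + 2 * (m + 1) - 1 = 2 * s + 2 * m + 3 by ring,
        show 2 * ((s : ℚ) + 1) + 2 * (m + 1) + 2 = 2 * s + 2 * m + 6 by ring,
        show 2 * (0 : ℚ) + 2 * (m + 1) - 1 = 2 * m + 1 by ring]
      field_simp
      ring
    have h1 : (2 * (m : ℚ) + 1) ≠ 0 := by positivity
    have e0 : quadRatio (m + 1) 1 0 = 3 / ((m + 3) * (2 * m + 1)) := by
      rw [e, momentRatio, Nat.cast_zero]
      have h2 : (2 * (0 : ℚ) + 2 * m + 4) ≠ 0 := by positivity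
      have h3 : (2 * (0 : ℚ) + 2 * m + 6) ≠ 0 := by positivity
      have h4 : ((m : ℚ) + 3) ≠ 0 := by positivity
      field_simp
      ring
    have em : quadRatio (m + 1) 1 m = momentRatio (m + 1) m *
        (3 * (5 * m ^ 2 + 8 * m + 2) / ((2 * m + 1) ^ 2 * (2 * (m + 1) * (2 * m + 3)))) := by
      rw [e]
      congr 1
      have h2 : (2 * (m : ℚ) + 2 * m + 4) ≠ 0 := by positivity
      have h3 : (2 * (m : ℚ) + 2 * m + 6) ≠ 0 := by positivity
      have h4 : ((m : ℚ) + 1) ≠ 0 := by positivity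
      have h5 : (2 * (m : ℚ) + 3) ≠ 0 := by positivity
      field_simp
      ring
    rw [e0, em, ← sub_nonneg]
    push_cast at hd ⊢
    have h4 : ((m : ℚ) + 1) ≠ 0 := by positivity
    have h5 : (2 * (m : ℚ) + 3) ≠ 0 := by positivity
    have h6 : ((m : ℚ) + 3) ≠ 0 := by positivity
    have h7 : 2 * ((m : ℚ) + 1) ^ 2 * (momentRatio (m + 1) m *
        (3 * (5 * m ^ 2 + 8 * m + 2) / ((2 * m + 1) ^ 2 * (2 * (m + 1) * (2 * m + 3))))) -
        ((m : ℚ) + 1 + 2) ^ 2 * momentRatio (m + 1) m * (3 / ((m + 3) * (2 * m + 1))) =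
        momentRatio (m + 1) m * (3 * ((m - 9) * (m + 1) ^ 2 + 2) /
          ((2 * m + 1) ^ 2 * (2 * m + 3))) := by
      field_simp
      ring
    rw [h7]
    have h8 : (0 : ℚ) ≤ m - 9 := by linarith
    positivity
  have key' : (((m + 1 : ℕ) : ℝ) + 2) ^ 2 * momentRatio (m + 1) m * quadRatio (m + 1) 1 0 ≤
      2 * ((m + 1 : ℕ) : ℝ) ^ 2 * quadRatio (m + 1) 1 m := by
    exact_mod_cast key
  have hq' : (0 : ℝ) < quadRatio (m + 1) 1 0 := by exact_mod_cast hq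
  rw [quadCoeff_zero_zero, quadCoeff_self, omega, Nat.add_sub_cancel]
  have h3 : (((m + 1 : ℕ) : ℝ) + 2) ^ 2 * momentRatio (m + 1) m ≤
      2 * ((m + 1 : ℕ) : ℝ) ^ 2 * (quadRatio (m + 1) 1 m / quadRatio (m + 1) 1 0) := by
    rw [← mul_div_assoc, le_div_iff₀ hq']
    exact key'
  have := mul_le_mul_of_nonneg_left h3 hM.le
  push_cast at this ⊢
  rw [show (2 : ℝ) * 1 = 2 by norm_num]
  linarith

end

end KG

/-! ### Diagonalisation of the Hessian, the Lagrange multiplier, and the tangent spaces -/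

namespace KG

noncomputable section

variable {δ : ℕ} [Fact (2 ≤ δ)]

/-! ### The quadratic form of the averaged functional at a single mode -/

/-- The bilinear form `(X, Y) ↦ ∫∫ W Φᵗ(ζ)₁² Φᵗ(X)₁ Φᵗ(Y)₁ dμ dt`. -/
def hessForm (ζ : Phase δ) : Phase δ →L[ℝ] Phase δ →L[ℝ] ℝ :=
  (ContinuousLinearMap.compL ℝ (Phase δ) TimeL2 ℝ (innerSL ℝ (orbitMul δ ζ ζ))).comp (orbitMul δ)

theorem hessForm_apply (ζ X Y : Phase δ) :
    hessForm ζ X Y = ⟪orbitMul δ ζ ζ, orbitMul δ X Y⟫_ℝ := rfl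

/-- Two mechanisms complement each other: the time average vanishes unless the mode numbers differ
by `δ`, and in that case the spatial coefficient vanishes by degree. -/
theorem hessForm_modeVec_of_ne (r : ℝ) {n m : ℕ} (h : n ≠ m) (a b c d : ℝ) :
    hessForm (modeVec δ 0 r 0) (modeVec δ n a b) (modeVec δ m c d) = 0 := by
  rw [hessForm_apply, inner_orbitMul_modeVec]
  by_cases h1 : n = m + δ
  · rw [quadCoeff_comm, quadCoeff_eq_zero h1.ge]; simp
  by_cases h2 : m = n + δ
  · rw [quadCoeff_eq_zero h2.ge]; simp
  rw [integral_cos_sq_mul_posAt_mul_posAt_of_ne one_le_delta h h1 h2, mul_zero]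

theorem hessForm_modeVec_left (r : ℝ) (n : ℕ) (a b : ℝ) (Z : Phase δ) :
    hessForm (modeVec δ 0 r 0) (modeVec δ n a b) Z =
      r ^ 2 * quadCoeff δ n n * ∫ t in (0 : ℝ)..(2 * Real.pi), Real.cos (δ * t) ^ 2 *
        (posAt (omega δ n) a b t * posAt (omega δ n) (posCoeff n Z) (momCoeff n Z) t) := by
  have h1 := (hasSum_modeVec Z).mapL (hessForm (modeVec δ 0 r 0) (modeVec δ n a b))
  have h2 := hasSum_single n (f := fun m => hessForm (modeVec δ 0 r 0) (modeVec δ n a b)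
    (modeVec δ m (posCoeff m Z) (momCoeff m Z)))
    fun m hm => hessForm_modeVec_of_ne r hm.symm a b _ _
  rw [h1.unique h2, hessForm_apply, inner_orbitMul_modeVec]

theorem hessForm_mode_left (r : ℝ) (Z : Phase δ) :
    hessForm (modeVec δ 0 r 0) (modeVec δ 0 r 0) Z =
      3 / 4 * Real.pi * r ^ 3 * quadCoeff δ 0 0 * posCoeff 0 Z := by
  rw [hessForm_modeVec_left]
  have e : ∀ t, Real.cos (δ * t) ^ 2 * (posAt (omega δ 0) r 0 t *
      posAt (omega δ 0) (posCoeff 0 Z) (momCoeff 0 Z) t) =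
      r * (Real.cos (δ * t) ^ 3 * posAt (omega δ 0) (posCoeff 0 Z) (momCoeff 0 Z) t) := fun t => by
    have : posAt (omega δ 0) r 0 t = r * Real.cos (δ * t) := by
      simp [posAt, omega]
    rw [this]; ring
  simp only [e]
  rw [intervalIntegral.integral_const_mul, integral_cos_cube_mul_posAt_zero one_le_delta]
  ring

theorem hasSum_hessForm_self (r : ℝ) {Y : Phase δ} (ha : posCoeff 0 Y = 0)
    (hb : momCoeff 0 Y = 0) :
    HasSum (fun n => r ^ 2 * quadCoeff δ n n * (Real.pi / 2 *
      (posCoeff n Y ^ 2 + momCoeff n Y ^ 2 / omega δ n ^ 2))) (hessForm (modeVec δ 0 r 0) Y Y) := by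
  refine ((hasSum_modeVec Y).mapL ((hessForm (modeVec δ 0 r 0)).flip Y)).congr_fun fun n => ?_
  rw [ContinuousLinearMap.flip_apply, hessForm_modeVec_left]
  rcases eq_or_ne n 0 with rfl | hn
  · rw [ha, hb]; simp [posAt]
  · rw [integral_cos_sq_mul_posAt_sq one_le_delta hn]

/-- Both sides are diagonal in the modes, so the comparison is termwise and rests on `quadCoeff_le`.
-/
theorem hessForm_self_le (hδ : δ ≤ 9) (r : ℝ) {Y : Phase δ} (ha : posCoeff 0 Y = 0)
    (hb : momCoeff 0 Y = 0) :
    100 * (2 * δ ^ 2) * hessForm (modeVec δ 0 r 0) Y Y ≤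
      98 * quadCoeff δ 0 0 * r ^ 2 * (Real.pi / 2) * harmonicEnergy Y := by
  refine hasSum_le (fun n => ?_) ((hasSum_hessForm_self r ha hb).mul_left _)
    ((hasSum_harmonicEnergy Y).mul_left _)
  rcases Nat.eq_zero_or_pos n with rfl | hn
  · rw [ha, hb]; simp
  · have h1 := quadCoeff_le hδ hn
    have h2 := omega_pos (δ := δ) n
    have h3 : posCoeff n Y ^ 2 + momCoeff n Y ^ 2 / omega δ n ^ 2 =
      (omega δ n ^ 2 * posCoeff n Y ^ 2 + momCoeff n Y ^ 2) / omega δ n ^ 2 := by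
      field_simp
    have h4 : 0 ≤ r ^ 2 * (Real.pi / 2) *
        ((omega δ n ^ 2 * posCoeff n Y ^ 2 + momCoeff n Y ^ 2) / omega δ n ^ 2) := by positivity
    calc _ = 100 * (2 * (δ : ℝ) ^ 2) * quadCoeff δ n n * (r ^ 2 * (Real.pi / 2) *
        ((omega δ n ^ 2 * posCoeff n Y ^ 2 + momCoeff n Y ^ 2) / omega δ n ^ 2)) := by
          rw [h3]; ring
      _ ≤ 98 * omega δ n ^ 2 * quadCoeff δ 0 0 * (r ^ 2 * (Real.pi / 2) *
        ((omega δ n ^ 2 * posCoeff n Y ^ 2 + momCoeff n Y ^ 2) / omega δ n ^ 2)) :=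
          mul_le_mul_of_nonneg_right h1 h4
      _ = _ := by field_simp

/-! ### Energy form against the lowest mode -/

theorem energyForm_modeVec_left (n : ℕ) (a b : ℝ) (Z : Phase δ) :
    energyForm δ (modeVec δ n a b) Z = omega δ n ^ 2 * a * posCoeff n Z + b * momCoeff n Z := by
  rw [energyForm_comm, energyForm_apply]
  have h1 := form_evec Z.fst n
  have h2 : form Z.fst (modeVec δ n a b).fst = a * form Z.fst (evec δ n) := by
    change form Z.fst (a • evec δ n) = _
    rw [form, form, value_smul, weakDer_smul, real_inner_smul_right, real_inner_smul_right]
    ring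
  have h3 : ⟪Z.snd, (modeVec δ n a b).snd⟫_ℝ = b * ⟪Z.snd, value (evec δ n)⟫_ℝ := by
    change ⟪Z.snd, b • value (evec δ n)⟫_ℝ = _
    rw [real_inner_smul_right]
  rw [h2, h3, h1, posCoeff, momCoeff]
  ring

theorem omega_zero {δ : ℕ} : omega δ 0 = δ := by simp [omega]

/-- The differential of `averaged` at the rescaled first mode is a multiple of that of the
harmonic energy. -/
theorem hessForm_mode_eq_energyForm {κ : ℝ}
    (hκ : κ ^ 2 = 8 * (δ : ℝ) ^ 2 / (3 * C0000 δ)) (Z : Phase δ) :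
    1 / (2 * Real.pi) * hessForm (modeVec δ 0 κ 0) (modeVec δ 0 κ 0) Z =
      energyForm δ (modeVec δ 0 κ 0) Z := by
  rw [hessForm_mode_left, energyForm_modeVec_left, omega_zero]
  rw [C0000_eq] at hκ
  have hG := (quadCoeff_zero_zero_pos (δ := δ)).ne'
  -- This relation says precisely that the Lagrange multiplier, relative to `dh_Ω = 2 energyForm`,
  -- is `1/2`.
  have hκ' : 3 * κ ^ 2 * quadCoeff δ 0 0 = 8 * δ ^ 2 := by rw [hκ]; field_simp
  have : κ ^ 3 * quadCoeff δ 0 0 = κ * (8 * δ ^ 2) / 3 := by linear_combination κ / 3 * hκ'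
  have hpi := Real.pi_pos.ne'
  field_simp
  linear_combination 3 * posCoeff 0 Z * this

/-! ### The tangent spaces -/

theorem hasFDerivAt_harmonicEnergy {δ : ℕ} (ζ : Phase δ) :
    HasFDerivAt (harmonicEnergy (δ := δ)) ((2 : ℝ) • energyForm δ ζ) ζ := by
  have h := (energyForm δ).hasFDerivAt_of_bilinear (hasFDerivAt_id ζ) (hasFDerivAt_id ζ)
  have e : (fun y : Phase δ => energyForm δ (id y) (id y)) = harmonicEnergy (δ := δ) :=
    funext fun y => energyForm_self y
  rw [e] at h
  refine h.congr_fderiv ?_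
  ext Z
  simp [ContinuousLinearMap.precompR, ContinuousLinearMap.precompL, energyForm_comm Z ζ, two_mul]

theorem mem_tangentSurface_iff {κ : ℝ} (hκ : κ ≠ 0) (X : Phase δ) :
    X ∈ tangentSurface δ κ ↔ posCoeff 0 X = 0 := by
  have hd : (δ : ℝ) ≠ 0 := by have := two_le_delta_real (δ := δ); positivity
  rw [tangentSurface, mode_eq, (hasFDerivAt_harmonicEnergy _).fderiv, LinearMap.mem_ker]
  change 2 * energyForm δ _ X = 0 ↔ _
  rw [energyForm_modeVec_left, omega_zero]
  simp [hκ, hd]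

theorem tangentOrbit_eq (κ : ℝ) :
    tangentOrbit δ κ = Submodule.span ℝ {modeVec δ 0 0 (-(δ ^ 2 * κ))} := by
  have h1 : HasDerivAt (fun t => posAt (δ : ℝ) κ 0 t • evec δ 0) (0 : H1 δ) 0 := by
    have hd : (δ : ℝ) ≠ 0 := by have := two_le_delta_real (δ := δ); positivity
    refine ((hasDerivAt_posAt hd κ 0 0).smul_const (evec δ 0)).congr_deriv ?_
    simp [momAt]
  have h2 : HasDerivAt (fun t => momAt (δ : ℝ) κ 0 t • value (evec δ 0))
      ((-(δ ^ 2 * κ) : ℝ) • value (evec δ 0)) 0 := by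
    have hd : (δ : ℝ) ≠ 0 := by have := two_le_delta_real (δ := δ); positivity
    refine ((hasDerivAt_momAt hd κ 0 0).smul_const (value (evec δ 0))).congr_deriv ?_
    simp [posAt]
  have h3 := ((WithLp.prodContinuousLinearEquiv 2 ℝ (H1 δ) (L2 δ)).symm :
    (H1 δ × L2 δ) →L[ℝ] Phase δ).hasFDerivAt.comp_hasDerivAt 0 (h1.prodMk h2)
  have h4 : (fun t => linearFlow t (mode δ κ)) =
      ((WithLp.prodContinuousLinearEquiv 2 ℝ (H1 δ) (L2 δ)).symm :
        (H1 δ × L2 δ) →L[ℝ] Phase δ) ∘ fun t =>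
        (posAt (δ : ℝ) κ 0 t • evec δ 0, momAt (δ : ℝ) κ 0 t • value (evec δ 0)) := by
    funext t
    rw [mode_eq, linearFlow_modeVec, omega_zero]; rfl
  rw [tangentOrbit, h4, h3.deriv, modeVec, zero_smul]; rfl

/-- The orbit leaves `ξ` in the pure momentum direction of mode `0`. Together with tangency to the
energy surface, orthogonality removes mode `0` entirely. -/
theorem mem_tangentOrbit_orthogonal_iff {κ : ℝ} (hκ : κ ≠ 0) (X : Phase δ) :
    X ∈ (tangentOrbit δ κ)ᗮ ↔ momCoeff 0 X = 0 := by
  have hd : (δ : ℝ) ≠ 0 := by have := two_le_delta_real (δ := δ); positivity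
  rw [tangentOrbit_eq, Submodule.mem_orthogonal_singleton_iff_inner_left, WithLp.prod_inner_apply]
  change ⟪X.fst, (0 : ℝ) • evec δ 0⟫_ℝ + ⟪X.snd, (-(δ ^ 2 * κ) : ℝ) • value (evec δ 0)⟫_ℝ = 0 ↔ _
  rw [zero_smul, real_inner_smul_right, inner_zero_right, zero_add, momCoeff]
  simp [hκ, hd]

end

end KG

/-! ### The second differential, its definiteness, and local maximality -/

namespace KG

noncomputable section

section Bilinear

variable {E F : Type*} [NormedAddCommGroup E] [NormedSpace ℝ E] [NormedAddCommGroup F]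
  [NormedSpace ℝ F]

/-- The restriction of a bounded bilinear form to a subspace. -/
def restrictForm (b : E →L[ℝ] E →L[ℝ] ℝ) (T : Submodule ℝ E) : T →L[ℝ] T →L[ℝ] ℝ :=
  b.bilinearComp T.subtypeL T.subtypeL

theorem exists_bilinear_bound (q : E →L[ℝ] E →L[ℝ] F) :
    ∃ M : ℝ, 0 ≤ M ∧ ∀ x y, ‖q x y‖ ≤ M * ‖x‖ * ‖y‖ :=
  ⟨‖q‖, ContinuousLinearMap.opNorm_nonneg q, q.le_opNorm₂⟩

end Bilinear

variable {δ : ℕ} [Fact (2 ≤ δ)]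

/-! ### Curves on the energy surface -/

theorem energyForm_deriv_of_mem {δ : ℕ} {κ : ℝ} {γ : ℝ → Phase δ} {γ' : Phase δ} {s : ℝ}
    (hγ : HasDerivAt γ γ' s) (hm : ∀ s, γ s ∈ energySurface δ κ) : energyForm δ (γ s) γ' = 0 := by
  have h1 := hasDerivAt_bilinear (energyForm δ) hγ hγ
  have h2 : (fun s => energyForm δ (γ s) (γ s)) = fun _ => κ ^ 2 * (δ : ℝ) ^ 2 :=
    funext fun s => (energyForm_self _).trans (hm s)
  rw [h2] at h1
  have h3 := h1.unique (hasDerivAt_const s _)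
  rw [energyForm_comm γ'] at h3
  linarith

theorem isCriticalPointOn_mode {κ : ℝ} (hκ : κ ^ 2 = 8 * (δ : ℝ) ^ 2 / (3 * C0000 δ)) :
    IsCriticalPointOn averaged (energySurface δ κ) (mode δ κ) := by
  intro γ hγ hm h0
  have h1 : HasDerivAt γ (deriv γ 0) 0 := (hγ.differentiable (by simp) 0).hasDerivAt
  refine (hasDerivAt_averaged_comp h1).congr_deriv ?_
  have h2 := energyForm_deriv_of_mem h1 hm
  rw [h0, mode_eq] at h2 ⊢
  rw [← hessForm_apply, hessForm_mode_eq_energyForm hκ, h2]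

/-- The second differential of `averaged` restricted to the energy surface at the mode. -/
def secondDiff (δ : ℕ) [Fact (2 ≤ δ)] (κ : ℝ) :
    tangentSurface δ κ →L[ℝ] tangentSurface δ κ →L[ℝ] ℝ :=
  restrictForm ((3 / (2 * Real.pi)) • hessForm (modeVec δ 0 κ 0) - energyForm δ)
    (tangentSurface δ κ)

theorem secondDiff_apply (κ : ℝ) (X Y : tangentSurface δ κ) :
    secondDiff δ κ X Y = 3 / (2 * Real.pi) * hessForm (modeVec δ 0 κ 0) (X : Phase δ) (Y : Phase δ) -
      energyForm δ (X : Phase δ) (Y : Phase δ) := rfl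

/-- The acceleration of the curve enters through `d⟨f⟩(ξ) γ''(0)`, which equals `energyForm ξ
γ''(0)`. Differentiating the constraint `energyForm γ γ' = 0` replaces it by `-energyForm X X`, so
the result depends on `X` alone. -/
theorem isSecondDifferentialOn_mode {κ : ℝ} (hκ : κ ^ 2 = 8 * (δ : ℝ) ^ 2 / (3 * C0000 δ)) :
    IsSecondDifferentialOn averaged (energySurface δ κ) (mode δ κ) (tangentSurface δ κ)
      (secondDiff δ κ) := by
  refine ⟨fun X Y => ?_, fun X γ hγ hm h0 hX => ?_⟩
  · rw [secondDiff_apply, secondDiff_apply, hessForm_apply, hessForm_apply,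
      orbitMul_comm (X : Phase δ), energyForm_comm (X : Phase δ)]
  have h1 : ∀ s, HasDerivAt γ (deriv γ s) s := fun s =>
    (hγ.differentiable (by simp) s).hasDerivAt
  have h2 : HasDerivAt (deriv γ) (deriv (deriv γ) 0) 0 :=
    ((((contDiff_succ_iff_deriv (n := 1)).1 hγ).2.2).differentiable (by simp) 0).hasDerivAt
  refine ⟨.of_forall fun s => (hasDerivAt_averaged_comp (h1 s)).differentiableAt, ?_⟩
  have h3 : deriv (averaged ∘ γ) = fun s => 1 / (2 * Real.pi) *
      ⟪orbitMul δ (γ s) (γ s), orbitMul δ (γ s) (deriv γ s)⟫_ℝ :=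
    funext fun s => (hasDerivAt_averaged_comp (h1 s)).deriv
  rw [h3]
  refine (hasDerivAt_averaged_comp_deriv (h1 0) h2).congr_deriv ?_
  have h4 := (hasDerivAt_bilinear (energyForm δ) (h1 0) h2)
  have h5 : (fun s => energyForm δ (γ s) (deriv γ s)) = fun _ => (0 : ℝ) :=
    funext fun s => energyForm_deriv_of_mem (h1 s) hm
  rw [h5] at h4
  have h6 := h4.unique (hasDerivAt_const 0 _)
  rw [h0, mode_eq] at h6 ⊢
  rw [hX] at h6 ⊢
  rw [← hessForm_apply, ← hessForm_apply, hessForm_mode_eq_energyForm hκ, secondDiff_apply]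
  linear_combination h6

/-! ### Definiteness -/

theorem kappa_ne_zero {κ : ℝ} (hκ : κ ^ 2 = 8 * (δ : ℝ) ^ 2 / (3 * C0000 δ)) : κ ≠ 0 := by
  rintro rfl
  have hd := two_le_delta_real (δ := δ)
  have hG := quadCoeff_zero_zero_pos (δ := δ)
  rw [C0000_eq] at hκ
  have : 0 < 8 * (δ : ℝ) ^ 2 / (3 * quadCoeff δ 0 0) := by positivity
  rw [← hκ] at this
  simp at this

theorem kappa_sq_mul_quadCoeff {κ : ℝ} (hκ : κ ^ 2 = 8 * (δ : ℝ) ^ 2 / (3 * C0000 δ)) :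
    3 * κ ^ 2 * quadCoeff δ 0 0 = 8 * δ ^ 2 := by
  have hG := (quadCoeff_zero_zero_pos (δ := δ)).ne'
  rw [C0000_eq] at hκ
  rw [hκ]; field_simp

/-- The coercivity of the negative second differential, in terms of the energy. -/
theorem hessForm_le_energy (hδ : δ ≤ 9) {κ : ℝ} (hκ : κ ^ 2 = 8 * (δ : ℝ) ^ 2 / (3 * C0000 δ))
    {ρ : ℝ} (hρ : ρ ^ 2 ≤ κ ^ 2) {Y : Phase δ} (ha : posCoeff 0 Y = 0) (hb : momCoeff 0 Y = 0) :
    300 * hessForm (modeVec δ 0 ρ 0) Y Y ≤ 196 * Real.pi * harmonicEnergy Y := by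
  have h1 := hessForm_self_le hδ ρ ha hb
  have h2 := kappa_sq_mul_quadCoeff hκ
  have hG := quadCoeff_zero_zero_pos (δ := δ)
  have hd : (0 : ℝ) < δ := by have := two_le_delta_real (δ := δ); positivity
  have hE : 0 ≤ harmonicEnergy Y := (sq_nonneg _).trans (norm_sq_le_harmonicEnergy Y)
  have h3 : 98 * quadCoeff δ 0 0 * ρ ^ 2 * (Real.pi / 2) * harmonicEnergy Y ≤
      98 * quadCoeff δ 0 0 * κ ^ 2 * (Real.pi / 2) * harmonicEnergy Y := by
    gcongr
  have h4 : 98 * quadCoeff δ 0 0 * κ ^ 2 * (Real.pi / 2) * harmonicEnergy Y =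
      98 * (8 * δ ^ 2 / 3) * (Real.pi / 2) * harmonicEnergy Y := by
    linear_combination 98 / 3 * (Real.pi / 2) * harmonicEnergy Y * h2
  have h5 : 0 < (δ : ℝ) ^ 2 := by positivity
  refine le_of_mul_le_mul_left ?_ h5
  linear_combination 3 / 2 * (h1.trans (h3.trans h4.le))

/-- The constant is `1 - 98/100`, and the energy dominates the squared norm. -/
theorem coercive_secondDiff (hδ : δ ≤ 9) {κ : ℝ}
    (hκ : κ ^ 2 = 8 * (δ : ℝ) ^ 2 / (3 * C0000 δ)) (X : tangentSurface δ κ)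
    (hX : (X : Phase δ) ∈ (tangentOrbit δ κ)ᗮ) :
    1 / 50 * ‖X‖ ^ 2 ≤ -secondDiff δ κ X X := by
  have hκ0 := kappa_ne_zero hκ
  have ha := (mem_tangentSurface_iff hκ0 _).1 X.2
  have hb := (mem_tangentOrbit_orthogonal_iff hκ0 _).1 hX
  have h1 := hessForm_le_energy hδ hκ le_rfl ha hb
  have h2 := norm_sq_le_harmonicEnergy (X : Phase δ)
  have h3 : 3 / (2 * Real.pi) * hessForm (modeVec δ 0 κ 0) (X : Phase δ) (X : Phase δ) ≤
      98 / 100 * harmonicEnergy (X : Phase δ) := by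
    rw [div_mul_eq_mul_div, div_le_iff₀ (by positivity)]
    linear_combination 1 / 100 * h1
  rw [secondDiff_apply, energyForm_self, Submodule.coe_norm]
  linarith

/-- In the direction `(e_1, 0)` the second differential is nonnegative, by `le_quadCoeff_one`. -/
theorem not_coercive_secondDiff (hδ : 10 ≤ δ) {κ : ℝ}
    (hκ : κ ^ 2 = 8 * (δ : ℝ) ^ 2 / (3 * C0000 δ)) {c : ℝ} (hc : 0 < c)
    (h : ∀ X : tangentSurface δ κ, (X : Phase δ) ∈ (tangentOrbit δ κ)ᗮ →
      c * ‖X‖ ^ 2 ≤ -secondDiff δ κ X X) : False := by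
  have hκ0 := kappa_ne_zero hκ
  have ha : modeVec δ 1 1 0 ∈ tangentSurface δ κ := by
    rw [mem_tangentSurface_iff hκ0, posCoeff_modeVec, if_neg one_ne_zero]
  have hb : modeVec δ 1 1 0 ∈ (tangentOrbit δ κ)ᗮ := by
    rw [mem_tangentOrbit_orthogonal_iff hκ0, momCoeff_modeVec, if_neg one_ne_zero]
  have h1 := h ⟨_, ha⟩ hb
  rw [secondDiff_apply, energyForm_self, Submodule.coe_norm, harmonicEnergy_modeVec,
    hessForm_apply, inner_orbitMul_modeVec,
    integral_cos_sq_mul_posAt_sq one_le_delta one_ne_zero] at h1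
  have h2 := le_quadCoeff_one hδ
  have h3 := kappa_sq_mul_quadCoeff hκ
  have hG := quadCoeff_zero_zero_pos (δ := δ)
  have hw := omega_pos (δ := δ) 1
  have h4 : 0 < ‖modeVec δ 1 1 0‖ ^ 2 := by
    have := harmonicEnergy_le (modeVec δ 1 1 0)
    rw [harmonicEnergy_modeVec] at this
    have h5 : 0 < omega δ 1 ^ 2 * 1 ^ 2 + 0 ^ 2 := by positivity
    exact pos_of_mul_pos_right (h5.trans_le this) (by positivity)
  have h5 : 3 / (2 * Real.pi) * (κ ^ 2 * quadCoeff δ 1 1 *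
      (Real.pi / 2 * (1 ^ 2 + 0 ^ 2 / omega δ 1 ^ 2))) = 3 / 4 * (κ ^ 2 * quadCoeff δ 1 1) := by
    have := Real.pi_pos.ne'
    field_simp
    ring
  rw [h5] at h1
  have h6 := h1.trans_lt' (mul_pos hc h4)
  have h7 : 0 < κ ^ 2 := by positivity
  have h8 := mul_le_mul_of_nonneg_left h2 h7.le
  have h9 := mul_pos h6 hG
  nlinarith

/-! ### Local maximality -/

/-- Moving along the orbit only shifts the window of integration over a full period. -/
theorem averaged_linearFlow (s : ℝ) (ζ : Phase δ) : averaged (linearFlow s ζ) = averaged ζ := by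
  have hp : Function.Periodic (fun t => quartic (linearFlow t ζ)) (2 * Real.pi) := fun t => by
    simp only [linearFlow_periodic ζ t]
  rw [averaged, averaged]
  congr 1
  simp only [linearFlow_linearFlow]
  rw [intervalIntegral.integral_comp_add_right (fun t => quartic (linearFlow t ζ)), zero_add,
    add_comm _ s]
  exact hp.intervalIntegral_add_eq s 0 |>.trans (by rw [zero_add])

theorem exists_momCoeff_linearFlow_eq_zero (ζ : Phase δ) :
    ∃ s, momCoeff 0 (linearFlow s ζ) = 0 := by
  have hd : (δ : ℝ) ≠ 0 := by have := two_le_delta_real (δ := δ); positivity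
  simp only [momCoeff_linearFlow, omega_zero, momAt]
  by_cases ha : posCoeff 0 ζ = 0
  · refine ⟨Real.pi / 2 / δ, ?_⟩
    rw [ha, mul_div_cancel₀ _ hd, Real.cos_pi_div_two]
    simp
  · refine ⟨Real.arctan (momCoeff 0 ζ / (δ * posCoeff 0 ζ)) / δ, ?_⟩
    rw [mul_div_cancel₀ _ hd]
    set x := momCoeff 0 ζ / (δ * posCoeff 0 ζ) with hx
    have h1 : Real.sin (Real.arctan x) = x * Real.cos (Real.arctan x) := by
      rw [Real.sin_arctan, Real.cos_arctan]; ring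
    have h2 : momCoeff 0 ζ = x * (δ * posCoeff 0 ζ) := by rw [hx]; field_simp
    rw [h1, h2]
    ring

/-- The energy of the lowest mode. -/
def lowEnergy (ζ : Phase δ) : ℝ := (δ : ℝ) ^ 2 * posCoeff 0 ζ ^ 2 + momCoeff 0 ζ ^ 2

theorem lowEnergy_linearFlow (s : ℝ) (ζ : Phase δ) : lowEnergy (linearFlow s ζ) = lowEnergy ζ := by
  have hd : (δ : ℝ) ≠ 0 := by have := two_le_delta_real (δ := δ); positivity
  rw [lowEnergy, lowEnergy, posCoeff_linearFlow, momCoeff_linearFlow, omega_zero, posAt, momAt]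
  field_simp
  linear_combination ((δ : ℝ) ^ 2 * posCoeff 0 ζ ^ 2 + momCoeff 0 ζ ^ 2) *
    Real.sin_sq_add_cos_sq (δ * s)

theorem continuous_lowEnergy {δ : ℕ} : Continuous (lowEnergy (δ := δ)) := by
  have h1 : Continuous fun ζ : Phase δ => posCoeff 0 ζ :=
    (posL δ).continuous.inner continuous_const
  have h2 : Continuous fun ζ : Phase δ => momCoeff 0 ζ :=
    (momL δ).continuous.inner continuous_const
  unfold lowEnergy
  fun_prop

/-- The factor `6` is `2` from the cross term with `q(Y, Y)` plus `4` from `‖2 q(ξ, Y)‖²`, which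
agree by total symmetry. -/
theorem norm_sq_orbitMul_add {ξ Y : Phase δ} (h : hessForm ξ ξ Y = 0) :
    ‖orbitMul δ (ξ + Y) (ξ + Y)‖ ^ 2 = ‖orbitMul δ ξ ξ‖ ^ 2 + 6 * hessForm ξ Y Y +
      4 * ⟪orbitMul δ ξ Y, orbitMul δ Y Y⟫_ℝ + ‖orbitMul δ Y Y‖ ^ 2 := by
  have e : orbitMul δ (ξ + Y) (ξ + Y) =
      orbitMul δ ξ ξ + ((2 : ℝ) • orbitMul δ ξ Y + orbitMul δ Y Y) := by
    rw [map_add, map_add, add_apply, add_apply,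
      orbitMul_comm Y ξ]
    module
  rw [e, norm_add_sq_real, norm_add_sq_real, inner_add_right, real_inner_smul_right,
    real_inner_smul_left, norm_smul, mul_pow, ← real_inner_self_eq_norm_sq (orbitMul δ ξ Y),
    inner_orbitMul_comm ξ Y ξ Y, ← hessForm_apply, ← hessForm_apply, h]
  norm_num
  ring

theorem harmonicEnergy_add {δ : ℕ} {ξ Y : Phase δ} (h : energyForm δ ξ Y = 0) :
    harmonicEnergy (ξ + Y) = harmonicEnergy ξ + harmonicEnergy Y := by
  rw [← energyForm_self, map_add, map_add, add_apply,
    add_apply, energyForm_comm Y ξ, h, energyForm_self, energyForm_self]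
  ring

/-- The factor controlling the higher order terms of `averaged` near the mode. -/
def gapFactor (δ : ℕ) (κ M h : ℝ) : ℝ :=
  -(2 / 25 * Real.pi) + 2 * Real.pi * h / (κ ^ 2 * δ ^ 2) +
    4 * M ^ 2 * (δ * |κ|) * Real.sqrt h + M ^ 2 * h

/-- Write `η = ρ e₀ + Y` with `Y` free of mode `0`. On the energy surface `h = h_Ω(Y) = δ² (κ² -
ρ²)`, and `8π (⟨f⟩(η) - ⟨f⟩(ξ))` is at most `h · gapFactor`. -/
theorem averaged_le_of_gapFactor (hδ : δ ≤ 9) {κ : ℝ}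
    (hκ : κ ^ 2 = 8 * (δ : ℝ) ^ 2 / (3 * C0000 δ)) {η : Phase δ} (hη : η ∈ energySurface δ κ)
    (hb : momCoeff 0 η = 0) {M : ℝ} (hM : 0 ≤ M)
    (hq : ∀ A B : Phase δ, ‖orbitMul δ A B‖ ≤ M * ‖A‖ * ‖B‖)
    (hF : gapFactor δ κ M (κ ^ 2 * δ ^ 2 - lowEnergy η) ≤ 0) :
    averaged η ≤ averaged (mode δ κ) := by
  have hκ0 := kappa_ne_zero hκ
  have hd : (0 : ℝ) < δ := by have := two_le_delta_real (δ := δ); positivity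
  set ρ := posCoeff 0 η with hρ
  set Y := η - modeVec δ 0 ρ 0 with hY
  have hsum : modeVec δ 0 ρ 0 + Y = η := by rw [hY]; abel
  have ha' : posCoeff 0 Y = 0 := by
    have := congrArg (posCoeff 0) hsum
    rw [posCoeff_add, posCoeff_modeVec, if_pos rfl] at this
    linarith
  have hb' : momCoeff 0 Y = 0 := by
    have := congrArg (momCoeff 0) hsum
    rw [momCoeff_add, momCoeff_modeVec, if_pos rfl] at this
    linarith
  have hE : harmonicEnergy Y = κ ^ 2 * δ ^ 2 - lowEnergy η := by
    have h1 := harmonicEnergy_add (ξ := modeVec δ 0 ρ 0) (Y := Y) (by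
      rw [energyForm_modeVec_left, ha']; simp)
    rw [hsum, harmonicEnergy_modeVec, omega_zero, show harmonicEnergy η = _ from hη] at h1
    rw [lowEnergy, ← hρ, hb]
    linarith
  have hE' : harmonicEnergy Y = δ ^ 2 * (κ ^ 2 - ρ ^ 2) := by
    rw [hE, lowEnergy, ← hρ, hb]; ring
  rw [← hE] at hF
  set h := harmonicEnergy Y with hh
  have h0 : 0 ≤ h := (sq_nonneg _).trans (norm_sq_le_harmonicEnergy Y)
  have hρκ : ρ ^ 2 ≤ κ ^ 2 := by
    have : 0 ≤ (δ : ℝ) ^ 2 * (κ ^ 2 - ρ ^ 2) := hE' ▸ h0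
    have := nonneg_of_mul_nonneg_right this (by positivity)
    linarith
  have hN := hessForm_le_energy hδ hκ hρκ ha' hb'
  have hP : ∀ r : ℝ, ‖orbitMul δ (modeVec δ 0 r 0) (modeVec δ 0 r 0)‖ ^ 2 =
      3 / 4 * Real.pi * r ^ 4 * quadCoeff δ 0 0 := fun r => by
    rw [← real_inner_self_eq_norm_sq, ← hessForm_apply, hessForm_mode_left, posCoeff_modeVec,
      if_pos rfl]
    ring
  have hYn : ‖Y‖ ≤ Real.sqrt h := Real.le_sqrt_of_sq_le (norm_sq_le_harmonicEnergy Y)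
  have hξn : ‖modeVec δ 0 ρ 0‖ ≤ δ * |κ| := by
    refine abs_le_of_sq_le_sq' ?_ (by positivity) |>.2
    refine (norm_sq_le_harmonicEnergy _).trans ?_
    rw [harmonicEnergy_modeVec, omega_zero, mul_pow, sq_abs]
    nlinarith [mul_le_mul_of_nonneg_left hρκ (sq_nonneg (δ : ℝ))]
  have hYY : ‖orbitMul δ Y Y‖ ≤ M * h := by
    refine (hq Y Y).trans ?_
    rw [mul_assoc, ← sq]
    exact mul_le_mul_of_nonneg_left (norm_sq_le_harmonicEnergy Y) hM
  have hξY : ‖orbitMul δ (modeVec δ 0 ρ 0) Y‖ ≤ M * (δ * |κ|) * Real.sqrt h :=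
    (hq _ _).trans (by gcongr)
  have hc : ⟪orbitMul δ (modeVec δ 0 ρ 0) Y, orbitMul δ Y Y⟫_ℝ ≤
      M * (δ * |κ|) * Real.sqrt h * (M * h) :=
    (real_inner_le_norm _ _).trans (mul_le_mul hξY hYY (norm_nonneg _) (by positivity))
  have hf : ‖orbitMul δ Y Y‖ ^ 2 ≤ (M * h) ^ 2 :=
    pow_le_pow_left₀ (norm_nonneg _) hYY 2
  -- Substituting `ρ² = κ² - h/δ²` turns the loss in the pure quartic term into `-4π h` up to a
  -- quadratic error.
  have hPP : 3 / 4 * Real.pi * ρ ^ 4 * quadCoeff δ 0 0 - 3 / 4 * Real.pi * κ ^ 4 * quadCoeff δ 0 0 =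
      -(4 * Real.pi * h) + 2 * Real.pi * h / (κ ^ 2 * δ ^ 2) * h := by
    have h2 := kappa_sq_mul_quadCoeff hκ
    have h3 : quadCoeff δ 0 0 = 8 * δ ^ 2 / (3 * κ ^ 2) := by
      field_simp; linarith
    rw [h3, hE']
    field_simp
    ring
  have hfin : h * gapFactor δ κ M h ≤ 0 := mul_nonpos_of_nonneg_of_nonpos h0 hF
  rw [gapFactor] at hfin
  rw [averaged_eq, averaged_eq, mode_eq, hP κ, ← hsum, norm_sq_orbitMul_add (by
    rw [hessForm_mode_left, ha', mul_zero]), hP ρ]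
  refine mul_le_mul_of_nonneg_left ?_ (by positivity)
  -- The leading terms are `-4π h` from `hPP` and at most `6 · 196π h / 300 = (98/25) π h` from the
  -- Hessian; their sum is `-(2/25) π h`.
  linear_combination hPP + 1 / 50 * hN + 4 * hc + hf + hfin

/-- Smallness is required only of the gap `κ² δ² - lowEnergy`, which is continuous, zero at `ξ` and
invariant under the flow. A nearby point may thus be rotated along its orbit, even far from `ξ`,
before the estimate is applied. -/
theorem isLocalMaxOn_mode (hδ : δ ≤ 9) {κ : ℝ}
    (hκ : κ ^ 2 = 8 * (δ : ℝ) ^ 2 / (3 * C0000 δ)) :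
    IsLocalMaxOn averaged (energySurface δ κ) (mode δ κ) := by
  obtain ⟨M, hM, hq⟩ := exists_bilinear_bound (orbitMul δ)
  have hc : Continuous fun ζ : Phase δ => gapFactor δ κ M (κ ^ 2 * δ ^ 2 - lowEnergy ζ) := by
    have := continuous_lowEnergy (δ := δ)
    unfold gapFactor
    fun_prop
  have h0 : gapFactor δ κ M (κ ^ 2 * δ ^ 2 - lowEnergy (mode δ κ)) < 0 := by
    rw [mode_eq, lowEnergy, posCoeff_modeVec, momCoeff_modeVec, if_pos rfl, if_pos rfl,
      show κ ^ 2 * (δ : ℝ) ^ 2 - (δ ^ 2 * κ ^ 2 + 0 ^ 2) = 0 by ring, gapFactor]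
    simp [Real.pi_pos]
  have h1 := (hc.tendsto (mode δ κ)).eventually (gt_mem_nhds h0)
  filter_upwards [mem_nhdsWithin_of_mem_nhds h1, self_mem_nhdsWithin] with ζ hζ hm
  obtain ⟨s, hs⟩ := exists_momCoeff_linearFlow_eq_zero ζ
  rw [← averaged_linearFlow s ζ]
  refine averaged_le_of_gapFactor hδ hκ ?_ hs hM hq ?_
  · change harmonicEnergy (linearFlow s ζ) = _
    rw [harmonicEnergy_linearFlow]; exact hm
  · rw [lowEnergy_linearFlow]; exact le_of_lt hζ

end

end KG

theorem mainTheorem7 (δ : ℕ) (hδ : 2 ≤ δ) (κ₀ : ℝ)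
    (hκ₀ : κ₀ ^ 2 = 8 * (δ : ℝ) ^ 2 / (3 * KG.C0000 δ)) :
    (∀ ζ : KG.Phase δ, ∃! φ : ℝ → KG.Phase δ, KG.IsLinearSolution ζ φ) ∧
    KG.mode δ κ₀ ∈ KG.energySurface δ κ₀ ∧
    KG.IsCriticalPointOn KG.averaged (KG.energySurface δ κ₀) (KG.mode δ κ₀) ∧
    ∃ B : KG.tangentSurface δ κ₀ →L[ℝ] KG.tangentSurface δ κ₀ →L[ℝ] ℝ,
      KG.IsSecondDifferentialOn KG.averaged (KG.energySurface δ κ₀) (KG.mode δ κ₀)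
        (KG.tangentSurface δ κ₀) B ∧
      (δ ∈ Finset.Icc 2 9 ↔
        ∃ c : ℝ, 0 < c ∧ ∀ X : KG.tangentSurface δ κ₀,
          (X : KG.Phase δ) ∈ (KG.tangentOrbit δ κ₀)ᗮ → c * ‖X‖ ^ 2 ≤ -B X X) ∧
      (δ ∈ Finset.Icc 2 9 →
        IsLocalMaxOn KG.averaged (KG.energySurface δ κ₀) (KG.mode δ κ₀)) := by
  have : Fact (2 ≤ δ) := ⟨hδ⟩
  refine ⟨KG.existsUnique_isLinearSolution, ?_, KG.isCriticalPointOn_mode hκ₀,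
    KG.secondDiff δ κ₀, KG.isSecondDifferentialOn_mode hκ₀, ⟨fun h => ?_, fun h => ?_⟩,
    fun h => KG.isLocalMaxOn_mode (Finset.mem_Icc.1 h).2 hκ₀⟩
  · change KG.harmonicEnergy _ = _
    rw [KG.mode_eq, KG.harmonicEnergy_modeVec, KG.omega_zero]
    ring
  · exact ⟨1 / 50, by norm_num, KG.coercive_secondDiff (Finset.mem_Icc.1 h).2 hκ₀⟩
  · obtain ⟨c, hc, h⟩ := h
    refine Finset.mem_Icc.2 ⟨hδ, ?_⟩
    by_contra h9
    exact KG.not_coercive_secondDiff (by omega) hκ₀ hc h
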